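/- **Setting.** Let $1<\gamma<2$, $\mathsf C_V>0$, $\mathsf G>0$, $\Omega\in\mathbb R$. For a set $D$ let $\mathcal K_D[g](x)=\frac1{4\pi}\int_{D}\frac{g(y)}{\|x-y\|}\,dy$. Let $(\rho,S,v)$ be an *admissible barotropic stationary solution* of the Euler–Poisson equations in the rotating frame, that is: $\rho\in C^1_0(\mathbb R^3;[0,\infty))$, $S\in C^1(\mathbb R^3)$, $v\in C^1(\mathbb R^3;\mathbb R^3)$ and, with $P=\rho^\gamma e^{S/\mathsf C_V}$, $\Phi=-4\pi\mathsf G\,\mathcal K_{\mathbb R^3}[\rho]$, $\mathbf\Omega=\Omega e_3$, $$\mathrm{div}(\rho v)=0,\quad \rho\big[(v\cdot\nabla)v+2\mathbf\Omega\times v\big]+\nabla P+\rho\nabla\big[\Phi-\tfrac12\|\mathbf\Omega\times x\|^2\big]=0,\quad \rho\,v\cdot\nabla S=0\quad\text{on }\mathbb R^3;$$ the set $\mathfrak R=\{\rho>0\}$ is a bounded domain with $C^\infty$ boundary; $v=\omega(\varpi)(-x^2,x^1,0)^\top$ with $\varpi=\sqrt{(x^1)^2+(x^2)^2}$ and $\omega$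 smooth on $[0,\infty)$; $\rho$ and $S$ are functions of $r=\|x\|$ and $\zeta=x^3/r$, and $\mathfrak R=\{r<R_b(\zeta)\}$ with $R_b$ continuous and positive on $[-1,1]$; $\rho^{\gamma-1},S,\Phi\in C^\infty(\mathfrak R)\cap C^{3,\alpha}(\overline{\mathfrak R})$ for some $0<\alpha<\min(\frac1{\gamma-1}-1,1)$; $\partial_r\rho<0$ and $\partial_rP<0$ on $\mathfrak R\setminus\{0\}$; at each boundary point the derivative of $\rho^{\gamma-1}$ along the inward unit normal is positive and finite; and $P=F(\rho^{\gamma-1})$ on $\mathfrak R$ for some $F\in C^\infty((0,\infty))$. Put $\mathfrak a=-\frac1{\gamma\mathsf C_V}\nabla S$, $n=\nabla\rho/\|\nabla\rho\|$ ($n=0$ where $\nabla\rho=0$), $\mathscr A=-\mathfrak a\cdot n$, $\rho_O=\rho(0)$, and $$\kappa_1=\sup_{\mathfrak R}|\mathscr A|\sqrt{\gamma P/\rho},\qquad \kappa_2=\sup_{\mathfrak R}\frac{\gamma P|\mathscr A|}{\rho^2}\|\nabla\rho\|,\qquad a=2\kappa_1^2+\kappa_2+4\pi\mathsf G\rho_O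 .$$ For a $\mathbb C^3$-valued field $u$ on $\mathfrak R$ let $$\mathcal Lu=\frac1\rho\nabla\delta P-\frac{\delta\rho}{\rho^2}\nabla P+\nabla\delta\Phi,\quad \delta\rho=-\mathrm{div}(\rho u),\quad \delta P=\frac{\gamma P}{\rho}\delta\rho+\gamma P\,(u|\mathfrak a),\quad \delta\Phi=4\pi\mathsf G\,\mathcal K_{\mathfrak R}[-\delta\rho],$$ where $(u_1|u_2)=\sum_k u_1^k\overline{u_2^k}$. Let $\mathfrak H=L^2(\mathfrak R,\rho\,dx;\mathbb C^3)$. Let $\mathfrak G$ be the space of $u\in\mathfrak H$ whose distributional divergence $\mathrm{div}(\rho u)$ lies in $L^2(\mathfrak R,\frac{\gamma P}{\rho^2}dx)$, with $(u_1|u_2)_{\mathfrak G}=(u_1|u_2)_{\mathfrak H}+\int_{\mathfrak R}\frac{\gamma P}{\rho^2}\mathrm{div}(\rho u_1)\overline{\mathrm{div}(\rho u_2)}\,dx$, and let $\mathfrak G_0$ be the closure of $C_0^\infty(\mathfrak R;\mathbb C^3)$ in $\mathfrak G$. For $u_1,u_2\in\mathfrak G$ and $g_j=\mathrm{div}(\rho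 u_j)$ let $$Q_0(u_1,u_2)=\int_{\mathfrak R}\frac{\gamma P}{\rho^2}g_1\overline{g_2}+\int_{\mathfrak R}\frac{\gamma P\mathscr A}{\rho}\big[(u_1|n)\overline{g_2}+g_1\overline{(u_2|n)}\big]-\int_{\mathfrak R}\frac{\gamma P\mathscr A}{\rho}\|\nabla\rho\|(u_1|n)\overline{(u_2|n)}-4\pi\mathsf G\int_{\mathfrak R}\mathcal K_{\mathfrak R}[g_1]\overline{g_2},$$ and $Q_a(u_1,u_2)=Q_0(u_1,u_2)+a(u_1|u_2)_{\mathfrak H}$. **Theorem.** We have $\mathfrak a=-\mathscr An$ on $\mathfrak R$, the constants $\kappa_1,\kappa_2$ are finite, and $\mathfrak G$ is a Hilbert space. Moreover: 1. $\mathcal L$ maps $C_0^\infty(\mathfrak R;\mathbb C^3)$ into $\mathfrak H$, and its restriction to $C_0^\infty(\mathfrak R;\mathbb C^3)$ is a densely defined symmetric operator in $\mathfrak H$ with $(\mathcal Lu_1|u_2)_{\mathfrak H}=Q_0(u_1,u_2)$ and $(\mathcal Lu|u)_{\mathfrak H}\ge-a\|u\|_{\mathfrak H}^2$. 2. This operator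 has a Friedrichs extension $L$ (the operator associated with the closure of the form $(\mathcal Lu_1|u_2)_{\mathfrak H}$). $L$ is a self-adjoint extension of it, with domain $$\mathsf D(L)=\{u\in\mathfrak G_0\mid\mathcal Lu\in\mathfrak H\}$$ ($\mathcal Lu$ in the sense of distributions on $\mathfrak R$), $Lu=\mathcal Lu$ for $u\in\mathsf D(L)$, and $((L+a)u_1|u_2)_{\mathfrak H}=Q_a(u_1,u_2)$ for all $u_1\in\mathsf D(L)$, $u_2\in\mathfrak G_0$. 3. For all $u\in\mathfrak G$, $Q_a(u,u)$ is real and $$\frac12\int_{\mathfrak R}\frac{\gamma P}{\rho^2}|\mathrm{div}(\rho u)|^2dx\le Q_a(u,u)\le\frac32\int_{\mathfrak R}\frac{\gamma P}{\rho^2}|\mathrm{div}(\rho u)|^2dx+(2\kappa_1^2+\kappa_2+a)\|u\|_{\mathfrak H}^2 .$$ Hence there is $C>0$ with $\frac1C\|u\|_{\mathfrak G}^2\le\|u\|_{\mathfrak H}^2+Q_a(u,u)\le C\|u\|_{\mathfrak G}^2$ for all $u\in\mathfrak G$. -/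

import Mathlib

open MeasureTheory Filter Topology
open scoped ContDiff NNReal ENNReal

noncomputable section

/-- Physical space. -/
abbrev E3 : Type := EuclideanSpace ℝ (Fin 3)

/-- Values of complex vector fields. -/
abbrev V3 : Type := EuclideanSpace ℂ (Fin 3)

namespace Star

/-! ### Vector calculus -/

/-- The partial derivative `∂f/∂xⁱ`. -/
def pd {F : Type*} [NormedAddCommGroup F] [NormedSpace ℝ F] (i : Fin 3) (f : E3 → F) (x : E3) : F :=
  fderiv ℝ f x (EuclideanSpace.single i 1)

/-- Divergence of a complex vector field. -/
def divC (u : E3 → V3) (x : E3) : ℂ := ∑ i, pd i (fun y => u y i) x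

/-- Gradient of a complex scalar field. -/
def gradC (f : E3 → ℂ) (x : E3) : V3 := WithLp.toLp 2 fun i => pd i f x

/-- Divergence of a real vector field. -/
def divR (v : E3 → E3) (x : E3) : ℝ := ∑ i, pd i (fun y => v y i) x

/-- Regard a real vector as a complex one. -/
def toV (a : E3) : V3 := WithLp.toLp 2 fun i => (a i : ℂ)

/-- The bilinear product `∑ aᵢ uᵢ` of a real and a complex vector; it is `(u | a)` for real `a`. -/
def rdot (a : E3) (u : V3) : ℂ := ∑ i, (a i : ℂ) * u i

/-- The bilinear product `∑ wᵢ uᵢ` of complex vectors (no conjugation). -/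
def cdot (w u : V3) : ℂ := ∑ i, w i * u i

/-- The Newton potential operator `𝒦[g](x) = (1/4π) ∫_D g(y) / ‖x - y‖ dy`. -/
def newtonK {F : Type*} [NormedAddCommGroup F] [NormedSpace ℝ F]
    (D : Set E3) (g : E3 → F) (x : E3) : F :=
  (4 * Real.pi)⁻¹ • ∫ y in D, (‖x - y‖)⁻¹ • g y

/-- `φ ∈ C₀^∞(D; F)`. -/
def IsTest {F : Type*} [NormedAddCommGroup F] [NormedSpace ℝ F] (D : Set E3) (φ : E3 → F) : Prop :=
  ContDiff ℝ ∞ φ ∧ HasCompactSupport φ ∧ tsupport φ ⊆ D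

/-- `n` is the inward unit normal of `D` at `x`, read off from a smooth local defining function. -/
def IsInwardUnitNormal (D : Set E3) (x n : E3) : Prop :=
  ∃ f : E3 → ℝ, ∃ U ∈ 𝓝 x, ContDiff ℝ ∞ f ∧ (∀ y ∈ U, y ∈ D ↔ 0 < f y) ∧
    gradient f x ≠ 0 ∧ n = (‖gradient f x‖)⁻¹ • gradient f x

/-- Bounded domain with `C^∞` boundary. -/
def IsBoundedSmoothDomain (D : Set E3) : Prop :=
  IsOpen D ∧ IsConnected D ∧ Bornology.IsBounded D ∧
    ∀ x ∈ frontier D, ∃ n, IsInwardUnitNormal D x n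

/-- `f ∈ C^{k,α}(D ∪ ∂D)` for a bounded open set `D`: the derivatives up to order `k` extend
continuously to the closure (uniform continuity on the bounded set `D`), and those of order `k`
are Hölder continuous with exponent `α`. -/
def HolderUpToBoundary (k : ℕ) (α : ℝ≥0) (f : E3 → ℝ) (D : Set E3) : Prop :=
  ContDiffOn ℝ k f D ∧
    (∀ j ≤ k, UniformContinuousOn (iteratedFDerivWithin ℝ j f D) D) ∧
    ∃ C : ℝ≥0, HolderOnWith C α (iteratedFDerivWithin ℝ k f D) D

/-- Equation of state `P = ρ^γ exp (S / C_V)`. -/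
def pressureOf (γ CV : ℝ) (ρ S : E3 → ℝ) (x : E3) : ℝ := ρ x ^ γ * Real.exp (S x / CV)

end Star

open Star

/-- An admissible barotropic stationary solution `(ρ, S, v)` of the Euler-Poisson equations in a
frame rotating with angular velocity `Ω` about the third axis. -/
structure BarotropicStar where
  (γ CV G Ω : ℝ)
  (ρ S : E3 → ℝ)
  (v : E3 → E3)
  one_lt_γ : 1 < γ
  γ_lt_two : γ < 2
  CV_pos : 0 < CV
  G_pos : 0 < G
  -- regularity on the whole space
  ρ_nonneg : ∀ x, 0 ≤ ρ x
  ρ_contDiff : ContDiff ℝ 1 ρ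
  ρ_compact : HasCompactSupport ρ
  S_contDiff : ContDiff ℝ 1 S
  v_contDiff : ContDiff ℝ 1 v
  -- conservation of mass, momentum and entropy, for time-independent fields
  mass : ∀ x, fderiv ℝ ρ x (v x) + ρ x * divR v x = 0
  momentum : ∀ x,
    ρ x • (fderiv ℝ v x (v x) + (2 * Ω) • !₂[-(v x 1), v x 0, 0])
      + gradient (pressureOf γ CV ρ S) x
      + ρ x • gradient (fun y => -(4 * Real.pi * G) * newtonK Set.univ ρ y
          - (1 / 2) * (Ω ^ 2 * (y 0 ^ 2 + y 1 ^ 2))) x = 0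
  entropy : ∀ x, ρ x * fderiv ℝ S x (v x) = 0
  -- the star is a bounded smooth domain
  domain_smooth : IsBoundedSmoothDomain {x | 0 < ρ x}
  -- differential rotation about the third axis
  rotation : ∃ om : ℝ → ℝ, ContDiffOn ℝ ∞ om (Set.Ici 0) ∧
    ∀ x, v x = om (√(x 0 ^ 2 + x 1 ^ 2)) • !₂[-(x 1), x 0, 0]
  -- `ρ` and `S` depend on `(r, ζ)` only
  ρ_axisymm : ∀ x y : E3, ‖x‖ = ‖y‖ → x 2 = y 2 → ρ x = ρ y
  S_axisymm : ∀ x y : E3, ‖x‖ = ‖y‖ → x 2 = y 2 → S x = S y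
  shape : ∃ Rb : ℝ → ℝ, ContinuousOn Rb (Set.Icc (-1) 1) ∧
    (∀ ζ ∈ Set.Icc (-1 : ℝ) 1, 0 < Rb ζ) ∧ {x | 0 < ρ x} = {x | ‖x‖ < Rb (x 2 / ‖x‖)}
  -- interior and boundary regularity
  ρ_smooth : ContDiffOn ℝ ∞ (fun x => ρ x ^ (γ - 1)) {x | 0 < ρ x}
  S_smooth : ContDiffOn ℝ ∞ S {x | 0 < ρ x}
  Φ_smooth : ContDiffOn ℝ ∞ (fun x => -(4 * Real.pi * G) * newtonK Set.univ ρ x) {x | 0 < ρ x}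
  boundary_regular : ∃ α : ℝ≥0, 0 < α ∧ (α : ℝ) < min (1 / (γ - 1) - 1) 1 ∧
    HolderUpToBoundary 3 α (fun x => ρ x ^ (γ - 1)) {x | 0 < ρ x} ∧
    HolderUpToBoundary 3 α S {x | 0 < ρ x} ∧
    HolderUpToBoundary 3 α (fun x => -(4 * Real.pi * G) * newtonK Set.univ ρ x) {x | 0 < ρ x}
  -- radial monotonicity
  ρ_radial : ∀ x, 0 < ρ x → x ≠ 0 → fderiv ℝ ρ x ((‖x‖)⁻¹ • x) < 0
  P_radial : ∀ x, 0 < ρ x → x ≠ 0 → fderiv ℝ (pressureOf γ CV ρ S) x ((‖x‖)⁻¹ • x) < 0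
  -- physical vacuum boundary
  vacuum : ∀ x ∈ frontier {x | 0 < ρ x}, ∀ n, IsInwardUnitNormal {x | 0 < ρ x} x n →
    ∃ c > 0, HasDerivWithinAt (fun t : ℝ => ρ (x + t • n) ^ (γ - 1)) c (Set.Ici 0) 0
  -- barotropy: the pressure is a smooth function of `ρ^(γ-1)`
  barotropic : ∃ F : ℝ → ℝ, ContDiffOn ℝ ∞ F (Set.Ioi 0) ∧
    ∀ x, 0 < ρ x → pressureOf γ CV ρ S x = F (ρ x ^ (γ - 1))

namespace BarotropicStar

variable (s : BarotropicStar)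

/-- The region `ℜ` occupied by the star. -/
def R : Set E3 := {x | 0 < s.ρ x}

/-- The pressure `P`. -/
def P (x : E3) : ℝ := pressureOf s.γ s.CV s.ρ s.S x

/-- The vector field `𝔞 = -(1/(γ C_V)) grad S`. -/
def 𝔞 (x : E3) : E3 := -((s.γ * s.CV)⁻¹ • gradient s.S x)

/-- The unit vector field `n = grad ρ / ‖grad ρ‖` (zero at a critical point of `ρ`). -/
def n (x : E3) : E3 := (‖gradient s.ρ x‖)⁻¹ • gradient s.ρ x

/-- The scalar field `𝒜` with `𝔞 = -𝒜 n`. -/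
def 𝒜 (x : E3) : ℝ := -inner ℝ (s.𝔞 x) (s.n x)

/-- `κ₁ = sup_ℜ |𝒜| √(γP/ρ)`. -/
def κ₁ : ℝ := sSup ((fun x => |s.𝒜 x| * √(s.γ * s.P x / s.ρ x)) '' s.R)

/-- `κ₂ = sup_ℜ (γP|𝒜|/ρ²) ‖grad ρ‖`. -/
def κ₂ : ℝ := sSup ((fun x => s.γ * s.P x * |s.𝒜 x| / s.ρ x ^ 2 * ‖gradient s.ρ x‖) '' s.R)

/-- The central density `ρ_O`. -/
def ρO : ℝ := s.ρ 0

/-- `a = 2κ₁² + κ₂ + 4πGρ_O`. -/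
def a : ℝ := 2 * s.κ₁ ^ 2 + s.κ₂ + 4 * Real.pi * s.G * s.ρO

/-! ### The integro-differential operator `𝓛` -/

/-- `δP = (γP/ρ) δρ + γP (u|𝔞)`. -/
def δP (δρ : E3 → ℂ) (u : E3 → V3) (x : E3) : ℂ :=
  ((s.γ * s.P x / s.ρ x : ℝ) : ℂ) * δρ x + ((s.γ * s.P x : ℝ) : ℂ) * rdot (s.𝔞 x) (u x)

/-- `δΦ = 4πG 𝒦[-δρ]`. -/
def δΦ (δρ : E3 → ℂ) (x : E3) : ℂ :=
  ((4 * Real.pi * s.G : ℝ) : ℂ) * newtonK s.R (fun y => -δρ y) x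

/-- `δρ = -div(ρu)` for a differentiable field `u`. -/
def δρ (u : E3 → V3) (x : E3) : ℂ := -divC (fun y => s.ρ y • u y) x

/-- `𝓛u = (1/ρ) grad δP - (δρ/ρ²) grad P + grad δΦ`, with classical derivatives. -/
def classicalL (u : E3 → V3) (x : E3) : V3 :=
  (s.ρ x)⁻¹ • gradC (s.δP (s.δρ u) u) x
    - (s.δρ u x / ((s.ρ x ^ 2 : ℝ) : ℂ)) • toV (gradient s.P x)
    + gradC (s.δΦ (s.δρ u)) x

/-! ### The Hilbert spaces `ℌ`, `𝔊`, `𝔊₀` -/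

/-- The measure `ρ dx` on `ℜ`. -/
def μ : Measure E3 := (volume.restrict s.R).withDensity fun x => ENNReal.ofReal (s.ρ x)

/-- The measure `(γP/ρ²) dx` on `ℜ`. -/
def ν : Measure E3 :=
  (volume.restrict s.R).withDensity fun x => ENNReal.ofReal (s.γ * s.P x / s.ρ x ^ 2)

/-- `ℌ = L²(ρ dx, ℜ; ℂ³)`. -/
abbrev H : Type := Lp V3 2 s.μ

/-- `L²((γP/ρ²) dx, ℜ; ℂ)`. -/
abbrev K : Type := Lp ℂ 2 s.ν

/-- `div(ρu) = g` on `ℜ` in the sense of distributions. -/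
def IsWeakDivRho (u : E3 → V3) (g : E3 → ℂ) : Prop :=
  LocallyIntegrableOn (fun x => s.ρ x • u x) s.R ∧ LocallyIntegrableOn g s.R ∧
    ∀ φ : E3 → ℝ, IsTest s.R φ →
      ∫ x in s.R, φ x • g x = -∫ x in s.R, rdot (gradient φ x) (s.ρ x • u x)

theorem measurable_ρ : Measurable s.ρ := s.ρ_contDiff.continuous.measurable

theorem measurable_P : Measurable s.P :=
  (s.measurable_ρ.pow_const _).mul
    (Real.measurable_exp.comp (s.S_contDiff.continuous.measurable.div_const _))

theorem measurableSet_R : MeasurableSet s.R := measurableSet_lt measurable_const s.measurable_ρ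

theorem isOpen_R : IsOpen s.R := isOpen_lt continuous_const s.ρ_contDiff.continuous

theorem ae_of_ae_μ {p : E3 → Prop} (h : ∀ᵐ x ∂s.μ, p x) : ∀ᵐ x ∂volume.restrict s.R, p x := by
  rw [μ, ae_withDensity_iff s.measurable_ρ.ennreal_ofReal] at h
  filter_upwards [h, ae_restrict_mem s.measurableSet_R] with x hx hR
  exact hx (by simpa [R] using hR)

theorem ae_of_ae_ν {p : E3 → Prop} (h : ∀ᵐ x ∂s.ν, p x) : ∀ᵐ x ∂volume.restrict s.R, p x := by
  have hm : Measurable fun x => ENNReal.ofReal (s.γ * s.P x / s.ρ x ^ 2) :=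
    ((s.measurable_P.const_mul _).div (s.measurable_ρ.pow_const _)).ennreal_ofReal
  rw [ν, ae_withDensity_iff hm] at h
  filter_upwards [h, ae_restrict_mem s.measurableSet_R] with x hx hR
  apply hx
  have hρ : 0 < s.ρ x := hR
  have hγ : 0 < s.γ := lt_trans one_pos s.one_lt_γ
  have hP : 0 < s.P x := mul_pos (Real.rpow_pos_of_pos hρ _) (Real.exp_pos _)
  simpa using (by positivity : 0 < s.γ * s.P x / s.ρ x ^ 2)

theorem integrableOn_smul_of_locallyIntegrableOn {F : Type*} [NormedAddCommGroup F]
    [NormedSpace ℝ F] {g : E3 → F} (hg : LocallyIntegrableOn g s.R) {φ : E3 → ℝ}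
    (hφ : Continuous φ) (hc : HasCompactSupport φ) (hs : tsupport φ ⊆ s.R) :
    IntegrableOn (fun x => φ x • g x) s.R := by
  have h1 : IntegrableOn (fun x => φ x • g x) (tsupport φ) :=
    (hg.integrableOn_compact_subset hs hc).continuousOn_smul hφ.continuousOn hc
  refine h1.of_forall_sdiff_eq_zero s.measurableSet_R fun x hx => ?_
  rw [image_eq_zero_of_notMem_tsupport hx.2, zero_smul]

theorem integrableOn_rdot {U : E3 → V3} (hU : LocallyIntegrableOn U s.R) {φ : E3 → ℝ}
    (hφ : IsTest s.R φ) : IntegrableOn (fun x => rdot (gradient φ x) (U x)) s.R := by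
  unfold rdot
  refine integrable_finsetSum _ fun i _ => ?_
  have hU' : LocallyIntegrableOn (fun x => U x i) s.R := fun x hx => by
    obtain ⟨t, ht, hi⟩ := hU x hx
    exact ⟨t, ht, (EuclideanSpace.proj (𝕜 := ℂ) i).integrable_comp hi⟩
  have hcont : Continuous (gradient φ) :=
    (InnerProductSpace.toDual ℝ E3).symm.continuous.comp
      (hφ.1.continuous_fderiv (by simp))
  have hsub : tsupport (fun x => gradient φ x i) ⊆ tsupport φ := by
    refine closure_minimal (fun x hx => ?_) (isClosed_tsupport φ)
    by_contra hn
    apply hx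
    have : fderiv ℝ φ x = 0 := by
      have := support_fderiv_subset ℝ (f := φ)
      by_contra h0
      exact hn (this h0)
    simp [gradient, this]
  have hc : HasCompactSupport (fun x => gradient φ x i) :=
    hφ.2.1.of_isClosed_subset (isClosed_tsupport _) hsub
  have := s.integrableOn_smul_of_locallyIntegrableOn hU'
    ((EuclideanSpace.proj (𝕜 := ℝ) i).continuous.comp hcont) hc (hsub.trans hφ.2.2)
  exact this.congr (ae_of_all _ fun x => Complex.real_smul)

theorem IsWeakDivRho.congr {u u' : E3 → V3} {g g' : E3 → ℂ} (h : s.IsWeakDivRho u g)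
    (hu : ∀ᵐ x ∂volume.restrict s.R, u x = u' x) (hg : ∀ᵐ x ∂volume.restrict s.R, g x = g' x) :
    s.IsWeakDivRho u' g' := by
  have key : ∀ {F : Type} [NormedAddCommGroup F] {f f' : E3 → F},
      LocallyIntegrableOn f s.R → (∀ᵐ x ∂volume.restrict s.R, f x = f' x) →
      LocallyIntegrableOn f' s.R := by
    intro F _ f f' hf he
    rw [locallyIntegrableOn_iff s.isOpen_R.isLocallyClosed] at hf ⊢
    intro k hk hkc
    exact (hf k hk hkc).congr (ae_restrict_of_ae_restrict_of_subset hk he)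
  refine ⟨key h.1 (hu.mono fun x hx => by simp only [hx]), key h.2.1 hg, fun φ hφ => ?_⟩
  have e1 : ∫ x in s.R, φ x • g x = ∫ x in s.R, φ x • g' x :=
    integral_congr_ae (hg.mono fun x hx => by simp only [hx])
  have e2 : ∫ x in s.R, rdot (gradient φ x) (s.ρ x • u x)
      = ∫ x in s.R, rdot (gradient φ x) (s.ρ x • u' x) :=
    integral_congr_ae (hu.mono fun x hx => by simp only [hx])
  rw [← e1, ← e2]
  exact h.2.2 φ hφ

theorem IsWeakDivRho.add {u u' : E3 → V3} {g g' : E3 → ℂ} (h : s.IsWeakDivRho u g)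
    (h' : s.IsWeakDivRho u' g') : s.IsWeakDivRho (u + u') (g + g') := by
  have e0 : (fun x => s.ρ x • (u + u') x) = (fun x => s.ρ x • u x) + fun x => s.ρ x • u' x := by
    funext x; simp
  refine ⟨e0 ▸ h.1.add h'.1, h.2.1.add h'.2.1, fun φ hφ => ?_⟩
  have e1 : ∀ x, φ x • (g + g') x = φ x • g x + φ x • g' x := fun x => by simp
  have e2 : ∀ x, rdot (gradient φ x) (s.ρ x • (u + u') x)
      = rdot (gradient φ x) (s.ρ x • u x) + rdot (gradient φ x) (s.ρ x • u' x) := fun x => by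
    simp only [rdot, ← Finset.sum_add_distrib]
    refine Finset.sum_congr rfl fun i _ => ?_
    simp; ring
  simp only [e1, e2]
  rw [integral_add (s.integrableOn_smul_of_locallyIntegrableOn h.2.1 hφ.1.continuous hφ.2.1 hφ.2.2)
    (s.integrableOn_smul_of_locallyIntegrableOn h'.2.1 hφ.1.continuous hφ.2.1 hφ.2.2),
    integral_add (s.integrableOn_rdot h.1 hφ) (s.integrableOn_rdot h'.1 hφ),
    h.2.2 φ hφ, h'.2.2 φ hφ]
  ring

theorem IsWeakDivRho.smul {u : E3 → V3} {g : E3 → ℂ} (c : ℂ) (h : s.IsWeakDivRho u g) :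
    s.IsWeakDivRho (c • u) (c • g) := by
  have e0 : (fun x => s.ρ x • (c • u) x) = c • fun x => s.ρ x • u x := by
    funext x; exact smul_comm (s.ρ x) c (u x)
  refine ⟨e0 ▸ h.1.smul c, h.2.1.smul c, fun φ hφ => ?_⟩
  have e1 : ∀ x, φ x • (c • g) x = c * (φ x • g x) := fun x => by simp; ring
  have e2 : ∀ x, rdot (gradient φ x) (s.ρ x • (c • u) x)
      = c * rdot (gradient φ x) (s.ρ x • u x) := fun x => by
    simp only [rdot, Finset.mul_sum]
    refine Finset.sum_congr rfl fun i _ => ?_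
    simp; ring
  simp only [e1, e2, integral_const_mul, h.2.2 φ hφ]
  ring

theorem IsWeakDivRho.zero : s.IsWeakDivRho 0 0 := by
  refine ⟨?_, locallyIntegrableOn_zero, fun φ _ => by simp [rdot]⟩
  simpa using (locallyIntegrableOn_zero (ε'' := V3) (μ := (volume : Measure E3)) (s := s.R))

/-- The space `𝔊` of all `u ∈ ℌ` with `div(ρu) ∈ L²((γP/ρ²) dx)`. An element `u` is recorded as the
pair `(u, div(ρu))` in the `ℓ²`-product of the two `L²` spaces; as `div(ρu)` is determined by `u`,
this is the same space, and the induced inner product is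
`(u₁|u₂)_ℌ + ∫ (γP/ρ²) div(ρu₁) div(ρu₂)^* dx`. -/
def 𝔊 : Submodule ℂ (WithLp 2 (s.H × s.K)) where
  carrier := {z | s.IsWeakDivRho z.fst z.snd}
  zero_mem' := (IsWeakDivRho.zero s).congr s
    ((s.ae_of_ae_μ (Lp.coeFn_zero V3 2 s.μ)).mono fun _ hx => hx.symm)
    ((s.ae_of_ae_ν (Lp.coeFn_zero ℂ 2 s.ν)).mono fun _ hx => hx.symm)
  add_mem' {z w} hz hw := (IsWeakDivRho.add s hz hw).congr s
    ((s.ae_of_ae_μ (Lp.coeFn_add z.fst w.fst)).mono fun _ hx => hx.symm)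
    ((s.ae_of_ae_ν (Lp.coeFn_add z.snd w.snd)).mono fun _ hx => hx.symm)
  smul_mem' c z hz := (IsWeakDivRho.smul s c hz).congr s
    ((s.ae_of_ae_μ (Lp.coeFn_smul c z.fst)).mono fun _ hx => hx.symm)
    ((s.ae_of_ae_ν (Lp.coeFn_smul c z.snd)).mono fun _ hx => hx.symm)

variable {s} in
/-- The underlying vector field `u ∈ ℌ` of an element of `𝔊`. -/
def fld (z : s.𝔊) : s.H := z.1.fst

variable {s} in
/-- The weak divergence `div(ρu)` of an element of `𝔊`. -/
def dvg (z : s.𝔊) : s.K := z.1.snd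

/-- `C₀^∞(ℜ)` as a subspace of `𝔊`. -/
def test𝔊 : Submodule ℂ s.𝔊 where
  carrier := {z | ∃ φ : E3 → V3, IsTest s.R φ ∧ fld z =ᵐ[s.μ] φ}
  zero_mem' := ⟨0, ⟨contDiff_const, HasCompactSupport.zero, by simp [tsupport]⟩,
    Lp.coeFn_zero V3 2 s.μ⟩
  add_mem' := by
    rintro z w ⟨φ, hφ, hz⟩ ⟨ψ, hψ, hw⟩
    refine ⟨φ + ψ, ⟨hφ.1.add hψ.1, hφ.2.1.add hψ.2.1,
      (tsupport_add φ ψ).trans (Set.union_subset hφ.2.2 hψ.2.2)⟩, ?_⟩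
    exact (Lp.coeFn_add (fld z) (fld w)).trans (hz.add hw)
  smul_mem' := by
    rintro c z ⟨φ, hφ, hz⟩
    have hsub : tsupport (c • φ) ⊆ tsupport φ :=
      closure_mono (Function.support_const_smul_subset c φ)
    refine ⟨c • φ, ⟨hφ.1.const_smul c, hφ.2.1.of_isClosed_subset (isClosed_tsupport _) hsub,
      hsub.trans hφ.2.2⟩, ?_⟩
    exact (Lp.coeFn_smul c (fld z)).trans (hz.const_smul c)

/-- `𝔊₀`, the closure of `C₀^∞(ℜ)` in `𝔊`. -/
def 𝔊₀ : Submodule ℂ s.𝔊 := s.test𝔊.topologicalClosure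

variable {s} in
/-- `𝓛u = w` on `ℜ` in the sense of distributions, for `u ∈ 𝔊` and a field `w`: the distribution
`(1/ρ) grad δP - (δρ/ρ²) grad P + grad δΦ` with `δρ = -div(ρu)` is given by `w`. -/
def IsWeakL (z : s.𝔊) (w : E3 → V3) : Prop :=
  let dr : E3 → ℂ := fun x => -(dvg z x)
  ∀ φ : E3 → V3, IsTest s.R φ →
    ∫ x in s.R, cdot (w x) (φ x) =
      -(∫ x in s.R, s.δP dr (fld z) x * divC (fun y => (s.ρ y)⁻¹ • φ y) x)
      - (∫ x in s.R, dr x / ((s.ρ x ^ 2 : ℝ) : ℂ) * rdot (gradient s.P x) (φ x))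
      - ∫ x in s.R, s.δΦ dr x * divC φ x

/-! ### The quadratic forms -/

variable {s} in
/-- The form `Q₀(u₁, u₂)`, linear in `u₁` and antilinear in `u₂`. On the diagonal its second
term is `2 Re ∫ (γP𝒜/ρ) (u|n) div(ρu)^*`. -/
def Q₀ (z₁ z₂ : s.𝔊) : ℂ :=
  (∫ x in s.R, ((s.γ * s.P x / s.ρ x ^ 2 : ℝ) : ℂ) * (dvg z₁ x * star (dvg z₂ x)))
  + (∫ x in s.R, ((s.γ * s.P x * s.𝒜 x / s.ρ x : ℝ) : ℂ) *
      (rdot (s.n x) (fld z₁ x) * star (dvg z₂ x) + dvg z₁ x * star (rdot (s.n x) (fld z₂ x))))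
  - (∫ x in s.R, ((s.γ * s.P x * s.𝒜 x / s.ρ x * ‖gradient s.ρ x‖ : ℝ) : ℂ) *
      (rdot (s.n x) (fld z₁ x) * star (rdot (s.n x) (fld z₂ x))))
  - ((4 * Real.pi * s.G : ℝ) : ℂ) *
      ∫ x in s.R, newtonK s.R (fun y => dvg z₁ y) x * star (dvg z₂ x)

variable {s} in
/-- `Q_a(u₁, u₂) = Q₀(u₁, u₂) + a (u₁|u₂)_ℌ`. -/
def Qa (z₁ z₂ : s.𝔊) : ℂ := Q₀ z₁ z₂ + (s.a : ℂ) * inner ℂ (fld z₂) (fld z₁)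

/-- `T` is the operator `𝓛` restricted to `C₀^∞(ℜ; ℂ³)`, as an operator in `ℌ`. -/
def IsLOnTest (T : s.H →ₗ.[ℂ] s.H) : Prop :=
  (∀ u : s.H, u ∈ T.domain ↔ ∃ φ : E3 → V3, IsTest s.R φ ∧ u =ᵐ[s.μ] φ) ∧
  ∀ (u : T.domain) (φ : E3 → V3), IsTest s.R φ → (u : s.H) =ᵐ[s.μ] φ →
    T u =ᵐ[s.μ] s.classicalL φ

end BarotropicStar

/-! ### The Friedrichs extension -/

section Friedrichs

variable {X : Type*} [NormedAddCommGroup X] [InnerProductSpace ℂ X]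

/-- The sequence `x` in the domain of `T` converges to `u` with respect to the form
`t(x, y) = (Tx | y)`: `x n → u` and `t(x n - x m, x n - x m) → 0`. -/
def FormConverges (T : X →ₗ.[ℂ] X) (x : ℕ → T.domain) (u : X) : Prop :=
  Tendsto (fun k => (x k : X)) atTop (𝓝 u) ∧
  Tendsto (fun p : ℕ × ℕ => inner ℂ ((x p.1 - x p.2 : T.domain) : X) (T (x p.1 - x p.2)))
    atTop (𝓝 0)

/-- `L` is the Friedrichs extension of the (densely defined, symmetric, bounded below) operator `T`,
that is, the operator associated with the closure `t̄` of the form `t(x, y) = (Tx | y)`: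
`Lu = w` if and only if `u` is in the domain of `t̄` and `t̄(u, v) = (w | v)` for all `v` in the
domain of `t̄`. The domain of `t̄` consists of the form limits, and `t̄(u, v) = lim t(x n, y n)`. -/
def IsFriedrichsExtension (T L : X →ₗ.[ℂ] X) : Prop :=
  ∀ u w : X, (u, w) ∈ L.graph ↔
    ∃ x : ℕ → T.domain, FormConverges T x u ∧
      ∀ (y : ℕ → T.domain) (v : X), FormConverges T y v →
        Tendsto (fun k => inner ℂ (y k : X) (T (x k))) atTop (𝓝 (inner ℂ v w))

end Friedrichs

end

/-!
`Q₀` is a bounded Hermitian form on `𝔊` which is coercive up to a multiple of the norm of `ℌ`, and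
integration by parts identifies it with the distribution `𝓛u` tested against fields of `C₀^∞(ℜ)`.
The statements about operators then follow from the theory of closed semibounded forms.

*Pointwise structure.* By barotropy `S` is locally a function of `ρ`, so `∇S` is parallel to `∇ρ`,
which gives `𝔞 = -𝒜 n` (`𝔞_eq`). The constants `κ₁`, `κ₂` are finite because
`(γP/ρ²) ‖∇ρ‖` and `γP/ρ` are bounded multiples of `‖∇w‖` and `w`, where `w = ρ^(γ-1)` is `C¹` up
to the boundary.

*Lower bound.* The local terms of `Q₀` are estimated by `κ₁`, `κ₂` and the Cauchy-Schwarz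
inequality. The gravitational term is the Coulomb energy of `div(ρu)`, which has to be bounded by
`ρ_O ‖u‖²`, without a derivative of `u` (`newton_form_bounds`). In Fourier space it is
`∫ |ĝ|² / (4π²|ξ|²)` for the extension `g` of `div(ρu)` by zero, and `|ĝ| ≤ 2π |ξ| |(ρu)^|`, so
Plancherel's identity gives `∫ |ρu|² ≤ ρ_O ‖u‖²`. To avoid the transform of the kernel, `1/r` is
written as an integral of Gaussians. The bound on `ĝ` uses that `div(ρu) = g` also holds when tested
with functions that do not vanish on the boundary (`integral_smul_dvg`): cutoffs `χ` in terms of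
`w` satisfy `∫ ρ |∇χ|² → 0`, because `ρ = w^(1/(γ-1))` with `1/(γ-1) > 1` and because
`∫ ∇χ · ∇w = -∫ χ Δw` is bounded.

*Operators.* The form `Q₀` on the Hilbert space `𝔊₀` defines a self-adjoint operator `L`
(`exists_isSelfAdjoint_graph_eq_formGraph`, by Lax-Milgram). Since test fields are dense in `𝔊₀`,
its graph consists of the `(u, w)` with `u ∈ 𝔊₀` and `𝓛u = w` in the sense of distributions
(`isWeakL_iff_forall_mem_𝔊₀`). For a test field `u` the distribution `𝓛u` is the classical one
(`isWeakL_classicalL`), so the operator `T` of the theorem is the restriction of `L` to test fields.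
Finally, convergence with respect to the form of `T` is convergence in `𝔊`, which makes `L` the
Friedrichs extension of `T` (`isFriedrichsExtension_of_form`).
-/

open Star
open scoped FourierTransform ComplexConjugate

/-! ### Self-adjoint operators from closed forms -/

section FormOperator

variable {V X : Type*} [NormedAddCommGroup V] [InnerProductSpace ℂ V] [CompleteSpace V]
  [NormedAddCommGroup X] [InnerProductSpace ℂ X] [CompleteSpace X]

/-- The relation of all `(u, w)` with `u = j z` and `B(·, z) = (j · | w)`: the graph of the operator
associated with the form `B` on `V`, where `j` embeds `V` into `X`. -/
def formGraph (j : V →L[ℂ] X) (B : V →L⋆[ℂ] V →L[ℂ] ℂ) : Submodule ℂ (X × X) where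
  carrier := {p | ∃ z, j z = p.1 ∧ ∀ z', B z' z = inner ℂ (j z') p.2}
  zero_mem' := ⟨0, by simp⟩
  add_mem' := by
    rintro p q ⟨z, hz, h⟩ ⟨y, hy, h'⟩
    exact ⟨z + y, by simp [hz, hy], fun z' => by simp [h, h']⟩
  smul_mem' := by
    rintro c p ⟨z, hz, h⟩
    exact ⟨c • z, by simp [hz], fun z' => by simp [h]⟩

/-- A bounded form that is coercive up to a multiple of the norm of `X` is solvable:
every `f` is of the form `w + c u` with `(u, w)` in the graph of the associated operator. -/
theorem exists_form_eq_inner (j : V →L[ℂ] X) (B : V →L⋆[ℂ] V →L[ℂ] ℂ)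
    (hB : ∀ x y, star (B x y) = B y x) {c δ : ℝ} (hδ : 0 < δ)
    (h : ∀ z, δ * ‖z‖ ^ 2 ≤ (B z z).re + c * ‖j z‖ ^ 2) (f : X) :
    ∃ z, ∀ z', B z' z + c * inner ℂ (j z') (j z) = inner ℂ (j z') f := by
  let A : V →L[ℂ] V := InnerProductSpace.continuousLinearMapOfBilin B +
    (c : ℂ) • (ContinuousLinearMap.adjoint j ∘L j)
  have hA : ∀ v w, inner ℂ (A v) w = B v w + c * inner ℂ (j v) (j w) := fun v w => by
    simp [A, ContinuousLinearMap.adjoint_inner_left]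
  have hA' : ∀ v w, inner ℂ v (A w) = inner ℂ (A v) w := fun v w => by
    rw [← inner_conj_symm, hA, hA, map_add, map_mul, inner_conj_symm, Complex.conj_ofReal,
      ← hB w v]
    rfl
  have hu : IsUnit A := by
    refine A.isUnit_of_forall_le_norm_inner_map (c := ⟨δ, hδ.le⟩) hδ fun z => ?_
    rw [hA]
    refine le_trans ?_ (Complex.re_le_norm _)
    have e : ((c : ℂ) * inner ℂ (j z) (j z)).re = c * ‖j z‖ ^ 2 := by
      rw [inner_self_eq_norm_sq_to_K, Complex.re_ofReal_mul]
      norm_cast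
    rw [Complex.add_re, e, mul_comm]
    exact h z
  rw [ContinuousLinearMap.isUnit_iff_bijective] at hu
  obtain ⟨z, hz⟩ := hu.2 (ContinuousLinearMap.adjoint j f)
  refine ⟨z, fun z' => ?_⟩
  rw [← hA, ← hA', hz, ContinuousLinearMap.adjoint_inner_right]

/-- The operator associated with a bounded symmetric form, coercive up to a multiple of the norm of
`X`, on a Hilbert space `V` embedded densely into `X`, is self-adjoint. -/
theorem exists_isSelfAdjoint_graph_eq_formGraph (j : V →L[ℂ] X) (hj : Function.Injective j)
    (hd : DenseRange j) (B : V →L⋆[ℂ] V →L[ℂ] ℂ)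
    (hB : ∀ x y, star (B x y) = B y x) {c δ : ℝ} (hδ : 0 < δ)
    (h : ∀ z, δ * ‖z‖ ^ 2 ≤ (B z z).re + c * ‖j z‖ ^ 2) :
    ∃ L : X →ₗ.[ℂ] X, IsSelfAdjoint L ∧ L.graph = formGraph j B := by
  have hz0 : ∀ w : X, (∀ z, inner ℂ (j z) w = 0) → w = 0 := fun w hw =>
    hd.eq_zero_of_inner_right ℂ hw
  have hgr : (formGraph j B).toLinearPMap.graph = formGraph j B := by
    refine Submodule.toLinearPMap_graph_eq _ ?_
    rintro ⟨u, w⟩ ⟨z, hz, hw⟩ (hu : u = 0)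
    have : z = 0 := hj (by simpa [hu] using hz)
    exact hz0 w fun z' => by rw [← hw z', this, map_zero]
  refine ⟨(formGraph j B).toLinearPMap, ?_, hgr⟩
  set L := (formGraph j B).toLinearPMap
  have hL : ∀ x : L.domain, ∃ z, j z = x ∧ ∀ z', B z' z = inner ℂ (j z') (L x) := fun x =>
    (hgr ▸ L.mem_graph x : ((x : X), L x) ∈ formGraph j B)
  have hsolve : ∀ f : X, ∃ x : L.domain, L x + (c : ℂ) • (x : X) = f ∧
      ∃ z, j z = x ∧ ∀ z', B z' z + c * inner ℂ (j z') (j z) = inner ℂ (j z') f := fun f => by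
    obtain ⟨z, hz⟩ := exists_form_eq_inner j B hB hδ h f
    have : (j z, f - (c : ℂ) • j z) ∈ L.graph := by
      rw [hgr]
      exact ⟨z, rfl, fun z' => by rw [inner_sub_right, ← hz, inner_smul_right]; ring⟩
    obtain ⟨x, hx, hx'⟩ := (LinearPMap.mem_graph_iff _).1 this
    exact ⟨x, by simp only at hx hx'; rw [hx, hx']; abel, z, hx.symm, hz⟩
  have hsymm : L.IsFormalAdjoint L := fun x y => by
    obtain ⟨z, hz, hw⟩ := hL x
    obtain ⟨z', hz', hw'⟩ := hL y
    rw [← inner_conj_symm, ← hz', ← hw, ← hz, ← hw', ← hB]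
    exact star_star _
  have hdense : Dense (L.domain : Set X) := by
    rw [Submodule.dense_iff_topologicalClosure_eq_top, Submodule.topologicalClosure_eq_top_iff,
      Submodule.eq_bot_iff]
    intro u hu
    obtain ⟨x, -, z, hx, hz⟩ := hsolve u
    have h0 := hz z
    rw [hx, Submodule.inner_right_of_mem_orthogonal x.2 hu, ← hx] at h0
    have h1 := h z
    have e : ((c : ℂ) * inner ℂ (j z) (j z)).re = c * ‖j z‖ ^ 2 := by
      rw [inner_self_eq_norm_sq_to_K, Complex.re_ofReal_mul]
      norm_cast
    rw [← e, ← Complex.add_re, h0, Complex.zero_re] at h1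
    have : ‖z‖ ^ 2 ≤ 0 := by nlinarith
    have : z = 0 := by simpa using this
    exact hz0 u fun z' => by rw [← hz z', this]; simp
  rw [LinearPMap.isSelfAdjoint_def]
  have hle := LinearPMap.IsFormalAdjoint.le_adjoint hdense hsymm
  refine (LinearPMap.eq_of_le_of_domain_eq hle (le_antisymm hle.1 fun y hy => ?_)).symm
  -- a `y` in the domain of the adjoint is the solution `x` of `(L + c) x = (L† + c) y`
  obtain ⟨x, hx, -⟩ := hsolve (LinearPMap.adjoint L ⟨y, hy⟩ + (c : ℂ) • y)
  obtain ⟨x', hx', -⟩ := hsolve (y - x)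
  have e1 : inner ℂ (LinearPMap.adjoint L ⟨y, hy⟩) (x' : X) = inner ℂ y (L x') :=
    LinearPMap.adjoint_isFormalAdjoint hdense ⟨y, hy⟩ x'
  have e2 : inner ℂ (L x) (x' : X) = inner ℂ (x : X) (L x') := hsymm x x'
  have e3 := congrArg (fun t => inner ℂ t (x' : X)) hx
  simp only [inner_add_left, inner_smul_left, Complex.conj_ofReal, e1, e2] at e3
  have e4 : inner ℂ (y - x) (y - x : X) = 0 := by
    nth_rw 2 [← hx']
    simp only [inner_add_right, inner_smul_right, inner_sub_left]
    linear_combination -e3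
  have : y = x := by simpa [sub_eq_zero] using e4
  rw [this]
  exact x.2

end FormOperator

/-! ### The Newton potential in Fourier space -/

namespace Star

theorem integral_fourier_smul_eq_of_integrable {G : Type*} [NormedAddCommGroup G] [NormedSpace ℂ G]
    [CompleteSpace G] {f : E3 → ℂ} {g : E3 → G} (hf : Integrable f) (hg : Integrable g) :
    ∫ ξ, 𝓕 f ξ • g ξ = ∫ x, f x • 𝓕 g x := by
  simpa using! VectorFourier.integral_fourierIntegral_smul_eq_flip (L := innerₗ E3)
    Real.continuous_fourierChar continuous_inner hf hg

theorem continuous_fourier {G : Type*} [NormedAddCommGroup G] [NormedSpace ℂ G]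
    {f : E3 → G} (hf : Integrable f) : Continuous (𝓕 f) :=
  VectorFourier.fourierIntegral_continuous Real.continuous_fourierChar continuous_inner hf

theorem norm_sq_Lp_two {α G : Type*} [MeasurableSpace α] {μ : Measure α} [NormedAddCommGroup G]
    [InnerProductSpace ℂ G] (g : Lp G 2 μ) : ‖g‖ ^ 2 = ∫ x, ‖g x‖ ^ 2 ∂μ := by
  have h := L2.inner_def (𝕜 := ℂ) g g
  simp only [inner_self_eq_norm_sq_to_K] at h
  apply Complex.ofReal_injective
  rw [← integral_complex_ofReal]
  simpa using h

/-- Plancherel's identity for `L¹ ∩ L²`, with the Fourier transform given by its integral. -/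
theorem integral_norm_sq_fourier {F : E3 → V3} (h1 : Integrable F) (h2 : MemLp F 2) :
    MemLp (𝓕 F) 2 ∧ ∫ ξ, ‖𝓕 F ξ‖ ^ 2 = ∫ x, ‖F x‖ ^ 2 := by
  set f : Lp V3 2 (volume : Measure E3) := h2.toLp F
  have hf : f =ᵐ[volume] F := h2.coeFn_toLp
  have key : ((𝓕 f : Lp V3 2 (volume : Measure E3)) : E3 → V3) =ᵐ[volume] 𝓕 F := by
    refine ae_eq_of_integral_contDiff_smul_eq ?_ (continuous_fourier h1).locallyIntegrable
      fun φ hφ hc => ?_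
    · exact (Lp.memLp (𝓕 f)).locallyIntegrable (by norm_num)
    have hφ' : ContDiff ℝ ∞ (fun x => (φ x : ℂ)) := Complex.ofRealCLM.contDiff.comp hφ
    have hc' : HasCompactSupport (fun x => (φ x : ℂ)) := hc.comp_left (g := ((↑) : ℝ → ℂ)) rfl
    let ψ : SchwartzMap E3 ℂ := hc'.toSchwartzMap hφ'
    have e := congrArg (fun T => T ψ) (Lp.fourier_toTemperedDistribution_eq f)
    simp only [TemperedDistribution.fourier_apply, Lp.toTemperedDistribution_apply] at e
    have e1 : ∫ x, φ x • (𝓕 f : Lp V3 2 (volume : Measure E3)) x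
        = ∫ x, ψ x • (𝓕 f : Lp V3 2 (volume : Measure E3)) x := rfl
    have e2 : ∫ x, (𝓕 ψ) x • f x = ∫ x, 𝓕 (ψ : E3 → ℂ) x • F x :=
      integral_congr_ae (hf.mono fun x hx => by simp only [hx, SchwartzMap.fourier_coe])
    rw [e1, ← e, e2, integral_fourier_smul_eq_of_integrable ψ.integrable h1]
    rfl
  have hm : MemLp (𝓕 F) 2 := (memLp_congr_ae key).1 (Lp.memLp _)
  refine ⟨hm, ?_⟩
  have h := congrArg (· ^ 2) (Lp.norm_fourier_eq f)
  simp only [norm_sq_Lp_two] at h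
  rwa [integral_congr_ae (key.mono fun x hx => congrArg (‖·‖ ^ 2) hx),
    integral_congr_ae (hf.mono fun x hx => congrArg (‖·‖ ^ 2) hx)] at h

/-- A Gaussian-weighted `L²` norm of a Fourier transform as a double integral. -/
theorem integral_norm_sq_fourier_mul_gaussian {h : E3 → ℂ} (hh : Integrable h) {b : ℝ}
    (hb : 0 < b) :
    ((∫ ξ, ‖𝓕 h ξ‖ ^ 2 * Real.exp (-b * ‖ξ‖ ^ 2) : ℝ) : ℂ) =
      ((Real.pi / b) ^ (3 / 2 : ℝ) : ℝ) * ∫ x, conj (h x) * ∫ y, h y *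
        (Real.exp (-(Real.pi ^ 2 / b) * ‖x - y‖ ^ 2) : ℝ) := by
  have hb' : 0 < (b : ℂ).re := by simpa using hb
  have hg : Integrable (fun ξ : E3 => Real.exp (-b * ‖ξ‖ ^ 2)) := by
    have := (GaussianFourier.integrable_cexp_neg_mul_sq_norm_add (V := E3) hb' 0 0).norm
    refine this.congr (ae_of_all _ fun ξ => ?_)
    simp only [Complex.norm_exp]
    norm_cast
    simp
  obtain ⟨C, hC⟩ : ∃ C, ∀ ξ, ‖𝓕 h ξ‖ ≤ C :=
    ⟨_, fun ξ => VectorFourier.norm_fourierIntegral_le_integral_norm _ _ _ _ _⟩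
  have hG : Integrable (fun ξ => ((Real.exp (-b * ‖ξ‖ ^ 2) : ℝ) : ℂ) * 𝓕 h ξ) :=
    hg.ofReal.mul_bdd (c := C) (continuous_fourier hh).aestronglyMeasurable (ae_of_all _ hC)
  have e1 := VectorFourier.integral_sesq_fourierIntegral_eq_neg_flip (L := innerₗ E3)
    (innerSL ℂ : ℂ →L⋆[ℂ] ℂ →L[ℂ] ℂ) Real.continuous_fourierChar continuous_inner hh hG
  have e2 : ∀ x : E3, VectorFourier.fourierIntegral Real.fourierChar volume (-(innerₗ E3).flip)
      (fun ξ => ((Real.exp (-b * ‖ξ‖ ^ 2) : ℝ) : ℂ) * 𝓕 h ξ) x =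
      ((Real.pi / b) ^ (3 / 2 : ℝ) : ℝ) * ∫ y, h y *
        (Real.exp (-(Real.pi ^ 2 / b) * ‖x - y‖ ^ 2) : ℝ) := fun x => by
    have hE : Integrable (fun ξ : E3 => Complex.exp (-b * ‖ξ‖ ^ 2 +
        2 * Real.pi * Complex.I * (inner ℝ x ξ : ℝ))) :=
      GaussianFourier.integrable_cexp_neg_mul_sq_norm_add hb' _ x
    have := integral_fourier_smul_eq_of_integrable hh hE
    simp only [fourier_gaussian_innerProductSpace' hb'] at this
    rw [← integral_const_mul]
    refine Eq.trans ?_ (this.trans ?_)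
    · refine integral_congr_ae (ae_of_all _ fun ξ => ?_)
      simp [Circle.smul_def, Real.fourierChar_apply, Complex.exp_add, real_inner_comm]
      ring_nf
    · refine integral_congr_ae (ae_of_all _ fun y => ?_)
      have : ((3 : ℕ) / 2 : ℂ) = ((3 / 2 : ℝ) : ℂ) := by push_cast; ring
      simp only [finrank_euclideanSpace, Fintype.card_fin, smul_eq_mul]
      rw [this, ← Complex.ofReal_div, ← Complex.ofReal_cpow (by positivity)]
      push_cast
      ring_nf
  simp only [e2] at e1
  rw [← integral_const_mul, ← integral_complex_ofReal]
  refine Eq.trans ?_ (e1.trans ?_)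
  · refine integral_congr_ae (ae_of_all _ fun ξ => ?_)
    have : conj (𝓕 h ξ) * 𝓕 h ξ = ((‖𝓕 h ξ‖ ^ 2 : ℝ) : ℂ) := by
      rw [mul_comm, Complex.mul_conj']; norm_cast
    change _ = _ * conj (𝓕 h ξ)
    rw [mul_assoc, mul_comm (𝓕 h ξ), this]
    push_cast
    ring
  · refine integral_congr_ae (ae_of_all _ fun x => ?_)
    simp
    ring


/-- The energy of `h` with a Gaussian kernel as an integral of `|ĥ|²` with a positive weight. -/
theorem integral_gaussian_double {h : E3 → ℂ} (hh : Integrable h) {s : ℝ} (hs : 0 < s) :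
    ∫ x, conj (h x) * ∫ y, h y * (Real.exp (-s ^ 2 * ‖x - y‖ ^ 2) : ℝ) =
      ((∫ ξ, ‖𝓕 h ξ‖ ^ 2 * (Real.pi ^ (3 / 2 : ℝ) / s ^ 3 *
        Real.exp (-(Real.pi ^ 2 / s ^ 2) * ‖ξ‖ ^ 2)) : ℝ) : ℂ) := by
  have hpi := Real.pi_pos
  have h1 := integral_norm_sq_fourier_mul_gaussian hh (b := Real.pi ^ 2 / s ^ 2) (by positivity)
  have e1 : Real.pi ^ 2 / (Real.pi ^ 2 / s ^ 2) = s ^ 2 := by field_simp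
  have e2 : (Real.pi / (Real.pi ^ 2 / s ^ 2)) ^ (3 / 2 : ℝ) = s ^ 3 / Real.pi ^ (3 / 2 : ℝ) := by
    have : Real.pi / (Real.pi ^ 2 / s ^ 2) = s ^ 2 / Real.pi := by field_simp
    rw [this, Real.div_rpow (by positivity) hpi.le, ← Real.rpow_natCast_mul hs.le]
    norm_num
  rw [e1, e2] at h1
  have e3 : ∀ ξ : E3, ‖𝓕 h ξ‖ ^ 2 *
      (Real.pi ^ (3 / 2 : ℝ) / s ^ 3 * Real.exp (-(Real.pi ^ 2 / s ^ 2) * ‖ξ‖ ^ 2)) =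
      Real.pi ^ (3 / 2 : ℝ) / s ^ 3 *
        (‖𝓕 h ξ‖ ^ 2 * Real.exp (-(Real.pi ^ 2 / s ^ 2) * ‖ξ‖ ^ 2)) := fun ξ => by ring
  simp only [e3, integral_const_mul]
  rw [Complex.ofReal_mul, h1, ← mul_assoc, ← Complex.ofReal_mul]
  have : Real.pi ^ (3 / 2 : ℝ) / s ^ 3 * (s ^ 3 / Real.pi ^ (3 / 2 : ℝ)) = 1 := by
    have : Real.pi ^ (3 / 2 : ℝ) ≠ 0 := by positivity
    field_simp
  rw [this]
  simp

theorem ae_fst_ne_snd : ∀ᵐ p : E3 × E3, p.1 ≠ p.2 := by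
  have hm : MeasurableSet {p : E3 × E3 | p.1 = p.2} := measurableSet_eq_fun measurable_fst
    measurable_snd
  rw [ae_iff]
  simp only [ne_eq, not_not]
  rw [Measure.volume_eq_prod, Measure.measure_prod_null hm]
  refine ae_of_all _ fun x => ?_
  have : Prod.mk x ⁻¹' {p : E3 × E3 | p.1 = p.2} = {x} := by
    ext y; simp [eq_comm]
  simp only [this]
  simp

/-- The Coulomb energy is a superposition of Gaussian energies, since
`1 / r = (2 / √π) ∫₀^∞ exp (-s² r²) ds`. -/
theorem integral_newton_double {h : E3 → ℂ} (hh : Integrable h)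
    (hk : Integrable (fun p : E3 × E3 => conj (h p.1) * (h p.2 * (‖p.1 - p.2‖⁻¹ : ℝ)))) :
    IntegrableOn (fun s : ℝ => ∫ x, conj (h x) * ∫ y, h y * (Real.exp (-s ^ 2 * ‖x - y‖ ^ 2) : ℝ))
      (Set.Ioi 0) ∧
    ((√Real.pi / 2 : ℝ) : ℂ) * ∫ x, conj (h x) * ∫ y, h y * (‖x - y‖⁻¹ : ℝ) =
      ∫ s in Set.Ioi (0 : ℝ),
        ∫ x, conj (h x) * ∫ y, h y * (Real.exp (-s ^ 2 * ‖x - y‖ ^ 2) : ℝ) := by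
  have hgi : ∀ p : E3 × E3, ∫ s in Set.Ioi (0 : ℝ), Real.exp (-s ^ 2 * ‖p.1 - p.2‖ ^ 2) =
      √Real.pi / 2 * ‖p.1 - p.2‖⁻¹ := fun p => by
    have := integral_gaussian_Ioi (‖p.1 - p.2‖ ^ 2)
    rw [Real.sqrt_div Real.pi_pos.le, Real.sqrt_sq (norm_nonneg _)] at this
    rw [div_mul_eq_mul_div, ← div_eq_mul_inv, ← this]
    refine integral_congr_ae (ae_of_all _ fun s => ?_)
    simp only
    ring_nf
  have hgint : ∀ p : E3 × E3, p.1 ≠ p.2 →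
      IntegrableOn (fun s : ℝ => Real.exp (-s ^ 2 * ‖p.1 - p.2‖ ^ 2)) (Set.Ioi 0) := fun p hp => by
    have : 0 < ‖p.1 - p.2‖ ^ 2 := by
      have := norm_pos_iff.2 (sub_ne_zero.2 hp)
      positivity
    refine (integrable_exp_neg_mul_sq this).integrableOn.congr_fun (fun s _ => ?_)
      measurableSet_Ioi
    simp only
    ring_nf
  have hΦ : Integrable (fun q : (E3 × E3) × ℝ => conj (h q.1.1) * (h q.1.2 *
      (Real.exp (-q.2 ^ 2 * ‖q.1.1 - q.1.2‖ ^ 2) : ℝ)))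
      ((volume : Measure (E3 × E3)).prod (volume.restrict (Set.Ioi (0 : ℝ)))) := by
    have hm : AEStronglyMeasurable (fun q : (E3 × E3) × ℝ => conj (h q.1.1) * (h q.1.2 *
      (Real.exp (-q.2 ^ 2 * ‖q.1.1 - q.1.2‖ ^ 2) : ℝ)))
      ((volume : Measure (E3 × E3)).prod (volume.restrict (Set.Ioi (0 : ℝ)))) := by
      have h1 : AEStronglyMeasurable (fun p : E3 × E3 => conj (h p.1) * h p.2) := by
        rw [Measure.volume_eq_prod]
        exact (Complex.continuous_conj.comp_aestronglyMeasurable hh.1.comp_fst).mul hh.1.comp_snd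
      have h2 : Continuous fun q : (E3 × E3) × ℝ =>
        ((Real.exp (-q.2 ^ 2 * ‖q.1.1 - q.1.2‖ ^ 2) : ℝ) : ℂ) := by fun_prop
      refine (h1.comp_fst.mul h2.aestronglyMeasurable).congr (ae_of_all _ fun q => ?_)
      simp only [Pi.mul_apply, mul_assoc]
    rw [integrable_prod_iff hm]
    refine ⟨ae_fst_ne_snd.mono fun p hp => ?_, ?_⟩
    · exact ((Integrable.ofReal (𝕜 := ℂ) (hgint p hp)).const_mul (h p.2)).const_mul (conj (h p.1))
    · refine (hk.norm.const_mul (√Real.pi / 2)).congr (ae_of_all _ fun p => ?_)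
      simp only [norm_mul, integral_const_mul, Complex.norm_real, Real.norm_eq_abs, Real.abs_exp,
        hgi]
      simp
      ring
  have hswap := integral_integral_swap (f := fun (p : E3 × E3) (s : ℝ) => conj (h p.1) * (h p.2 *
      (Real.exp (-s ^ 2 * ‖p.1 - p.2‖ ^ 2) : ℝ))) hΦ
  have hI : ∀ s : ℝ, 0 < s →
      ∫ p : E3 × E3, conj (h p.1) * (h p.2 * (Real.exp (-s ^ 2 * ‖p.1 - p.2‖ ^ 2) : ℝ)) =
      ∫ x, conj (h x) * ∫ y, h y * (Real.exp (-s ^ 2 * ‖x - y‖ ^ 2) : ℝ) := fun s hs => by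
    have hi : Integrable (fun p : E3 × E3 => conj (h p.1) *
        (h p.2 * (Real.exp (-s ^ 2 * ‖p.1 - p.2‖ ^ 2) : ℝ))) := by
      have h1 : Integrable (fun p : E3 × E3 => conj (h p.1) * h p.2) := by
        have : Integrable (fun x => conj (h x)) := by
          simpa using Complex.conjCLE.toContinuousLinearMap.integrable_comp hh
        exact this.mul_prod hh
      have h2 : Continuous fun p : E3 × E3 =>
        ((Real.exp (-s ^ 2 * ‖p.1 - p.2‖ ^ 2) : ℝ) : ℂ) := by fun_prop
      have := h1.mul_bdd (c := 1) h2.aestronglyMeasurable (ae_of_all _ fun p => by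
        rw [Complex.norm_real, Real.norm_eq_abs, Real.abs_exp, Real.exp_le_one_iff]
        have := mul_nonneg (sq_nonneg s) (sq_nonneg ‖p.1 - p.2‖)
        linarith)
      simpa only [mul_assoc] using this
    rw [Measure.volume_eq_prod] at hi ⊢
    rw [integral_prod _ hi]
    simp only [integral_const_mul]
  have hJ : ∫ p : E3 × E3, conj (h p.1) * (h p.2 * (‖p.1 - p.2‖⁻¹ : ℝ)) =
      ∫ x, conj (h x) * ∫ y, h y * (‖x - y‖⁻¹ : ℝ) := by
    rw [Measure.volume_eq_prod] at hk ⊢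
    rw [integral_prod _ hk]
    simp only [integral_const_mul]
  constructor
  · have h1 : IntegrableOn _ (Set.Ioi (0 : ℝ)) := hΦ.integral_prod_right
    exact h1.congr_fun (fun s hs => hI s hs) measurableSet_Ioi
  · rw [← setIntegral_congr_fun measurableSet_Ioi fun s hs => hI s hs, ← hswap, ← hJ,
      ← integral_const_mul]
    refine integral_congr_ae (ae_of_all _ fun p => ?_)
    simp only [integral_const_mul, integral_complex_ofReal, hgi]
    push_cast
    ring


/-- `rdot a` as a continuous linear map. -/
noncomputable def rdotL (a : E3) : V3 →L[ℂ] ℂ :=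
  ∑ i, (a i : ℂ) • (EuclideanSpace.proj i : V3 →L[ℂ] ℂ)

theorem rdotL_apply (a : E3) (v : V3) : rdotL a v = rdot a v := by simp [rdotL, rdot]

theorem rdot_eq_inner (a : E3) (v : V3) : rdot a v = inner ℂ (toV a) v := by
  simp [rdot, toV, PiLp.inner_apply, mul_comm]

theorem norm_toV (a : E3) : ‖toV a‖ = ‖a‖ := by simp [toV, EuclideanSpace.norm_eq]

theorem norm_rdot_le (a : E3) (v : V3) : ‖rdot a v‖ ≤ ‖a‖ * ‖v‖ := by
  rw [rdot_eq_inner, ← norm_toV]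
  exact norm_inner_le_norm _ _

theorem rdot_neg (a : E3) (v : V3) : rdot (-a) v = -rdot a v := by simp [rdot]

theorem rdot_smul (c : ℝ) (a : E3) (v : V3) : rdot (c • a) v = c * rdot a v := by
  simp [rdot, Finset.mul_sum, mul_assoc]

theorem ofReal_integral_le_lintegral {α : Type*} [MeasurableSpace α] {μ : Measure α} {f : α → ℝ}
    (hf : ∀ x, 0 ≤ f x) : ENNReal.ofReal (∫ x, f x ∂μ) ≤ ∫⁻ x, ENNReal.ofReal (f x) ∂μ := by
  by_cases h : Integrable f μ
  · exact (ofReal_integral_eq_lintegral_ofReal h (ae_of_all _ hf)).le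
  · simp [integral_undef h]

/-- The integrand is the derivative of `exp (-c / s²)`, which increases from `0` to `1`. -/
theorem lintegral_inv_cube_mul_exp {c : ℝ} (hc : 0 < c) :
    ∫⁻ s in Set.Ioi (0 : ℝ), ENNReal.ofReal (2 * c / s ^ 3 * Real.exp (-(c / s ^ 2))) = 1 := by
  -- the continuous extension of `exp (-c / s²)` to `s = 0`
  set g : ℝ → ℝ := fun s => expNegInvGlue (s ^ 2 / c)
  have hgs : ∀ s ∈ Set.Ioi (0 : ℝ), g s = Real.exp (-(c / s ^ 2)) := fun s hs => by
    have hs : 0 < s := hs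
    have : ¬ s ^ 2 / c ≤ 0 := not_le.2 (by positivity)
    simp [g, expNegInvGlue, this]
  have hcont : Continuous g := by
    have : Continuous expNegInvGlue := (expNegInvGlue.contDiff (n := 0)).continuous
    exact this.comp (by fun_prop)
  have hd : ∀ s ∈ Set.Ioi (0 : ℝ), HasDerivAt g (2 * c / s ^ 3 * Real.exp (-(c / s ^ 2))) s := by
    intro s hs
    have hs' : s ≠ 0 := ne_of_gt hs
    have h1 : HasDerivAt (fun s : ℝ => Real.exp (-(c / s ^ 2)))
        (2 * c / s ^ 3 * Real.exp (-(c / s ^ 2))) s := by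
      have h2 : HasDerivAt (fun s : ℝ => -(c / s ^ 2)) (2 * c / s ^ 3) s := by
        have := (((hasDerivAt_pow 2 s).inv (pow_ne_zero 2 hs')).const_mul c).neg
        convert! this using 1
        field_simp
        norm_num
      convert! h2.exp using 1
      ring
    exact h1.congr_of_eventuallyEq (eventually_of_mem (Ioi_mem_nhds hs) hgs)
  have hpos : ∀ s ∈ Set.Ioi (0 : ℝ), 0 ≤ 2 * c / s ^ 3 * Real.exp (-(c / s ^ 2)) := by
    intro s hs
    have hs : 0 < s := hs
    positivity
  have hlim : Tendsto g atTop (𝓝 1) := by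
    have h1 : Tendsto (fun s : ℝ => Real.exp (-(c / s ^ 2))) atTop (𝓝 1) := by
      have : Tendsto (fun s : ℝ => c / s ^ 2) atTop (𝓝 0) :=
        tendsto_const_nhds.div_atTop (tendsto_pow_atTop two_ne_zero)
      simpa using! (Real.continuous_exp.tendsto _).comp this.neg
    refine h1.congr' ?_
    filter_upwards [eventually_gt_atTop 0] with s hs using (hgs s hs).symm
  have hint := integrableOn_Ioi_deriv_of_nonneg hcont.continuousWithinAt hd hpos hlim
  have hval := integral_Ioi_of_hasDerivAt_of_nonneg hcont.continuousWithinAt hd hpos hlim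
  rw [← ofReal_integral_eq_lintegral_ofReal hint
    ((ae_restrict_mem measurableSet_Ioi).mono hpos), hval]
  simp [g]

/-- The bound `|ĥ| ≤ 2π |ξ| |F̂|` for the divergence `h` of `F`. -/
theorem norm_fourier_div_le {h : E3 → ℂ} {F : E3 → V3} (hh : Integrable h) (hF : Integrable F)
    (hdiv : ∀ φ : E3 → ℝ, ContDiff ℝ ∞ φ → ∫ x, φ x • h x = -∫ x, rdot (gradient φ x) (F x))
    (ξ : E3) : ‖𝓕 h ξ‖ ≤ 2 * Real.pi * ‖ξ‖ * ‖𝓕 F ξ‖ := by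
  -- the real and imaginary parts of the character `exp (-iθ)` serve as test functions
  set θ : E3 → ℝ := fun y => 2 * Real.pi * inner ℝ y ξ
  have hθ : ContDiff ℝ ∞ θ := contDiff_const.mul (contDiff_id.inner ℝ contDiff_const)
  have hgrad : ∀ y, HasGradientAt θ ((2 * Real.pi) • ξ) y := fun y => by
    rw [hasGradientAt_iff_hasFDerivAt]
    have : HasFDerivAt θ ((2 * Real.pi) • (innerSL ℝ ξ)) y := by
      have h1 := (innerSL ℝ ξ).hasFDerivAt (x := y)
      have h2 := h1.const_mul (2 * Real.pi)
      refine h2.congr_of_eventuallyEq (Eventually.of_forall fun z => ?_)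
      simp [θ, real_inner_comm]
    convert! this using 1
    ext z
    simp
  have hcos : ∀ y, gradient (fun z => Real.cos (θ z)) y = -(Real.sin (θ y) • (2 * Real.pi) • ξ) :=
    fun y => by
      refine HasGradientAt.gradient ?_
      rw [hasGradientAt_iff_hasFDerivAt]
      have := ((hasGradientAt_iff_hasFDerivAt.1 (hgrad y)).cos)
      convert! this using 1
      rw [map_neg, map_smul]
      exact (neg_smul _ _).symm
  have hsin : ∀ y, gradient (fun z => Real.sin (θ z)) y = Real.cos (θ y) • (2 * Real.pi) • ξ :=
    fun y => by
      refine HasGradientAt.gradient ?_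
      rw [hasGradientAt_iff_hasFDerivAt]
      have := ((hasGradientAt_iff_hasFDerivAt.1 (hgrad y)).sin)
      convert! this using 1
      simp
  have d1 := hdiv (fun y => Real.cos (θ y)) (Real.contDiff_cos.comp hθ)
  have d2 := hdiv (fun y => Real.sin (θ y)) (Real.contDiff_sin.comp hθ)
  simp only [hcos, hsin] at d1 d2
  have hbc : ∀ {G : Type} [NormedAddCommGroup G] [NormedSpace ℝ G] {k : E3 → G},
      Integrable k → Integrable (fun y => Real.cos (θ y) • k y) := fun hk =>
    hk.bdd_smul 1 (Real.continuous_cos.comp hθ.continuous).aestronglyMeasurable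
      (ae_of_all _ fun y => by simpa using Real.abs_cos_le_one _)
  have hbs : ∀ {G : Type} [NormedAddCommGroup G] [NormedSpace ℝ G] {k : E3 → G},
      Integrable k → Integrable (fun y => Real.sin (θ y) • k y) := fun hk =>
    hk.bdd_smul 1 (Real.continuous_sin.comp hθ.continuous).aestronglyMeasurable
      (ae_of_all _ fun y => by simpa using Real.abs_sin_le_one _)
  have hfour : ∀ {G : Type} [NormedAddCommGroup G] [NormedSpace ℂ G] {k : E3 → G},
      Integrable k → 𝓕 k ξ = (∫ y, Real.cos (θ y) • k y) - Complex.I • ∫ y, Real.sin (θ y) • k y :=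
    fun {G} _ _ {k} hk => by
      rw [← integral_smul, ← integral_sub (hbc hk) (Integrable.smul Complex.I (hbs hk) :
        Integrable (fun y => Complex.I • Real.sin (θ y) • k y)), Real.fourier_eq']
      refine integral_congr_ae (ae_of_all _ fun y => ?_)
      have : ((-2 * Real.pi * inner ℝ y ξ : ℝ) : ℂ) = ((-θ y : ℝ) : ℂ) := by simp [θ]
      simp only
      rw [this, Complex.exp_mul_I, ← Complex.ofReal_cos, ← Complex.ofReal_sin, Real.cos_neg,
        Real.sin_neg, add_smul, Complex.coe_smul,
        Complex.ofReal_neg, neg_mul, neg_smul, mul_comm, mul_smul, Complex.coe_smul, sub_eq_add_neg]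
  set R := rdotL ξ
  have rsmul : ∀ (c : ℝ) (v : V3), rdot (c • (2 * Real.pi) • ξ) v = (2 * Real.pi) • R (c • v) :=
    fun c v => by
      rw [← Complex.coe_smul c, map_smul, rdotL_apply, rdot_smul, rdot_smul]
      simp
      ring
  simp only [rdot_neg, rsmul, integral_neg, neg_neg, integral_smul] at d1 d2
  have i1 : ∫ y, R (Real.sin (θ y) • F y) = R (∫ y, Real.sin (θ y) • F y) :=
    R.integral_comp_comm (hbs hF)
  have i2 : ∫ y, R (Real.cos (θ y) • F y) = R (∫ y, Real.cos (θ y) • F y) :=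
    R.integral_comp_comm (hbc hF)
  have key : 𝓕 h ξ = (2 * Real.pi : ℝ) • (Complex.I * R (𝓕 F ξ)) := by
    rw [hfour hh, hfour hF, d1, d2, i1, i2, map_sub, map_smul]
    simp only [Complex.real_smul, smul_eq_mul]
    linear_combination ((2 * Real.pi : ℝ) * R (∫ y, Real.sin (θ y) • F y)) * Complex.I_sq
  have hpi : ‖(2 * Real.pi : ℝ)‖ = 2 * Real.pi := Real.norm_of_nonneg (by positivity)
  rw [key, norm_smul, hpi, norm_mul, Complex.norm_I, one_mul, mul_assoc (2 * Real.pi), rdotL_apply]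
  exact mul_le_mul_of_nonneg_left (norm_rdot_le _ _) (by positivity)

/-- The Coulomb energy of `h = div F` is real, nonnegative, and at most `‖F‖²`. -/
theorem newton_form_bounds {h : E3 → ℂ} {F : E3 → V3} (hh : Integrable h) (hF : Integrable F)
    (hF2 : MemLp F 2)
    (hk : Integrable (fun p : E3 × E3 => conj (h p.1) * (h p.2 * (‖p.1 - p.2‖⁻¹ : ℝ))))
    (hdiv : ∀ φ : E3 → ℝ, ContDiff ℝ ∞ φ → ∫ x, φ x • h x = -∫ x, rdot (gradient φ x) (F x)) :
    ∃ r : ℝ, 0 ≤ r ∧ r ≤ 4 * Real.pi * ∫ x, ‖F x‖ ^ 2 ∧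
      ∫ x, conj (h x) * ∫ y, h y * (‖x - y‖⁻¹ : ℝ) = r := by
  have hpi := Real.pi_pos
  obtain ⟨h1, h2⟩ := integral_newton_double hh hk
  obtain ⟨hm, hpl⟩ := integral_norm_sq_fourier hF hF2
  set w : ℝ → E3 → ℝ := fun s ξ =>
    Real.pi ^ (3 / 2 : ℝ) / s ^ 3 * Real.exp (-(Real.pi ^ 2 / s ^ 2) * ‖ξ‖ ^ 2) with hw
  set I : ℝ → ℝ := fun s => ∫ ξ, ‖𝓕 h ξ‖ ^ 2 * w s ξ
  have hw0 : ∀ s ∈ Set.Ioi (0 : ℝ), ∀ ξ, 0 ≤ w s ξ := fun s hs ξ => by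
    have hs : 0 < s := hs
    positivity
  have hI0 : ∀ s ∈ Set.Ioi (0 : ℝ), 0 ≤ I s := fun s hs =>
    integral_nonneg fun ξ => mul_nonneg (sq_nonneg _) (hw0 s hs ξ)
  have hIe : ∀ s ∈ Set.Ioi (0 : ℝ),
      ∫ x, conj (h x) * ∫ y, h y * (Real.exp (-s ^ 2 * ‖x - y‖ ^ 2) : ℝ) = (I s : ℂ) :=
    fun s hs => integral_gaussian_double hh hs
  have hIint : IntegrableOn I (Set.Ioi 0) := by
    have : Integrable _ (volume.restrict (Set.Ioi (0 : ℝ))) :=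
      (h1.congr_fun hIe measurableSet_Ioi).re
    simpa using! this
  rw [setIntegral_congr_fun measurableSet_Ioi hIe, integral_complex_ofReal] at h2
  set c0 : ℝ := Real.pi ^ (3 / 2 : ℝ) with hc0
  have hc0' : c0 = Real.pi * √Real.pi := by
    rw [hc0, Real.sqrt_eq_rpow, ← Real.rpow_one_add' hpi.le (by norm_num)]
    norm_num
  have hbound : ∫ s in Set.Ioi (0 : ℝ), I s ≤ 2 * c0 * ∫ x, ‖F x‖ ^ 2 := by
    rw [← ENNReal.ofReal_le_ofReal_iff (by positivity),
      ofReal_integral_eq_lintegral_ofReal hIint ((ae_restrict_mem measurableSet_Ioi).mono hI0)]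
    -- for each `ξ` the factor `|ξ|²` from the bound on `ĥ` cancels against the integral over `s`
    calc ∫⁻ s in Set.Ioi (0 : ℝ), ENNReal.ofReal (I s)
        ≤ ∫⁻ s in Set.Ioi (0 : ℝ), ∫⁻ ξ, ENNReal.ofReal
            (‖𝓕 F ξ‖ ^ 2 * (4 * Real.pi ^ 2 * ‖ξ‖ ^ 2 * w s ξ)) := by
          refine setLIntegral_mono' measurableSet_Ioi fun s hs => ?_
          refine (ofReal_integral_le_lintegral fun ξ =>
            mul_nonneg (sq_nonneg _) (hw0 s hs ξ)).trans (lintegral_mono fun ξ => ?_)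
          refine ENNReal.ofReal_le_ofReal ?_
          have := norm_fourier_div_le hh hF hdiv ξ
          calc ‖𝓕 h ξ‖ ^ 2 * w s ξ ≤ (2 * Real.pi * ‖ξ‖ * ‖𝓕 F ξ‖) ^ 2 * w s ξ := by
                gcongr
                exact hw0 s hs ξ
            _ = _ := by ring
      _ = ∫⁻ ξ, ∫⁻ s in Set.Ioi (0 : ℝ), ENNReal.ofReal
            (‖𝓕 F ξ‖ ^ 2 * (4 * Real.pi ^ 2 * ‖ξ‖ ^ 2 * w s ξ)) := by
          refine lintegral_lintegral_swap (Measurable.aemeasurable ?_)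
          have := (continuous_fourier hF).measurable
          simp only [Function.uncurry_def, hw]
          fun_prop
      _ ≤ ∫⁻ ξ, ENNReal.ofReal (2 * c0 * ‖𝓕 F ξ‖ ^ 2) := by
          refine lintegral_mono fun ξ => ?_
          rcases eq_or_ne ξ 0 with rfl | hξ
          · simp
          have hξ' := norm_pos_iff.2 hξ
          have e : ∀ s : ℝ, ENNReal.ofReal (‖𝓕 F ξ‖ ^ 2 * (4 * Real.pi ^ 2 * ‖ξ‖ ^ 2 * w s ξ)) =
              ENNReal.ofReal (2 * c0 * ‖𝓕 F ξ‖ ^ 2) * ENNReal.ofReal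
                (2 * (Real.pi ^ 2 * ‖ξ‖ ^ 2) / s ^ 3 *
                  Real.exp (-(Real.pi ^ 2 * ‖ξ‖ ^ 2 / s ^ 2))) := fun s => by
            rw [← ENNReal.ofReal_mul (by positivity)]
            congr 1
            simp only [hw]
            ring_nf
          simp only [e]
          rw [lintegral_const_mul _ (by fun_prop), lintegral_inv_cube_mul_exp (by positivity),
            mul_one]
      _ = ENNReal.ofReal (2 * c0 * ∫ x, ‖F x‖ ^ 2) := by
          rw [← hpl, ← integral_const_mul, ofReal_integral_eq_lintegral_ofReal
            ((hm.integrable_norm_pow two_ne_zero).const_mul _)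
            (ae_of_all _ fun ξ => by positivity)]
  have hsp : 0 < √Real.pi := Real.sqrt_pos.2 hpi
  have hss : √Real.pi * √Real.pi = Real.pi := Real.mul_self_sqrt hpi.le
  refine ⟨2 / √Real.pi * ∫ s in Set.Ioi (0 : ℝ), I s,
    mul_nonneg (by positivity) (setIntegral_nonneg measurableSet_Ioi hI0), ?_, ?_⟩
  · calc 2 / √Real.pi * ∫ s in Set.Ioi (0 : ℝ), I s
        ≤ 2 / √Real.pi * (2 * c0 * ∫ x, ‖F x‖ ^ 2) := by gcongr
      _ = _ := by
        rw [hc0']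
        field_simp
        ring
  · rw [Complex.ofReal_mul, ← h2, ← mul_assoc, ← Complex.ofReal_mul]
    have : 2 / √Real.pi * (√Real.pi / 2) = 1 := by field_simp
    rw [this]
    simp

end Star

/-! ### Pointwise structure of a barotropic star -/

theorem UniformContinuousOn.exists_norm_le {X Y : Type*} [PseudoMetricSpace X]
    [ProperSpace X] [SeminormedAddCommGroup Y] {f : X → Y} {s : Set X}
    (hf : UniformContinuousOn f s) (hs : Bornology.IsBounded s) : ∃ C, ∀ x ∈ s, ‖f x‖ ≤ C := by
  obtain ⟨δ, hδ, h⟩ := Metric.uniformContinuousOn_iff.1 hf 1 one_pos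
  obtain ⟨t, hts, ht, hst⟩ := TotallyBounded.exists_subset
    (hs.isCompact_closure.totallyBounded.subset subset_closure) (Metric.dist_mem_uniformity hδ)
  obtain ⟨C, hC⟩ := (ht.image fun x => ‖f x‖).bddAbove
  refine ⟨C + 1, fun x hx => ?_⟩
  obtain ⟨y, hy, hxy⟩ := Set.mem_iUnion₂.1 (hst hx)
  have h1 : dist (f x) (f y) < 1 := h x hx y (hts hy) hxy
  have h2 : ‖f y‖ ≤ C := hC ⟨y, hy, rfl⟩
  have h3 := norm_sub_norm_le (f x) (f y)
  rw [dist_eq_norm] at h1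
  linarith

theorem norm_gradient (f : E3 → ℝ) (x : E3) : ‖gradient f x‖ = ‖fderiv ℝ f x‖ := by
  simp [gradient]

namespace BarotropicStar

variable (s : BarotropicStar)

theorem γ_pos : 0 < s.γ := one_pos.trans s.one_lt_γ

variable {s} in
theorem ρ_pos {x : E3} (hx : x ∈ s.R) : 0 < s.ρ x := hx

theorem P_nonneg (x : E3) : 0 ≤ s.P x :=
  mul_nonneg (Real.rpow_nonneg (s.ρ_nonneg x) _) (Real.exp_pos _).le

variable {s} in
theorem P_pos {x : E3} (hx : x ∈ s.R) : 0 < s.P x :=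
  mul_pos (Real.rpow_pos_of_pos hx _) (Real.exp_pos _)

theorem R_nonempty : s.R.Nonempty := s.domain_smooth.2.1.nonempty

theorem isBounded_R : Bornology.IsBounded s.R := s.domain_smooth.2.2.1

theorem isCompact_closure_R : IsCompact (closure s.R) := s.isBounded_R.isCompact_closure

theorem ρ_eq_zero {x : E3} (hx : x ∉ s.R) : s.ρ x = 0 :=
  le_antisymm (not_lt.1 hx) (s.ρ_nonneg x)

instance : IsFiniteMeasure (volume.restrict s.R) :=
  ⟨by simpa using s.isBounded_R.measure_lt_top⟩

/-- The enthalpy-like variable `ρ^(γ-1)`, a `C²` function up to the boundary that vanishes there. -/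
noncomputable def w (x : E3) : ℝ := s.ρ x ^ (s.γ - 1)

variable {s} in
theorem w_pos {x : E3} (hx : x ∈ s.R) : 0 < s.w x := Real.rpow_pos_of_pos hx _

theorem w_eq_zero {x : E3} (hx : x ∉ s.R) : s.w x = 0 := by
  rw [w, s.ρ_eq_zero hx, Real.zero_rpow (by linarith [s.one_lt_γ])]

theorem w_continuous : Continuous s.w :=
  s.ρ_contDiff.continuous.rpow_const fun _ => Or.inr (by linarith [s.one_lt_γ])

theorem ρ_eq_w_rpow (x : E3) : s.ρ x = s.w x ^ (1 / (s.γ - 1)) := by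
  have : s.γ - 1 ≠ 0 := by linarith [s.one_lt_γ]
  rw [w, ← Real.rpow_mul (s.ρ_nonneg x), mul_one_div_cancel this, Real.rpow_one]

theorem w_contDiffOn : ContDiffOn ℝ ∞ s.w s.R := s.ρ_smooth

theorem ρ_contDiffOn : ContDiffOn ℝ ∞ s.ρ s.R :=
  (s.w_contDiffOn.rpow_const_of_ne fun _ hx => (w_pos hx).ne').congr fun x _ => s.ρ_eq_w_rpow x

theorem P_contDiffOn : ContDiffOn ℝ ∞ s.P s.R :=
  (s.ρ_contDiffOn.rpow_const_of_ne fun _ hx => (ρ_pos hx).ne').mul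
    (s.S_smooth.div_const _).exp

/-- The density is largest at the centre, its only critical point in the star. -/
theorem ρ_le_ρO (x : E3) : s.ρ x ≤ s.ρO := by
  obtain ⟨x₀, h₀⟩ := s.ρ_contDiff.continuous.exists_forall_ge_of_hasCompactSupport s.ρ_compact
  obtain ⟨y, hy⟩ := s.R_nonempty
  have : x₀ = 0 := by
    by_contra hne
    have h1 := s.ρ_radial x₀ ((ρ_pos hy).trans_le (h₀ y)) hne
    have h2 : IsLocalMax s.ρ x₀ := Eventually.of_forall h₀
    simp [h2.fderiv_eq_zero] at h1
  rw [ρO, ← this]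
  exact h₀ x

theorem ρO_nonneg : 0 ≤ s.ρO := s.ρ_nonneg 0

/-- By barotropy the entropy is locally a differentiable function of the density. -/
theorem exists_gradient_S_eq {x : E3} (hx : x ∈ s.R) :
    ∃ c : ℝ, gradient s.S x = c • gradient s.ρ x := by
  obtain ⟨F, hF, hPF⟩ := s.barotropic
  have hCV := s.CV_pos.ne'
  have hρ := ρ_pos hx
  have hS : s.S =ᶠ[𝓝 x] fun y => s.CV * (Real.log (F (s.ρ y ^ (s.γ - 1))) -
      s.γ * Real.log (s.ρ y)) := by
    filter_upwards [s.isOpen_R.mem_nhds hx] with y hy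
    rw [← hPF y hy, pressureOf, Real.log_mul (Real.rpow_pos_of_pos hy _).ne' (Real.exp_pos _).ne',
      Real.log_rpow hy, Real.log_exp]
    field_simp
    ring
  have hd : DifferentiableAt ℝ (fun t : ℝ => s.CV * (Real.log (F (t ^ (s.γ - 1))) -
      s.γ * Real.log t)) (s.ρ x) := by
    have h1 : DifferentiableAt ℝ F (s.ρ x ^ (s.γ - 1)) :=
      (hF.differentiableOn (by simp)).differentiableAt (Ioi_mem_nhds (w_pos hx))
    have h2 : DifferentiableAt ℝ (fun t : ℝ => t ^ (s.γ - 1)) (s.ρ x) :=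
      Real.differentiableAt_rpow_const_of_ne _ hρ.ne'
    have h3 : F (s.ρ x ^ (s.γ - 1)) ≠ 0 := by
      rw [← hPF x hx]
      exact (P_pos hx).ne'
    exact (((h1.comp (s.ρ x) h2).log h3).sub
      ((Real.differentiableAt_log hρ.ne').const_mul _)).const_mul _
  refine ⟨deriv (fun t : ℝ => s.CV * (Real.log (F (t ^ (s.γ - 1))) -
      s.γ * Real.log t)) (s.ρ x), ?_⟩
  have h1 := hd.hasDerivAt.comp_hasFDerivAt x
    (s.ρ_contDiff.differentiable (by simp) x).hasFDerivAt
  have h2 := (h1.congr_of_eventuallyEq hS).fderiv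
  rw [gradient, gradient, h2, map_smul]

theorem 𝔞_eq {x : E3} (hx : x ∈ s.R) : s.𝔞 x = -(s.𝒜 x • s.n x) := by
  obtain ⟨c, hc⟩ := s.exists_gradient_S_eq hx
  rcases eq_or_ne (gradient s.ρ x) 0 with h0 | h0
  · simp [𝔞, hc, h0, n]
  · have hn : ‖gradient s.ρ x‖ ≠ 0 := norm_ne_zero_iff.2 h0
    simp only [𝒜, 𝔞, n, hc, inner_smul_left, inner_smul_right,
      real_inner_self_eq_norm_sq, smul_smul, ← neg_smul]
    congr 1
    simp
    field_simp

theorem norm_n_le (x : E3) : ‖s.n x‖ ≤ 1 := by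
  rw [n, norm_smul, norm_inv, norm_norm]
  exact inv_mul_le_one

theorem gradient_ρ_eq (x : E3) : gradient s.ρ x = ‖gradient s.ρ x‖ • s.n x := by
  rcases eq_or_ne (gradient s.ρ x) 0 with h0 | h0
  · simp [h0]
  · rw [n, smul_smul, mul_inv_cancel₀ (norm_ne_zero_iff.2 h0), one_smul]

theorem abs_𝒜_le (x : E3) : |s.𝒜 x| ≤ ‖s.𝔞 x‖ := by
  rw [𝒜, abs_neg]
  exact (abs_real_inner_le_norm _ _).trans
    (mul_le_of_le_one_right (norm_nonneg _) (s.norm_n_le x))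

theorem continuous_gradient_S : Continuous (gradient s.S) :=
  (InnerProductSpace.toDual ℝ E3).symm.continuous.comp (s.S_contDiff.continuous_fderiv (by simp))

theorem continuous_gradient_ρ : Continuous (gradient s.ρ) :=
  (InnerProductSpace.toDual ℝ E3).symm.continuous.comp (s.ρ_contDiff.continuous_fderiv (by simp))

theorem continuous_𝔞 : Continuous s.𝔞 :=
  (s.continuous_gradient_S.const_smul (s.γ * s.CV)⁻¹).neg

theorem measurable_n : Measurable s.n :=
  s.continuous_gradient_ρ.measurable.norm.inv.smul s.continuous_gradient_ρ.measurable

theorem measurable_𝒜 : Measurable s.𝒜 := (s.continuous_𝔞.measurable.inner s.measurable_n).neg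

theorem exists_abs_𝒜_le : ∃ C, 0 ≤ C ∧ ∀ x ∈ s.R, |s.𝒜 x| ≤ C := by
  obtain ⟨C, hC⟩ := s.isCompact_closure_R.exists_bound_of_continuousOn s.continuous_𝔞.continuousOn
  obtain ⟨y, hy⟩ := s.R_nonempty
  exact ⟨C, (norm_nonneg _).trans (hC y (subset_closure hy)),
    fun x hx => (s.abs_𝒜_le x).trans (hC x (subset_closure hx))⟩

theorem exists_exp_S_le : ∃ C, 0 < C ∧ ∀ x ∈ s.R, Real.exp (s.S x / s.CV) ≤ C := by
  obtain ⟨C, hC⟩ := s.isCompact_closure_R.exists_bound_of_continuousOn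
    s.S_contDiff.continuous.continuousOn
  refine ⟨Real.exp (C / s.CV), Real.exp_pos _, fun x hx => Real.exp_le_exp.2 ?_⟩
  have := (le_abs_self _).trans (hC x (subset_closure hx))
  exact div_le_div_of_nonneg_right this s.CV_pos.le

theorem exists_norm_fderiv_w_le : ∃ C, 0 ≤ C ∧ ∀ x ∈ s.R, ‖fderiv ℝ s.w x‖ ≤ C := by
  obtain ⟨α, -, -, h, -⟩ := s.boundary_regular
  obtain ⟨C, hC⟩ := (h.2.1 1 (by norm_num)).exists_norm_le s.isBounded_R
  change ∀ x ∈ s.R, ‖iteratedFDerivWithin ℝ 1 s.w s.R x‖ ≤ C at hC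
  have h1 : ∀ x ∈ s.R, ‖fderiv ℝ s.w x‖ ≤ C := fun x hx => by
    have := hC x hx
    rwa [norm_iteratedFDerivWithin_one _ (s.isOpen_R.uniqueDiffWithinAt hx),
      fderivWithin_of_isOpen s.isOpen_R hx] at this
  obtain ⟨y, hy⟩ := s.R_nonempty
  exact ⟨C, le_trans (by positivity) (h1 y hy), h1⟩

theorem exists_norm_fderiv_fderiv_w_le :
    ∃ C, 0 ≤ C ∧ ∀ x ∈ s.R, ‖fderiv ℝ (fderiv ℝ s.w) x‖ ≤ C := by
  obtain ⟨α, -, -, h, -⟩ := s.boundary_regular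
  obtain ⟨C, hC⟩ := (h.2.1 2 (by norm_num)).exists_norm_le s.isBounded_R
  change ∀ x ∈ s.R, ‖iteratedFDerivWithin ℝ 2 s.w s.R x‖ ≤ C at hC
  have h1 : ∀ x ∈ s.R, ‖fderiv ℝ (fderiv ℝ s.w) x‖ ≤ C := fun x hx => by
    have := hC x hx
    rw [iteratedFDerivWithin_of_isOpen 2 s.isOpen_R hx, ← norm_iteratedFDeriv_fderiv,
      norm_iteratedFDeriv_one] at this
    exact this
  obtain ⟨y, hy⟩ := s.R_nonempty
  exact ⟨C, le_trans (by positivity) (h1 y hy), h1⟩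

variable {s} in
theorem P_div_ρ {x : E3} (hx : x ∈ s.R) : s.P x / s.ρ x = s.w x * Real.exp (s.S x / s.CV) := by
  rw [P, pressureOf, w, Real.rpow_sub_one (ρ_pos hx).ne']
  ring

theorem bddAbove_κ₁ : BddAbove ((fun x => |s.𝒜 x| * √(s.γ * s.P x / s.ρ x)) '' s.R) := by
  obtain ⟨C, hC0, hC⟩ := s.exists_abs_𝒜_le
  obtain ⟨D, hD0, hD⟩ := s.exists_exp_S_le
  refine ⟨C * √(s.γ * (s.ρO ^ (s.γ - 1) * D)), ?_⟩
  rintro _ ⟨x, hx, rfl⟩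
  have hγ := s.γ_pos
  have hw : s.w x ≤ s.ρO ^ (s.γ - 1) :=
    Real.rpow_le_rpow (s.ρ_nonneg x) (s.ρ_le_ρO x) (by linarith [s.one_lt_γ])
  have hw0 := (w_pos hx).le
  dsimp only
  rw [mul_div_assoc, P_div_ρ hx]
  gcongr
  · exact hC x hx
  · exact Real.rpow_nonneg s.ρO_nonneg _
  · exact hD x hx

variable {s} in
theorem gradient_w {x : E3} (hx : x ∈ s.R) :
    gradient s.w x = ((s.γ - 1) * s.ρ x ^ (s.γ - 2)) • gradient s.ρ x := by
  have h1 := (s.ρ_contDiff.differentiable (by simp) x).hasFDerivAt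
  have h2 := (h1.rpow_const (p := s.γ - 1) (Or.inl (ρ_pos hx).ne')).fderiv
  rw [gradient, gradient, show s.w = fun x => s.ρ x ^ (s.γ - 1) from rfl, h2, map_smul]
  ring_nf

theorem bddAbove_κ₂ :
    BddAbove ((fun x => s.γ * s.P x * |s.𝒜 x| / s.ρ x ^ 2 * ‖gradient s.ρ x‖) '' s.R) := by
  obtain ⟨C, hC0, hC⟩ := s.exists_abs_𝒜_le
  obtain ⟨D, hD0, hD⟩ := s.exists_exp_S_le
  obtain ⟨M, hM0, hM⟩ := s.exists_norm_fderiv_w_le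
  have hγ1 : 0 < s.γ - 1 := by linarith [s.one_lt_γ]
  have hγ := s.γ_pos
  refine ⟨s.γ / (s.γ - 1) * D * C * M, ?_⟩
  rintro _ ⟨x, hx, rfl⟩
  have h1 : s.γ * s.P x * |s.𝒜 x| / s.ρ x ^ 2 * ‖gradient s.ρ x‖ =
      s.γ / (s.γ - 1) * Real.exp (s.S x / s.CV) * |s.𝒜 x| * ‖fderiv ℝ s.w x‖ := by
    have hρ := ρ_pos hx
    rw [← norm_gradient, gradient_w hx, norm_smul, norm_mul, Real.norm_of_nonneg hγ1.le,
      Real.norm_of_nonneg (Real.rpow_nonneg hρ.le _), P, pressureOf,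
      show s.γ - 2 = s.γ - (2 : ℕ) by norm_num, Real.rpow_sub_natCast hρ.ne']
    field_simp
  dsimp only
  rw [h1]
  have := hC x hx
  have := hD x hx
  have := hM x hx
  gcongr

theorem le_κ₁ {x : E3} (hx : x ∈ s.R) : |s.𝒜 x| * √(s.γ * s.P x / s.ρ x) ≤ s.κ₁ :=
  le_csSup s.bddAbove_κ₁ ⟨x, hx, rfl⟩

theorem le_κ₂ {x : E3} (hx : x ∈ s.R) :
    s.γ * s.P x * |s.𝒜 x| / s.ρ x ^ 2 * ‖gradient s.ρ x‖ ≤ s.κ₂ :=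
  le_csSup s.bddAbove_κ₂ ⟨x, hx, rfl⟩

theorem κ₁_nonneg : 0 ≤ s.κ₁ := by
  obtain ⟨x, hx⟩ := s.R_nonempty
  exact le_trans (by positivity) (s.le_κ₁ hx)

theorem κ₂_nonneg : 0 ≤ s.κ₂ := by
  obtain ⟨x, hx⟩ := s.R_nonempty
  have h1 := s.γ_pos
  have h2 := P_pos hx
  exact le_trans (by positivity) (s.le_κ₂ hx)

theorem a_nonneg : 0 ≤ s.a := by
  have h1 := s.κ₂_nonneg
  have h2 := s.ρO_nonneg
  have h3 := s.G_pos
  have h4 := Real.pi_pos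
  unfold a
  positivity

variable {s} in
/-- `∇P = (γP/ρ) ∇ρ - γP 𝔞`. -/
theorem gradient_P {x : E3} (hx : x ∈ s.R) :
    gradient s.P x = (s.γ * s.P x / s.ρ x) • gradient s.ρ x - (s.γ * s.P x) • s.𝔞 x := by
  have hρ := ρ_pos hx
  have hγ := s.γ_pos.ne'
  have hCV := s.CV_pos.ne'
  have h1 := (s.ρ_contDiff.differentiable (by simp) x).hasFDerivAt
  have h2 := h1.rpow_const (p := s.γ) (Or.inl hρ.ne')
  have h3 := ((s.S_contDiff.differentiable (by simp) x).hasFDerivAt.mul_const s.CV⁻¹).exp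
  have h4 := (h2.mul h3).fderiv
  have e : (fun x => s.ρ x ^ s.γ * Real.exp (s.S x * s.CV⁻¹)) = s.P := by
    funext y; rw [P, pressureOf, div_eq_mul_inv]
  have e' : ((fun x => s.ρ x ^ s.γ) * fun x => Real.exp (s.S x * s.CV⁻¹)) = s.P := e
  have hP : s.P x = s.ρ x ^ s.γ * Real.exp (s.S x * s.CV⁻¹) := congrFun e.symm x
  rw [hP, gradient, ← e', h4, 𝔞, gradient, gradient]
  simp only [map_add, map_smul, smul_neg, sub_neg_eq_add, smul_smul]
  rw [add_comm, Real.rpow_sub_one hρ.ne']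
  congr 2 <;> field_simp

/-- The weight `γP/ρ²` is bounded below on the star, as `γ < 2`. -/
theorem exists_le_weight : ∃ c, 0 < c ∧ ∀ x ∈ s.R, c ≤ s.γ * s.P x / s.ρ x ^ 2 := by
  obtain ⟨C, hC⟩ := s.isCompact_closure_R.exists_bound_of_continuousOn
    s.S_contDiff.continuous.continuousOn
  obtain ⟨y, hy⟩ := s.R_nonempty
  have hγ := s.γ_pos
  have hO : 0 < s.ρO := (ρ_pos hy).trans_le (s.ρ_le_ρO y)
  refine ⟨s.γ * (s.ρO ^ (s.γ - 2) * Real.exp (-C / s.CV)), by positivity, fun x hx => ?_⟩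
  have hρ := ρ_pos hx
  have e : s.γ * s.P x / s.ρ x ^ 2 = s.γ * (s.ρ x ^ (s.γ - 2) * Real.exp (s.S x / s.CV)) := by
    rw [P, pressureOf, show s.γ - 2 = s.γ - (2 : ℕ) by norm_num, Real.rpow_sub_natCast hρ.ne']
    ring
  rw [e]
  have h1 : s.ρO ^ (s.γ - 2) ≤ s.ρ x ^ (s.γ - 2) :=
    Real.rpow_le_rpow_of_nonpos hρ (s.ρ_le_ρO x) (by linarith [s.γ_lt_two])
  have h2 : -C ≤ s.S x := (abs_le.1 (hC x (subset_closure hx))).1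
  have h3 : Real.exp (-C / s.CV) ≤ Real.exp (s.S x / s.CV) :=
    Real.exp_le_exp.2 (div_le_div_of_nonneg_right h2 s.CV_pos.le)
  gcongr

end BarotropicStar

/-! ### Test functions and integration by parts -/

namespace Star

section
variable {F : Type*} [NormedAddCommGroup F] [NormedSpace ℝ F]

/-- A function that is smooth on `D` and vanishes off a compact subset of `D` is a test function. -/
theorem isTest_of_contDiffOn {D K : Set E3} {f : E3 → F} (hD : IsOpen D) (hf : ContDiffOn ℝ ∞ f D)
    (hK : IsCompact K) (hKD : K ⊆ D) (h0 : ∀ x, x ∉ K → f x = 0) : IsTest D f := by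
  have hts : tsupport f ⊆ K := closure_minimal
    (fun x hx => by_contra fun h => hx (h0 x h)) hK.isClosed
  refine ⟨contDiff_iff_contDiffAt.2 fun x => ?_, hK.of_isClosed_subset (isClosed_tsupport f) hts,
    hts.trans hKD⟩
  by_cases hx : x ∈ D
  · exact hf.contDiffAt (hD.mem_nhds hx)
  · have : f =ᶠ[𝓝 x] fun _ => 0 := by
      filter_upwards [hK.isClosed.isOpen_compl.mem_nhds fun h => hx (hKD h)] with y hy
      exact h0 y hy
    exact contDiffAt_const.congr_of_eventuallyEq this

theorem IsTest.eq_zero {D : Set E3} {f : E3 → F} (h : IsTest D f) {x : E3} (hx : x ∉ D) : f x = 0 :=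
  image_eq_zero_of_notMem_tsupport fun h' => hx (h.2.2 h')

theorem IsTest.of_eq_zero {G : Type*} [NormedAddCommGroup G] [NormedSpace ℝ G] {D : Set E3}
    {f : E3 → F} {g : E3 → G} (h : IsTest D f) (hD : IsOpen D) (hg : ContDiffOn ℝ ∞ g D)
    (h0 : ∀ x, f x = 0 → g x = 0) : IsTest D g :=
  isTest_of_contDiffOn hD hg h.2.1 h.2.2
    fun x hx => h0 x (image_eq_zero_of_notMem_tsupport hx)

theorem IsTest.smul_left {𝕜 : Type*} [NormedField 𝕜] [NormedAlgebra ℝ 𝕜] [NormedSpace 𝕜 F]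
    [IsScalarTower ℝ 𝕜 F] {D : Set E3} {f : E3 → F} (h : IsTest D f) (hD : IsOpen D) {c : E3 → 𝕜}
    (hc : ContDiffOn ℝ ∞ c D) : IsTest D fun x => c x • f x :=
  h.of_eq_zero hD (hc.smul h.1.contDiffOn) fun x hx => by rw [hx, smul_zero]

theorem IsTest.add {D : Set E3} {f g : E3 → F} (hf : IsTest D f) (hg : IsTest D g) :
    IsTest D (f + g) :=
  ⟨hf.1.add hg.1, hf.2.1.add hg.2.1, (tsupport_add f g).trans (Set.union_subset hf.2.2 hg.2.2)⟩

theorem IsTest.neg {D : Set E3} {f : E3 → F} (hf : IsTest D f) : IsTest D fun x => -f x :=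
  ⟨hf.1.neg, hf.2.1.neg, by
    have : tsupport (fun x => -f x) = tsupport f := by
      simp [tsupport, Function.support_fun_neg]
    rw [this]; exact hf.2.2⟩

theorem IsTest.sum {ι : Type*} {D : Set E3} {t : Finset ι} {f : ι → E3 → F}
    (hf : ∀ i ∈ t, IsTest D (f i)) : IsTest D fun x => ∑ i ∈ t, f i x := by
  classical
  induction t using Finset.induction_on with
  | empty => exact ⟨by simpa using contDiff_const, by simpa using! HasCompactSupport.zero,
      by simp [tsupport]⟩
  | insert i t hi ih =>
    simp only [Finset.sum_insert hi]
    exact (hf i (by simp)).add (ih fun j hj => hf j (by simp [hj]))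

theorem IsTest.clm_comp {G : Type*} [NormedAddCommGroup G] [NormedSpace ℝ G] {D : Set E3}
    {f : E3 → F} (hf : IsTest D f) (T : F →L[ℝ] G) : IsTest D fun x => T (f x) := by
  have hs : tsupport (fun x => T (f x)) ⊆ tsupport f :=
    closure_mono fun x hx h => hx (by simp only [h, map_zero])
  exact ⟨T.contDiff.comp hf.1, hf.2.1.of_isClosed_subset (isClosed_tsupport _) hs, hs.trans hf.2.2⟩

theorem IsTest.pd {D : Set E3} {f : E3 → F} (hf : IsTest D f) (i : Fin 3) : IsTest D (pd i f) := by
  have h : IsTest D (fderiv ℝ f) :=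
    ⟨hf.1.fderiv_right (by simp), hf.2.1.fderiv ℝ, (tsupport_fderiv_subset ℝ).trans hf.2.2⟩
  exact h.clm_comp (ContinuousLinearMap.apply ℝ F (EuclideanSpace.single i (1 : ℝ)))

theorem IsTest.integrable {D : Set E3} {f : E3 → F} (hf : IsTest D f) : Integrable f :=
  hf.1.continuous.integrable_of_hasCompactSupport hf.2.1

theorem IsTest.setIntegral_eq {D : Set E3} {f : E3 → F} (hf : IsTest D f) :
    ∫ x in D, f x = ∫ x, f x :=
  setIntegral_eq_integral_of_forall_compl_eq_zero fun _ hx => hf.eq_zero hx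

theorem integral_pd_eq_zero {f : E3 → F} (hf : ContDiff ℝ 1 f) (hc : HasCompactSupport f)
    (i : Fin 3) : ∫ x, pd i f x = 0 := by
  have hi : Integrable (fun x => fderiv ℝ f x (EuclideanSpace.single i (1 : ℝ))) :=
    ((hf.continuous_fderiv (by simp)).clm_apply continuous_const).integrable_of_hasCompactSupport
      (hc.fderiv_apply (𝕜 := ℝ) _)
  have := integral_smul_fderiv_eq_neg_fderiv_smul_of_integrable (μ := volume)
    (f := fun _ : E3 => (1 : ℝ)) (g := f) (v := EuclideanSpace.single i (1 : ℝ))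
    (by simp) (by simpa using hi)
    (by simpa using hf.continuous.integrable_of_hasCompactSupport hc)
    (fun _ _ => differentiableAt_const _) (fun _ _ => hf.differentiable (by simp) _)
  simpa [pd] using this

theorem pd_smul {𝕜 : Type*} [NontriviallyNormedField 𝕜] [NormedAlgebra ℝ 𝕜] [NormedSpace 𝕜 F]
    [IsScalarTower ℝ 𝕜 F] {c : E3 → 𝕜} {f : E3 → F} {x : E3} (hc : DifferentiableAt ℝ c x)
    (hf : DifferentiableAt ℝ f x) (i : Fin 3) :
    pd i (fun y => c y • f y) x = c x • pd i f x + pd i c x • f x := by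
  simp [pd, fderiv_fun_smul hc hf]

end

theorem integral_mul_pd {h g : E3 → ℂ} (hh : ContDiff ℝ 1 h) (hg : ContDiff ℝ 1 g)
    (hc : HasCompactSupport g) (i : Fin 3) : ∫ x, h x * pd i g x = -∫ x, pd i h x * g x := by
  have hi1 : Integrable fun x => h x * fderiv ℝ g x (EuclideanSpace.single i (1 : ℝ)) :=
    (hh.continuous.mul ((hg.continuous_fderiv (by simp)).clm_apply
      continuous_const)).integrable_of_hasCompactSupport (hc.fderiv_apply (𝕜 := ℝ) _).mul_left
  have hi2 : Integrable fun x => fderiv ℝ h x (EuclideanSpace.single i (1 : ℝ)) * g x :=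
    (((hh.continuous_fderiv (by simp)).clm_apply continuous_const).mul
      hg.continuous).integrable_of_hasCompactSupport hc.mul_left
  exact integral_mul_fderiv_eq_neg_fderiv_mul_of_integrable hi2 hi1
    ((hh.continuous.mul hg.continuous).integrable_of_hasCompactSupport hc.mul_left)
    (fun _ _ => hh.differentiable (by simp) _) (fun _ _ => hg.differentiable (by simp) _)

theorem IsTest.comp_proj {D : Set E3} {u : E3 → V3} (hu : IsTest D u) (i : Fin 3) :
    IsTest D fun x => u x i :=
  hu.clm_comp ((EuclideanSpace.proj i : V3 →L[ℂ] ℂ).restrictScalars ℝ)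

theorem IsTest.divC {D : Set E3} {u : E3 → V3} (hu : IsTest D u) : IsTest D (divC u) :=
  IsTest.sum fun i _ => (hu.comp_proj i).pd i

theorem IsTest.toLp {D : Set E3} {u : Fin 3 → E3 → ℂ} (hu : ∀ i, IsTest D (u i)) :
    IsTest D fun x => (WithLp.toLp 2 fun i => u i x : V3) := by
  have : (fun x => (WithLp.toLp 2 fun i => u i x : V3)) =
      fun x => ∑ i, (ContinuousLinearMap.toSpanSingleton ℂ
        (EuclideanSpace.single i (1 : ℂ) : V3)).restrictScalars ℝ (u i x) := by
    funext x
    ext j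
    simp [Pi.single_apply]
  rw [this]
  exact IsTest.sum fun i _ => (hu i).clm_comp _

theorem IsTest.gradC {D : Set E3} {f : E3 → ℂ} (hf : IsTest D f) : IsTest D (gradC f) :=
  IsTest.toLp fun i => hf.pd i

/-- Integration by parts: the gradient is minus the transpose of the divergence. -/
theorem integral_mul_divC {h : E3 → ℂ} {ψ : E3 → V3} {D : Set E3} (hh : ContDiff ℝ 1 h)
    (hψ : IsTest D ψ) : ∫ x in D, h x * divC ψ x = -∫ x in D, cdot (gradC h x) (ψ x) := by
  rw [setIntegral_eq_integral_of_forall_compl_eq_zero fun x hx => by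
      rw [hψ.divC.eq_zero hx, mul_zero],
    setIntegral_eq_integral_of_forall_compl_eq_zero fun x hx => by simp [cdot, hψ.eq_zero hx]]
  simp only [divC, cdot, gradC, Finset.mul_sum]
  rw [integral_finsetSum, integral_finsetSum, ← Finset.sum_neg_distrib]
  · exact Finset.sum_congr rfl fun i _ =>
      integral_mul_pd hh ((hψ.comp_proj i).1.of_le (by simp)) (hψ.comp_proj i).2.1 i
  · intro i _
    exact ((((hh.continuous_fderiv (by simp)).clm_apply continuous_const)).mul
      (hψ.comp_proj i).1.continuous).integrable_of_hasCompactSupport (hψ.comp_proj i).2.1.mul_left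
  · intro i _
    exact (hh.continuous.mul ((hψ.comp_proj i).pd i).1.continuous).integrable_of_hasCompactSupport
      ((hψ.comp_proj i).pd i).2.1.mul_left

end Star

/-! ### Cutoffs at the vacuum boundary -/

theorem exists_deriv_smoothTransition_le :
    ∃ C, 0 ≤ C ∧ ∀ t, deriv Real.smoothTransition t ≤ C := by
  have hc : Continuous (deriv Real.smoothTransition) :=
    (Real.smoothTransition.contDiff (n := 1)).continuous_deriv (by simp)
  obtain ⟨C, hC⟩ := (isCompact_Icc (a := (0 : ℝ)) (b := 1)).exists_bound_of_continuousOn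
    hc.continuousOn
  have hC0 : 0 ≤ C := (norm_nonneg _).trans (hC 0 (by simp))
  refine ⟨C, hC0, fun t => ?_⟩
  by_cases ht : t ∈ Set.Icc (0 : ℝ) 1
  · exact (le_abs_self _).trans (hC t ht)
  · have : deriv Real.smoothTransition t = 0 := by
      rw [Set.mem_Icc, not_and_or, not_le, not_le] at ht
      rcases ht with ht | ht
      · have : Real.smoothTransition =ᶠ[𝓝 t] fun _ => 0 := by
          filter_upwards [Iio_mem_nhds ht] with y hy
          exact Real.smoothTransition.zero_of_nonpos (le_of_lt hy)
        rw [this.deriv_eq, deriv_const]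
      · have : Real.smoothTransition =ᶠ[𝓝 t] fun _ => 1 := by
          filter_upwards [Ioi_mem_nhds ht] with y hy
          exact Real.smoothTransition.one_of_one_le (le_of_lt hy)
        rw [this.deriv_eq, deriv_const]
    exact this ▸ hC0

theorem gradient_apply (f : E3 → ℝ) (x : E3) (i : Fin 3) : gradient f x i = pd i f x := by
  have h := inner_gradient_left (𝕜 := ℝ) (f := f) (x := x) (y := EuclideanSpace.single i (1 : ℝ))
  rw [pd, ← h, EuclideanSpace.inner_single_right]
  simp

theorem norm_sq_fderiv (f : E3 → ℝ) (x : E3) : ‖fderiv ℝ f x‖ ^ 2 = ∑ i, pd i f x ^ 2 := by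
  rw [← norm_gradient, EuclideanSpace.norm_sq_eq]
  refine Finset.sum_congr rfl fun i _ => ?_
  rw [gradient_apply, Real.norm_eq_abs, sq_abs]

namespace BarotropicStar

variable (s : BarotropicStar)

/-- A smooth cutoff that vanishes where `ρ^(γ-1) ≤ ε` and equals `1` where `ρ^(γ-1) ≥ 2ε`. -/
noncomputable def cutoff (ε : ℝ) (x : E3) : ℝ := Real.smoothTransition (s.w x / ε - 1)

theorem cutoff_nonneg (ε : ℝ) (x : E3) : 0 ≤ s.cutoff ε x := Real.smoothTransition.nonneg _

theorem cutoff_le_one (ε : ℝ) (x : E3) : s.cutoff ε x ≤ 1 := Real.smoothTransition.le_one _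

theorem isCompact_superlevel {ε : ℝ} (hε : 0 < ε) : IsCompact {x | ε ≤ s.w x} := by
  refine Metric.isCompact_of_isClosed_isBounded (isClosed_le continuous_const s.w_continuous)
    (s.isBounded_R.subset fun x hx => ?_)
  by_contra h
  rw [Set.mem_ofPred_eq, s.w_eq_zero h] at hx
  linarith

theorem superlevel_subset {ε : ℝ} (hε : 0 < ε) : {x | ε ≤ s.w x} ⊆ s.R := fun x hx => by
  by_contra h
  rw [Set.mem_ofPred_eq, s.w_eq_zero h] at hx
  linarith

theorem cutoff_contDiffOn (ε : ℝ) : ContDiffOn ℝ ∞ (s.cutoff ε) s.R :=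
  Real.smoothTransition.contDiff.comp_contDiffOn ((s.w_contDiffOn.div_const ε).sub contDiffOn_const)

theorem isTest_cutoff_smul {F : Type*} [NormedAddCommGroup F] [NormedSpace ℝ F] {ε : ℝ} (hε : 0 < ε)
    {f : E3 → F} (hf : ContDiffOn ℝ ∞ f s.R) : IsTest s.R fun x => s.cutoff ε x • f x := by
  refine isTest_of_contDiffOn s.isOpen_R ((s.cutoff_contDiffOn ε).smul hf)
    (s.isCompact_superlevel hε) (s.superlevel_subset hε) fun x hx => ?_
  have hx : s.w x < ε := not_le.1 hx
  have : s.w x / ε - 1 ≤ 0 := by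
    rw [sub_nonpos, div_le_one hε]; exact hx.le
  rw [cutoff, Real.smoothTransition.zero_of_nonpos this, zero_smul]

theorem isTest_cutoff {ε : ℝ} (hε : 0 < ε) : IsTest s.R (s.cutoff ε) := by
  simpa using s.isTest_cutoff_smul hε (f := fun _ => (1 : ℝ)) contDiffOn_const

variable {s} in
theorem fderiv_cutoff (ε : ℝ) {x : E3} (hx : x ∈ s.R) : fderiv ℝ (s.cutoff ε) x =
    (deriv Real.smoothTransition (s.w x / ε - 1) / ε) • fderiv ℝ s.w x := by
  have h1 := (Real.smoothTransition.contDiffAt (n := 1)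
    (x := s.w x / ε - 1)).differentiableAt (by simp)
  have h2 := ((s.w_contDiffOn.contDiffAt (s.isOpen_R.mem_nhds hx)).differentiableAt
    (by simp)).hasFDerivAt
  have h3 := (h1.hasDerivAt.comp_hasFDerivAt x ((h2.mul_const ε⁻¹).sub_const 1)).fderiv
  have e : (Real.smoothTransition ∘ fun x => s.w x * ε⁻¹ - 1) = s.cutoff ε := rfl
  rw [← e, h3, smul_smul]
  rfl

variable {s} in
theorem pd_w_contDiffOn (i : Fin 3) : ContDiffOn ℝ ∞ (pd i s.w) s.R :=
  (s.w_contDiffOn.fderiv_of_isOpen s.isOpen_R (by simp)).clm_apply contDiffOn_const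

variable {s} in
theorem abs_pd_pd_w_le {x : E3} (hx : x ∈ s.R) (i : Fin 3) :
    |pd i (pd i s.w) x| ≤ ‖fderiv ℝ (fderiv ℝ s.w) x‖ := by
  have h1 : DifferentiableAt ℝ (fderiv ℝ s.w) x :=
    ((s.w_contDiffOn.fderiv_of_isOpen s.isOpen_R (m := ∞) (by simp)).contDiffAt
      (s.isOpen_R.mem_nhds hx)).differentiableAt (by simp)
  have h2 : pd i (pd i s.w) x = fderiv ℝ (fderiv ℝ s.w) x (EuclideanSpace.single i 1)
      (EuclideanSpace.single i 1) := by
    have : pd i s.w = fun y => fderiv ℝ s.w y (EuclideanSpace.single i 1) := rfl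
    rw [pd, this, fderiv_clm_apply h1 (differentiableAt_const _)]
    simp
  rw [h2, ← Real.norm_eq_abs]
  refine ((fderiv ℝ (fderiv ℝ s.w) x).le_opNorm₂ _ _).trans ?_
  simp

/-- Integration by parts of `∇χ · ∇w` moves the derivatives onto `w`, whose Laplacian is bounded;
hence the integral is bounded uniformly in `ε`. -/
theorem exists_integral_cutoff_le : ∃ C, 0 ≤ C ∧ ∀ ε > 0,
    ∫ x in s.R, ∑ i, pd i (s.cutoff ε) x * pd i s.w x ≤ C := by
  obtain ⟨M, hM0, hM⟩ := s.exists_norm_fderiv_fderiv_w_le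
  refine ⟨3 * M * (volume.restrict s.R).real Set.univ, by positivity, fun ε hε => ?_⟩
  have hχ := s.isTest_cutoff hε
  have hdiv : ∀ x ∈ s.R, ∀ i, pd i (fun y => s.cutoff ε y • pd i s.w y) x =
      s.cutoff ε x * pd i (pd i s.w) x + pd i (s.cutoff ε) x * pd i s.w x := fun x hx i =>
    pd_smul (hχ.1.differentiable (by simp) x)
      (((pd_w_contDiffOn i).contDiffAt (s.isOpen_R.mem_nhds hx)).differentiableAt (by simp)) i
  have hV : ∀ i, IsTest s.R fun y => s.cutoff ε y • pd i s.w y := fun i =>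
    s.isTest_cutoff_smul hε (pd_w_contDiffOn i)
  have hz : ∫ x in s.R, ∑ i, pd i (fun y => s.cutoff ε y • pd i s.w y) x = 0 := by
    rw [integral_finsetSum _ fun i _ => (((hV i).pd i).integrable).integrableOn]
    refine Finset.sum_eq_zero fun i _ => ?_
    rw [((hV i).pd i).setIntegral_eq]
    exact integral_pd_eq_zero ((hV i).1.of_le (by simp)) (hV i).2.1 i
  have hi1 : IntegrableOn (fun x => ∑ i, pd i (fun y => s.cutoff ε y • pd i s.w y) x) s.R :=
    (IsTest.sum fun i _ => (hV i).pd i).integrable.integrableOn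
  have hle : ∫ x in s.R, ∑ i, pd i (s.cutoff ε) x * pd i s.w x ≤
      ∫ x in s.R, (∑ i, pd i (fun y => s.cutoff ε y • pd i s.w y) x + 3 * M) := by
    refine setIntegral_mono_on ?_ (hi1.add (integrable_const _)) s.measurableSet_R fun x hx => ?_
    · have : IsTest s.R fun x => ∑ i, pd i s.w x • pd i (s.cutoff ε) x :=
        IsTest.sum fun i _ => (hχ.pd i).smul_left s.isOpen_R (pd_w_contDiffOn i)
      refine this.integrable.integrableOn.congr_fun (fun x _ => ?_) s.measurableSet_R
      exact Finset.sum_congr rfl fun i _ => mul_comm _ _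
    · simp only [hdiv x hx, Finset.sum_add_distrib]
      have : ∀ i, -M ≤ s.cutoff ε x * pd i (pd i s.w) x := fun i => by
        have h1 := (abs_pd_pd_w_le hx i).trans (hM x hx)
        have h2 : |s.cutoff ε x * pd i (pd i s.w) x| ≤ 1 * M := by
          rw [abs_mul, abs_of_nonneg (s.cutoff_nonneg ε x)]
          exact mul_le_mul (s.cutoff_le_one ε x) h1 (abs_nonneg _) zero_le_one
        linarith [neg_abs_le (s.cutoff ε x * pd i (pd i s.w) x)]
      have := Finset.sum_le_sum fun i (_ : i ∈ Finset.univ) => this i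
      simp only [Finset.sum_const, Finset.card_univ, Fintype.card_fin, nsmul_eq_mul] at this
      push_cast at this
      linarith
  rw [integral_add hi1 (integrable_const _), hz, zero_add, integral_const, smul_eq_mul] at hle
  linarith

/-- The energy `∫ ρ |∇χ|²` of the cutoffs tends to zero, because `ρ = w^(1/(γ-1))` with
`1/(γ-1) > 1`. -/
theorem tendsto_cutoff_energy : Tendsto
    (fun k : ℕ => ∫ x in s.R, s.ρ x * ‖fderiv ℝ (s.cutoff (1 / ((k : ℝ) + 1))) x‖ ^ 2)
    atTop (𝓝 0) := by
  obtain ⟨C, hC0, hC⟩ := exists_deriv_smoothTransition_le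
  obtain ⟨M, hM0, hM⟩ := s.exists_integral_cutoff_le
  have hγ1 : 0 < s.γ - 1 := by linarith [s.one_lt_γ]
  set p := 1 / (s.γ - 1)
  have hp : 1 < p := by
    rw [lt_div_iff₀ hγ1]; linarith [s.γ_lt_two]
  have hbound : ∀ ε > 0, ∫ x in s.R, s.ρ x * ‖fderiv ℝ (s.cutoff ε) x‖ ^ 2 ≤
      2 ^ p * C * M * ε ^ (p - 1) := fun ε hε => by
    have hχ := s.isTest_cutoff hε
    have h1 : ∫ x in s.R, s.ρ x * ‖fderiv ℝ (s.cutoff ε) x‖ ^ 2 ≤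
        ∫ x in s.R, (2 * ε) ^ p * (C / ε) * ∑ i, pd i (s.cutoff ε) x * pd i s.w x := by
      refine setIntegral_mono_on ?_ ?_ s.measurableSet_R fun x hx => ?_
      · have hf : Continuous (fderiv ℝ (s.cutoff ε)) := hχ.1.continuous_fderiv (by simp)
        refine Integrable.integrableOn ?_
        refine (s.ρ_contDiff.continuous.mul
          (hf.norm.pow 2)).integrable_of_hasCompactSupport ?_
        exact s.ρ_compact.mul_right
      · have : IsTest s.R fun x => ∑ i, pd i s.w x • pd i (s.cutoff ε) x :=
          IsTest.sum fun i _ => (hχ.pd i).smul_left s.isOpen_R (pd_w_contDiffOn i)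
        refine (this.integrable.integrableOn.congr_fun (fun x _ => ?_)
          s.measurableSet_R).const_mul _
        exact Finset.sum_congr rfl fun i _ => mul_comm _ _
      · set T := deriv Real.smoothTransition (s.w x / ε - 1) with hT
        have hT0 : 0 ≤ T := Real.smoothTransition.monotone.deriv_nonneg
        have e1 : ∑ i, pd i (s.cutoff ε) x * pd i s.w x = T / ε * ‖fderiv ℝ s.w x‖ ^ 2 := by
          rw [norm_sq_fderiv, Finset.mul_sum]
          refine Finset.sum_congr rfl fun i _ => ?_
          rw [pd, pd, fderiv_cutoff ε hx]
          simp only [smul_apply, smul_eq_mul]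
          ring
        rw [e1, fderiv_cutoff ε hx, norm_smul, Real.norm_of_nonneg (by positivity)]
        rcases hT0.eq_or_lt with h0 | hpos
        · rw [← hT, ← h0]; simp
        · have hw : s.w x ≤ 2 * ε := by
            by_contra hlt
            have hlt : 1 < s.w x / ε - 1 := by
              rw [lt_sub_iff_add_lt, lt_div_iff₀ hε]; linarith [not_le.1 hlt]
            have : Real.smoothTransition =ᶠ[𝓝 (s.w x / ε - 1)] fun _ => 1 := by
              filter_upwards [Ioi_mem_nhds hlt] with y hy
              exact Real.smoothTransition.one_of_one_le (le_of_lt hy)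
            rw [hT, this.deriv_eq, deriv_const] at hpos
            exact lt_irrefl _ hpos
          have hρ : s.ρ x ≤ (2 * ε) ^ p := by
            rw [s.ρ_eq_w_rpow x]
            exact Real.rpow_le_rpow (w_pos hx).le hw (by positivity)
          have hTC : T ≤ C := hC _
          calc s.ρ x * (T / ε * ‖fderiv ℝ s.w x‖) ^ 2
              = s.ρ x * (T / ε) * (T / ε * ‖fderiv ℝ s.w x‖ ^ 2) := by ring
            _ ≤ (2 * ε) ^ p * (C / ε) * (T / ε * ‖fderiv ℝ s.w x‖ ^ 2) := by
              gcongr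
    refine h1.trans ?_
    rw [integral_const_mul]
    calc (2 * ε) ^ p * (C / ε) * ∫ x in s.R, ∑ i, pd i (s.cutoff ε) x * pd i s.w x
        ≤ (2 * ε) ^ p * (C / ε) * M := by
          gcongr
          exact hM ε hε
      _ = _ := by
        rw [Real.mul_rpow (by norm_num) hε.le, Real.rpow_sub_one hε.ne']
        ring
  have hlim : Tendsto (fun k : ℕ => 2 ^ p * C * M * (1 / ((k : ℝ) + 1)) ^ (p - 1)) atTop (𝓝 0) := by
    have := (tendsto_one_div_add_atTop_nhds_zero_nat (𝕜 := ℝ)).rpow_const (p := p - 1)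
      (Or.inr (by linarith))
    rw [Real.zero_rpow (by linarith)] at this
    simpa using this.const_mul (2 ^ p * C * M)
  refine squeeze_zero (fun k => ?_) (fun k => hbound _ (by positivity)) hlim
  exact integral_nonneg fun x => mul_nonneg (s.ρ_nonneg x) (sq_nonneg _)

end BarotropicStar

/-! ### The weighted `L²` spaces -/

section WithDensity

variable {α F : Type*} [MeasurableSpace α] {m : Measure α} [NormedAddCommGroup F]
  [InnerProductSpace ℂ F] {d : α → ℝ}

theorem integral_withDensity_ofReal (hd : Measurable d) (h0 : ∀ x, 0 ≤ d x) {G : Type*}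
    [NormedAddCommGroup G] [NormedSpace ℝ G] (f : α → G) :
    ∫ x, f x ∂(m.withDensity fun x => ENNReal.ofReal (d x)) = ∫ x, d x • f x ∂m := by
  rw [integral_withDensity_eq_integral_toReal_smul hd.ennreal_ofReal
    (ae_of_all _ fun _ => ENNReal.ofReal_lt_top)]
  simp only [ENNReal.toReal_ofReal (h0 _)]

theorem integrable_withDensity_ofReal (hd : Measurable d) (h0 : ∀ x, 0 ≤ d x) {G : Type*}
    [NormedAddCommGroup G] [NormedSpace ℝ G] {f : α → G} :
    Integrable f (m.withDensity fun x => ENNReal.ofReal (d x)) ↔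
      Integrable (fun x => d x • f x) m := by
  rw [integrable_withDensity_iff_integrable_smul' hd.ennreal_ofReal
    (ae_of_all _ fun _ => ENNReal.ofReal_lt_top)]
  simp only [ENNReal.toReal_ofReal (h0 _)]

/-- Multiplication by the square root of the density maps the weighted `L²` space to the
unweighted one. -/
theorem memLp_sqrt_smul (hd : Measurable d) (h0 : ∀ x, 0 ≤ d x)
    (f : Lp F 2 (m.withDensity fun x => ENNReal.ofReal (d x))) :
    MemLp (fun x => √(d x) • f x) 2 m := by
  have hm : AEStronglyMeasurable (fun x => √(d x) • f x) m :=
    hd.sqrt.aestronglyMeasurable.smul (Lp.stronglyMeasurable f).aestronglyMeasurable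
  rw [memLp_two_iff_integrable_sq_norm hm]
  have := ((integrable_withDensity_ofReal hd h0).1
    ((Lp.memLp f).integrable_norm_pow two_ne_zero))
  refine this.congr (ae_of_all _ fun x => ?_)
  simp only [norm_smul, mul_pow, Real.norm_eq_abs, sq_abs, Real.sq_sqrt (h0 x), smul_eq_mul]

theorem norm_sq_eq_integral_sqrt (hd : Measurable d) (h0 : ∀ x, 0 ≤ d x)
    (f : Lp F 2 (m.withDensity fun x => ENNReal.ofReal (d x))) :
    ‖f‖ ^ 2 = ∫ x, ‖√(d x) • f x‖ ^ 2 ∂m := by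
  rw [norm_sq_Lp_two, integral_withDensity_ofReal hd h0]
  refine integral_congr_ae (ae_of_all _ fun x => ?_)
  simp only [norm_smul, mul_pow, Real.norm_eq_abs, sq_abs, Real.sq_sqrt (h0 x), smul_eq_mul]

end WithDensity

namespace BarotropicStar

variable (s : BarotropicStar)

/-- The weight `γP/ρ²` of the space `K`. -/
noncomputable def W (x : E3) : ℝ := s.γ * s.P x / s.ρ x ^ 2

theorem W_nonneg (x : E3) : 0 ≤ s.W x :=
  div_nonneg (mul_nonneg s.γ_pos.le (s.P_nonneg x)) (sq_nonneg _)

variable {s} in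
theorem W_pos {x : E3} (hx : x ∈ s.R) : 0 < s.W x :=
  div_pos (mul_pos s.γ_pos (P_pos hx)) (pow_pos (ρ_pos hx) 2)

theorem measurable_W : Measurable s.W :=
  (s.measurable_P.const_mul _).div (s.measurable_ρ.pow_const _)

theorem W_contDiffOn : ContDiffOn ℝ ∞ s.W s.R :=
  (contDiffOn_const.mul s.P_contDiffOn).div (s.ρ_contDiffOn.pow 2)
    fun _ hx => (pow_pos (ρ_pos hx) 2).ne'

theorem ae_μ_of_ae {p : E3 → Prop} (h : ∀ᵐ x ∂volume.restrict s.R, p x) : ∀ᵐ x ∂s.μ, p x :=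
  (withDensity_absolutelyContinuous _ _).ae_le h

theorem ae_ν_of_ae {p : E3 → Prop} (h : ∀ᵐ x ∂volume.restrict s.R, p x) : ∀ᵐ x ∂s.ν, p x :=
  (withDensity_absolutelyContinuous _ _).ae_le h

theorem inner_H (v u : s.H) : inner ℂ v u = ∫ x in s.R, s.ρ x • (inner ℂ (v x) (u x) : ℂ) := by
  rw [L2.inner_def]
  exact integral_withDensity_ofReal s.measurable_ρ s.ρ_nonneg _

theorem inner_K (v u : s.K) : inner ℂ v u = ∫ x in s.R, s.W x • (inner ℂ (v x) (u x) : ℂ) := by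
  rw [L2.inner_def]
  exact integral_withDensity_ofReal s.measurable_W s.W_nonneg _

variable {s} in
/-- The unweighted representative `√ρ u` of `u ∈ ℌ`. -/
noncomputable def sqrtH (u : s.H) (x : E3) : V3 := √(s.ρ x) • u x

variable {s} in
/-- The unweighted representative `√(γP/ρ²) g` of `g ∈ K`. -/
noncomputable def sqrtK (g : s.K) (x : E3) : ℂ := √(s.W x) • g x

variable {s} in
theorem memLp_sqrtH (u : s.H) : MemLp (sqrtH u) 2 (volume.restrict s.R) :=
  memLp_sqrt_smul s.measurable_ρ s.ρ_nonneg u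

variable {s} in
theorem memLp_sqrtK (g : s.K) : MemLp (sqrtK g) 2 (volume.restrict s.R) :=
  memLp_sqrt_smul s.measurable_W s.W_nonneg g

variable {s} in
theorem norm_sq_H (u : s.H) : ‖u‖ ^ 2 = ∫ x in s.R, ‖sqrtH u x‖ ^ 2 :=
  norm_sq_eq_integral_sqrt s.measurable_ρ s.ρ_nonneg u

variable {s} in
theorem norm_sq_K (g : s.K) : ‖g‖ ^ 2 = ∫ x in s.R, ‖sqrtK g x‖ ^ 2 :=
  norm_sq_eq_integral_sqrt s.measurable_W s.W_nonneg g

variable {s} in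
theorem ρ_smul_eq (u : s.H) (x : E3) : s.ρ x • u x = √(s.ρ x) • sqrtH u x := by
  rw [sqrtH, smul_smul, Real.mul_self_sqrt (s.ρ_nonneg x)]

variable {s} in
theorem memLp_ρ_smul (u : s.H) :
    MemLp (fun x => s.ρ x • u x) 2 (volume.restrict s.R) := by
  refine (memLp_sqrtH u).of_le_mul (c := √s.ρO) ?_ (ae_of_all _ fun x => ?_)
  · exact s.measurable_ρ.aestronglyMeasurable.smul (Lp.stronglyMeasurable u).aestronglyMeasurable
  · rw [ρ_smul_eq, norm_smul, Real.norm_of_nonneg (Real.sqrt_nonneg _)]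
    gcongr
    exact s.ρ_le_ρO x

variable {s} in
theorem integral_norm_sq_ρ_smul_le (u : s.H) :
    ∫ x in s.R, ‖s.ρ x • u x‖ ^ 2 ≤ s.ρO * ‖u‖ ^ 2 := by
  rw [norm_sq_H, ← integral_const_mul]
  refine integral_mono ((memLp_ρ_smul u).integrable_norm_pow two_ne_zero)
    (((memLp_sqrtH u).integrable_norm_pow two_ne_zero).const_mul _) fun x => ?_
  simp only
  rw [ρ_smul_eq, norm_smul, Real.norm_of_nonneg (Real.sqrt_nonneg _), mul_pow,
    Real.sq_sqrt (s.ρ_nonneg x)]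
  gcongr
  exact s.ρ_le_ρO x

variable {s} in
/-- `K` is contained in the unweighted `L²(ℜ)`, as its weight is bounded below. -/
theorem memLp_K (g : s.K) : MemLp g 2 (volume.restrict s.R) := by
  obtain ⟨c, hc0, hc⟩ := s.exists_le_weight
  refine (memLp_sqrtK g).of_le_mul (c := (√c)⁻¹) (Lp.stronglyMeasurable g).aestronglyMeasurable ?_
  filter_upwards [ae_restrict_mem s.measurableSet_R] with x hx
  have h1 : √c ≤ √(s.W x) := Real.sqrt_le_sqrt (hc x hx)
  have h2 : 0 < √c := Real.sqrt_pos.2 hc0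
  rw [sqrtK, norm_smul, Real.norm_of_nonneg (Real.sqrt_nonneg _), ← mul_assoc]
  refine le_mul_of_one_le_left (norm_nonneg _) ?_
  rw [inv_mul_eq_div, one_le_div h2]
  exact h1

variable {s} in
theorem locallyIntegrableOn_ρ_smul (u : s.H) : LocallyIntegrableOn (fun x => s.ρ x • u x) s.R :=
  IntegrableOn.locallyIntegrableOn ((memLp_ρ_smul u).integrable one_le_two)

variable {s} in
theorem locallyIntegrableOn_K (g : s.K) : LocallyIntegrableOn g s.R :=
  IntegrableOn.locallyIntegrableOn ((memLp_K g).integrable one_le_two)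

section Tests

variable {s}
variable {F : Type*} [NormedAddCommGroup F] [NormedSpace ℝ F]

theorem memLp_test_withDensity {d : E3 → ℝ} (hd : Measurable d) (h0 : ∀ x, 0 ≤ d x)
    (hs : ContDiffOn ℝ ∞ d s.R) {φ : E3 → F} (hφ : IsTest s.R φ) :
    MemLp φ 2 ((volume.restrict s.R).withDensity fun x => ENNReal.ofReal (d x)) := by
  rw [memLp_two_iff_integrable_sq_norm hφ.1.continuous.aestronglyMeasurable,
    integrable_withDensity_ofReal hd h0]
  have h1 := hφ.smul_left s.isOpen_R hs
  have h2 : Integrable fun x => ‖d x • φ x‖ * ‖φ x‖ :=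
    (h1.1.continuous.norm.mul hφ.1.continuous.norm).integrable_of_hasCompactSupport
      hφ.2.1.norm.mul_left
  refine h2.integrableOn.congr (ae_of_all _ fun x => ?_)
  simp only [norm_smul, Real.norm_of_nonneg (h0 x), smul_eq_mul]
  ring

theorem memLp_μ {φ : E3 → F} (hφ : IsTest s.R φ) : MemLp φ 2 s.μ :=
  memLp_test_withDensity s.measurable_ρ s.ρ_nonneg s.ρ_contDiffOn hφ

theorem memLp_ν {φ : E3 → F} (hφ : IsTest s.R φ) : MemLp φ 2 s.ν :=
  memLp_test_withDensity s.measurable_W s.W_nonneg s.W_contDiffOn hφ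

theorem isTest_ρ_smul {φ : E3 → F} (hφ : IsTest s.R φ) : IsTest s.R fun x => s.ρ x • φ x :=
  hφ.smul_left s.isOpen_R s.ρ_contDiffOn

theorem isTest_ρ_inv_smul {φ : E3 → F} (hφ : IsTest s.R φ) :
    IsTest s.R fun x => (s.ρ x)⁻¹ • φ x :=
  hφ.smul_left s.isOpen_R (s.ρ_contDiffOn.inv fun _ hx => (ρ_pos hx).ne')

theorem cdot_gradC_ofReal {φ : E3 → ℝ} {x : E3} (hφ : DifferentiableAt ℝ φ x) (v : V3) :
    cdot (gradC (fun y => (φ y : ℂ)) x) v = rdot (gradient φ x) v := by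
  have h : ∀ i, pd i (fun y => (φ y : ℂ)) x = (pd i φ x : ℝ) := fun i => by
    have := (Complex.ofRealCLM.hasFDerivAt.comp x hφ.hasFDerivAt).fderiv
    have e : (Complex.ofRealCLM ∘ φ) = fun y => (φ y : ℂ) := rfl
    rw [e] at this
    simp [pd, this]
  simp [cdot, rdot, gradC, h, gradient_apply]

theorem isWeakDivRho_test {φ : E3 → V3} (hφ : IsTest s.R φ) :
    s.IsWeakDivRho φ (divC fun y => s.ρ y • φ y) := by
  have h1 := isTest_ρ_smul hφ
  refine ⟨h1.integrable.locallyIntegrable.locallyIntegrableOn _,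
    h1.divC.integrable.locallyIntegrable.locallyIntegrableOn _, fun ψ hψ => ?_⟩
  have h2 : ContDiff ℝ 1 fun x => (ψ x : ℂ) :=
    Complex.ofRealCLM.contDiff.comp (hψ.1.of_le (by simp))
  have := integral_mul_divC (D := s.R) h2 h1
  simp only [cdot_gradC_ofReal (hψ.1.differentiable (by simp) _)] at this
  simpa only [Complex.real_smul] using this

end Tests

/-- The element of `𝔊` given by a test field. -/
noncomputable def ofTest {s : BarotropicStar} {φ : E3 → V3} (hφ : IsTest s.R φ) : s.𝔊 :=
  ⟨WithLp.toLp 2 ((memLp_μ hφ).toLp φ, (memLp_ν (isTest_ρ_smul hφ).divC).toLp _),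
    (isWeakDivRho_test hφ).congr s
      ((s.ae_of_ae_μ (memLp_μ hφ).coeFn_toLp).mono fun _ h => h.symm)
      ((s.ae_of_ae_ν (memLp_ν (isTest_ρ_smul hφ).divC).coeFn_toLp).mono fun _ h => h.symm)⟩

section

variable {s}

theorem fld_ofTest {φ : E3 → V3} (hφ : IsTest s.R φ) : fld (ofTest hφ) =ᵐ[s.μ] φ :=
  (memLp_μ hφ).coeFn_toLp

theorem fld_ofTest_eq {φ : E3 → V3} (hφ : IsTest s.R φ) {u : s.H} (hu : u =ᵐ[s.μ] φ) :
    fld (ofTest hφ) = u :=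
  Lp.ext ((fld_ofTest hφ).trans hu.symm)

theorem dvg_ofTest {φ : E3 → V3} (hφ : IsTest s.R φ) :
    dvg (ofTest hφ) =ᵐ[s.ν] divC fun y => s.ρ y • φ y :=
  (memLp_ν (isTest_ρ_smul hφ).divC).coeFn_toLp

theorem ofTest_mem {φ : E3 → V3} (hφ : IsTest s.R φ) : ofTest hφ ∈ s.test𝔊 :=
  ⟨φ, hφ, fld_ofTest hφ⟩

theorem eq_zero_of_integral_test_smul {F : Type*} [NormedAddCommGroup F] [NormedSpace ℝ F]
    [CompleteSpace F] {g : E3 → F} (hg : LocallyIntegrableOn g s.R)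
    (h : ∀ φ : E3 → ℝ, IsTest s.R φ → ∫ x in s.R, φ x • g x = 0) :
    ∀ᵐ x ∂volume.restrict s.R, g x = 0 := by
  rw [ae_restrict_iff' s.measurableSet_R]
  refine s.isOpen_R.ae_eq_zero_of_integral_contDiff_smul_eq_zero hg fun φ h1 h2 h3 => ?_
  rw [← h φ ⟨h1, h2, h3⟩, setIntegral_eq_integral_of_forall_compl_eq_zero fun x hx => ?_]
  rw [IsTest.eq_zero ⟨h1, h2, h3⟩ hx, zero_smul]

/-- The weak divergence is determined by the field. -/
theorem fld_injective : Function.Injective (fld : s.𝔊 → s.H) := by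
  intro z z' h
  have hd : dvg z = dvg z' := by
    have hz : s.IsWeakDivRho (fld z) (dvg z) := z.2
    have hz' : s.IsWeakDivRho (fld z') (dvg z') := z'.2
    have h0 : ∀ᵐ x ∂volume.restrict s.R, dvg z x - dvg z' x = 0 := by
      refine eq_zero_of_integral_test_smul (hz.2.1.sub hz'.2.1) fun φ hφ => ?_
      have i1 := s.integrableOn_smul_of_locallyIntegrableOn hz.2.1 hφ.1.continuous hφ.2.1 hφ.2.2
      have i2 := s.integrableOn_smul_of_locallyIntegrableOn hz'.2.1 hφ.1.continuous hφ.2.1 hφ.2.2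
      simp only [smul_sub]
      rw [integral_sub i1 i2, hz.2.2 φ hφ, hz'.2.2 φ hφ, h, sub_self]
    exact Lp.ext ((s.ae_ν_of_ae h0).mono fun x hx => sub_eq_zero.1 hx)
  apply Subtype.ext
  apply (WithLp.equiv 2 (s.H × s.K)).injective
  exact Prod.ext h hd

theorem norm_sq_𝔊 (z : s.𝔊) : ‖z‖ ^ 2 = ‖fld z‖ ^ 2 + ‖dvg z‖ ^ 2 :=
  WithLp.prod_norm_sq_eq_of_L2 z.1

end

/-- The weak divergence is a closed operator, so `𝔊` is complete. -/
theorem completeSpace_𝔊 : CompleteSpace s.𝔊 := by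
  have hcl : IsClosed (s.𝔊 : Set (WithLp 2 (s.H × s.K))) := by
    have : (s.𝔊 : Set (WithLp 2 (s.H × s.K))) = ⋂ (φ : E3 → ℝ) (_ : IsTest s.R φ),
        {z | ∫ x in s.R, φ x • z.snd x =
          -∫ x in s.R, rdot (gradient φ x) (s.ρ x • z.fst x)} := by
      ext z
      simp only [Set.mem_iInter]
      exact ⟨fun h φ hφ => h.2.2 φ hφ, fun h =>
        ⟨locallyIntegrableOn_ρ_smul z.fst, locallyIntegrableOn_K z.snd, h⟩⟩
    rw [this]
    refine isClosed_iInter fun φ => isClosed_iInter fun hφ => ?_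
    have hk : IsTest s.R fun x => (((s.W x)⁻¹ • φ x : ℝ) : ℂ) :=
      (hφ.smul_left s.isOpen_R (s.W_contDiffOn.inv fun _ hx => (W_pos hx).ne')).clm_comp
        Complex.ofRealCLM
    have hv : IsTest s.R fun x => toV (gradient φ x) := by
      refine IsTest.toLp fun i => ?_
      simp only [gradient_apply]
      exact (hφ.pd i).clm_comp Complex.ofRealCLM
    have e1 : ∀ g : s.K, ∫ x in s.R, φ x • g x = inner ℂ ((memLp_ν hk).toLp _) g := fun g => by
      rw [inner_K]
      refine integral_congr_ae ?_
      filter_upwards [s.ae_of_ae_ν (memLp_ν hk).coeFn_toLp, ae_restrict_mem s.measurableSet_R]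
        with x hx hxR
      have : (s.W x : ℂ) ≠ 0 := Complex.ofReal_ne_zero.2 (W_pos hxR).ne'
      rw [hx]
      simp
      field_simp
    have e2 : ∀ u : s.H, ∫ x in s.R, rdot (gradient φ x) (s.ρ x • u x) =
        inner ℂ ((memLp_μ hv).toLp _) u := fun u => by
      rw [inner_H]
      refine integral_congr_ae ?_
      filter_upwards [s.ae_of_ae_μ (memLp_μ hv).coeFn_toLp] with x hx
      rw [hx, ← rdot_eq_inner, ← rdotL_apply, ← rdotL_apply, ← Complex.coe_smul, map_smul,
        Complex.coe_smul]
    simp only [e1, e2]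
    have hc : Continuous fun z : WithLp 2 (s.H × s.K) => WithLp.ofLp z :=
      WithLp.prod_continuous_ofLp 2 s.H s.K
    exact isClosed_eq (continuous_const.inner hc.snd)
      (continuous_const.inner hc.fst).neg
  exact hcl.completeSpace_coe

end BarotropicStar

/-! ### The weak divergence on the whole space and the Newton potential -/

namespace BarotropicStar

variable {s : BarotropicStar}

theorem rdot_gradient_mul {f g : E3 → ℝ} {x : E3} (hf : DifferentiableAt ℝ f x)
    (hg : DifferentiableAt ℝ g x) (v : V3) : rdot (gradient (fun y => f y • g y) x) v =
      (f x : ℂ) * rdot (gradient g x) v + g x * rdot (gradient f x) v := by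
  simp only [rdot, gradient_apply, Finset.mul_sum, ← Finset.sum_add_distrib]
  refine Finset.sum_congr rfl fun i _ => ?_
  rw [pd_smul hf hg]
  simp
  ring

theorem aestronglyMeasurable_rdot {m : Measure E3} {a : E3 → E3} {v : E3 → V3}
    (ha : AEStronglyMeasurable a m) (hv : AEStronglyMeasurable v m) :
    AEStronglyMeasurable (fun x => rdot (a x) (v x)) m := by
  refine Finset.aestronglyMeasurable_fun_sum _ fun i _ => ?_
  exact (Complex.continuous_ofReal.comp_aestronglyMeasurable
    ((EuclideanSpace.proj (𝕜 := ℝ) i).continuous.comp_aestronglyMeasurable ha)).mul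
      ((EuclideanSpace.proj (𝕜 := ℂ) i).continuous.comp_aestronglyMeasurable hv)

theorem continuous_gradient {φ : E3 → ℝ} (hφ : ContDiff ℝ ∞ φ) : Continuous (gradient φ) :=
  (InnerProductSpace.toDual ℝ E3).symm.continuous.comp (hφ.continuous_fderiv (by simp))

theorem tendsto_cutoff {x : E3} (hx : x ∈ s.R) :
    Tendsto (fun k : ℕ => s.cutoff (1 / ((k : ℝ) + 1)) x) atTop (𝓝 1) := by
  refine tendsto_const_nhds.congr' ?_
  have h1 := (tendsto_one_div_add_atTop_nhds_zero_nat (𝕜 := ℝ)).eventually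
    (gt_mem_nhds (half_pos (w_pos hx)))
  filter_upwards [h1] with k hk
  refine (Real.smoothTransition.one_of_one_le ?_).symm
  have : (0 : ℝ) < 1 / ((k : ℝ) + 1) := by positivity
  rw [le_sub_iff_add_le, le_div_iff₀ this]
  linarith

/-- The cutoff error `∫ φ ∇χ · ρu` tends to zero, by the Cauchy-Schwarz inequality. -/
theorem tendsto_integral_cutoff_gradient (u : s.H) {φ : E3 → ℝ} (hφ : Continuous φ) :
    Tendsto (fun k : ℕ => ∫ x in s.R, (φ x : ℂ) *
      rdot (gradient (s.cutoff (1 / ((k : ℝ) + 1))) x) (s.ρ x • u x)) atTop (𝓝 0) := by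
  obtain ⟨M, hM⟩ := s.isCompact_closure_R.exists_bound_of_continuousOn hφ.continuousOn
  have hE := s.tendsto_cutoff_energy
  have hlim : Tendsto (fun k : ℕ => M * ((∫ x in s.R, s.ρ x *
      ‖fderiv ℝ (s.cutoff (1 / ((k : ℝ) + 1))) x‖ ^ 2) ^ (1 / 2 : ℝ) *
      (∫ x in s.R, ‖sqrtH u x‖ ^ (2 : ℝ)) ^ (1 / 2 : ℝ))) atTop (𝓝 0) := by
    have := ((hE.rpow_const (p := 1 / 2) (Or.inr (by norm_num))).mul_const
      ((∫ x in s.R, ‖sqrtH u x‖ ^ (2 : ℝ)) ^ (1 / 2 : ℝ))).const_mul M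
    simpa using this
  refine squeeze_zero_norm (fun k => ?_) hlim
  have hε : (0 : ℝ) < 1 / ((k : ℝ) + 1) := by positivity
  generalize 1 / ((k : ℝ) + 1) = ε at hε ⊢
  have hχ := s.isTest_cutoff hε
  have hfc : Continuous (fderiv ℝ (s.cutoff ε)) := hχ.1.continuous_fderiv (by simp)
  have hf : MemLp (fun x => √(s.ρ x) * ‖fderiv ℝ (s.cutoff ε) x‖) 2 (volume.restrict s.R) := by
    have hc : Continuous fun x => √(s.ρ x) * ‖fderiv ℝ (s.cutoff ε) x‖ :=
      (s.ρ_contDiff.continuous.sqrt).mul hfc.norm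
    exact (hc.memLp_of_hasCompactSupport (hχ.2.1.fderiv ℝ).norm.mul_left).restrict _
  have hg : MemLp (fun x => ‖sqrtH u x‖) 2 (volume.restrict s.R) := (memLp_sqrtH u).norm
  have hcs := integral_mul_le_Lp_mul_Lq_of_nonneg (μ := volume.restrict s.R) (p := 2) (q := 2)
    (Real.HolderConjugate.two_two)
    (ae_of_all _ fun x => (by positivity : (0 : ℝ) ≤ √(s.ρ x) * ‖fderiv ℝ (s.cutoff ε) x‖))
    (ae_of_all _ fun x => norm_nonneg (sqrtH u x)) (by simpa using hf) (by simpa using hg)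
  have e : ∀ x, (√(s.ρ x) * ‖fderiv ℝ (s.cutoff ε) x‖) ^ (2 : ℝ) =
      s.ρ x * ‖fderiv ℝ (s.cutoff ε) x‖ ^ 2 := fun x => by
    rw [Real.rpow_two, mul_pow, Real.sq_sqrt (s.ρ_nonneg x)]
  simp only [e] at hcs
  obtain ⟨y, hy⟩ := s.R_nonempty
  have hM0 : 0 ≤ M := (norm_nonneg _).trans (hM y (subset_closure hy))
  refine le_trans ?_ (mul_le_mul_of_nonneg_left hcs hM0)
  rw [← integral_const_mul]
  refine norm_integral_le_of_norm_le ((hf.integrable_mul hg).const_mul M) ?_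
  filter_upwards [ae_restrict_mem s.measurableSet_R] with x hx
  rw [norm_mul, Complex.norm_real]
  refine mul_le_mul (hM x (subset_closure hx)) ?_ (norm_nonneg _) hM0
  refine (norm_rdot_le _ _).trans (le_of_eq ?_)
  rw [ρ_smul_eq, norm_smul, norm_gradient, Real.norm_of_nonneg (Real.sqrt_nonneg _)]
  ring

/-- The divergence theorem for `ρu`, `u ∈ 𝔊`, tested with functions that need not vanish on the
boundary: the density degenerates there, so there is no boundary term. -/
theorem integral_smul_dvg (z : s.𝔊) {φ : E3 → ℝ} (hφ : ContDiff ℝ ∞ φ) :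
    ∫ x in s.R, φ x • dvg z x = -∫ x in s.R, rdot (gradient φ x) (s.ρ x • fld z x) := by
  have hz : s.IsWeakDivRho (fld z) (dvg z) := z.2
  have hg : Integrable (dvg z) (volume.restrict s.R) := (memLp_K (dvg z)).integrable one_le_two
  have hu : Integrable (fun x => s.ρ x • fld z x) (volume.restrict s.R) :=
    (memLp_ρ_smul (fld z)).integrable one_le_two
  obtain ⟨M, hM⟩ := s.isCompact_closure_R.exists_bound_of_continuousOn hφ.continuous.continuousOn
  obtain ⟨M', hM'⟩ := s.isCompact_closure_R.exists_bound_of_continuousOn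
    (continuous_gradient hφ).continuousOn
  have i1 : Integrable (fun x => φ x • dvg z x) (volume.restrict s.R) :=
    hg.bdd_smul M hφ.continuous.aestronglyMeasurable
      ((ae_restrict_mem s.measurableSet_R).mono fun x hx => hM x (subset_closure hx))
  have i2 : Integrable (fun x => rdot (gradient φ x) (s.ρ x • fld z x)) (volume.restrict s.R) := by
    refine (hu.norm.const_mul M').mono' (aestronglyMeasurable_rdot
      (continuous_gradient hφ).aestronglyMeasurable hu.1)
      ((ae_restrict_mem s.measurableSet_R).mono fun x hx => ?_)
    exact (norm_rdot_le _ _).trans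
      (mul_le_mul_of_nonneg_right (hM' x (subset_closure hx)) (norm_nonneg _))
  set χ : ℕ → E3 → ℝ := fun k => s.cutoff (1 / ((k : ℝ) + 1))
  have hχ : ∀ k, IsTest s.R (χ k) := fun k => s.isTest_cutoff (by positivity)
  have hχ1 : ∀ k x, ‖χ k x‖ ≤ 1 := fun k x => by
    rw [Real.norm_of_nonneg (s.cutoff_nonneg _ x)]
    exact s.cutoff_le_one _ x
  have l1 : Tendsto (fun k => ∫ x in s.R, χ k x • φ x • dvg z x) atTop
      (𝓝 (∫ x in s.R, φ x • dvg z x)) := by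
    refine tendsto_integral_of_dominated_convergence (fun x => ‖φ x • dvg z x‖)
      (fun k => (hχ k).1.continuous.aestronglyMeasurable.smul i1.1) i1.norm
      (fun k => ae_of_all _ fun x => ?_) ?_
    · rw [norm_smul]
      exact mul_le_of_le_one_left (norm_nonneg _) (hχ1 k x)
    · filter_upwards [ae_restrict_mem s.measurableSet_R] with x hx
      have := (tendsto_cutoff hx).smul_const (φ x • dvg z x)
      rwa [one_smul] at this
  have l2 : Tendsto (fun k => ∫ x in s.R, χ k x • rdot (gradient φ x) (s.ρ x • fld z x)) atTop
      (𝓝 (∫ x in s.R, rdot (gradient φ x) (s.ρ x • fld z x))) := by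
    refine tendsto_integral_of_dominated_convergence
      (fun x => ‖rdot (gradient φ x) (s.ρ x • fld z x)‖)
      (fun k => (hχ k).1.continuous.aestronglyMeasurable.smul i2.1) i2.norm
      (fun k => ae_of_all _ fun x => ?_) ?_
    · rw [norm_smul]
      exact mul_le_of_le_one_left (norm_nonneg _) (hχ1 k x)
    · filter_upwards [ae_restrict_mem s.measurableSet_R] with x hx
      have := (tendsto_cutoff hx).smul_const (rdot (gradient φ x) (s.ρ x • fld z x))
      rwa [one_smul] at this
  have l3 := tendsto_integral_cutoff_gradient (fld z) hφ.continuous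
  have key : ∀ k, ∫ x in s.R, χ k x • φ x • dvg z x =
      -((∫ x in s.R, χ k x • rdot (gradient φ x) (s.ρ x • fld z x)) +
        ∫ x in s.R, (φ x : ℂ) * rdot (gradient (χ k) x) (s.ρ x • fld z x)) := fun k => by
    have ht : IsTest s.R fun x => χ k x • φ x :=
      s.isTest_cutoff_smul (by positivity) hφ.contDiffOn
    have := hz.2.2 _ ht
    simp only [rdot_gradient_mul ((hχ k).1.differentiable (by simp) _)
      (hφ.differentiable (by simp) _)] at this
    simp only [smul_smul]
    simp only [smul_eq_mul] at this
    rw [this, integral_add]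
    · simp only [Complex.real_smul]
    · have : Integrable (fun x => (χ k x : ℝ) • rdot (gradient φ x) (s.ρ x • fld z x))
          (volume.restrict s.R) :=
        i2.bdd_smul 1 (hχ k).1.continuous.aestronglyMeasurable (ae_of_all _ (hχ1 k))
      simpa only [Complex.real_smul] using this
    · have h1 := s.integrableOn_rdot (locallyIntegrableOn_ρ_smul (fld z)) (hχ k)
      have : Integrable (fun x => (φ x : ℝ) • rdot (gradient (χ k) x) (s.ρ x • fld z x))
          (volume.restrict s.R) := Integrable.bdd_smul h1 M hφ.continuous.aestronglyMeasurable
          ((ae_restrict_mem s.measurableSet_R).mono fun x hx => hM x (subset_closure hx))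
      simpa only [Complex.real_smul] using this
  have l4 := (l2.add l3).neg
  rw [add_zero] at l4
  exact tendsto_nhds_unique l1 (l4.congr fun k => (key k).symm)

end BarotropicStar

namespace Star

theorem integrable_indicator_inv_norm_sq (D : ℝ) :
    Integrable ((Metric.ball (0 : E3) D).indicator fun z => ‖z‖⁻¹ ^ 2) := by
  rw [integrable_indicator_iff Metric.isOpen_ball.measurableSet,
    integrableOn_fun_norm_addHaar volume (f := fun r => r⁻¹ ^ 2)]
  refine (integrableOn_const (C := (1 : ℝ)) (by simp) (by simp)).congr_fun (fun y hy => ?_)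
    measurableSet_Ioo
  have : y ≠ 0 := hy.1.ne'
  simp
  field_simp

/-- The Newton kernel is square integrable on bounded sets, uniformly in the pole. -/
theorem exists_integral_inv_norm_sq_le {D : Set E3} (hD : Bornology.IsBounded D)
    (hDm : MeasurableSet D) : ∃ C, 0 ≤ C ∧ ∀ x ∈ D,
      MemLp (fun y => ‖x - y‖⁻¹) 2 (volume.restrict D) ∧ ∫ y in D, ‖x - y‖⁻¹ ^ 2 ≤ C := by
  obtain ⟨d, hd⟩ := hD.subset_ball (0 : E3)
  set f : E3 → ℝ := (Metric.ball (0 : E3) (2 * d)).indicator fun z => ‖z‖⁻¹ ^ 2 with hf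
  have hfi : Integrable f := integrable_indicator_inv_norm_sq (2 * d)
  have hf0 : ∀ z, 0 ≤ f z := fun z => Set.indicator_nonneg (fun z _ => by positivity) z
  refine ⟨∫ z, f z, integral_nonneg hf0, fun x hx => ?_⟩
  have hfe : ∀ y ∈ D, f (x - y) = ‖x - y‖⁻¹ ^ 2 := fun y hy => by
    refine Set.indicator_of_mem ?_ _
    have h1 := mem_ball_zero_iff.1 (hd hx)
    have h2 := mem_ball_zero_iff.1 (hd hy)
    rw [mem_ball_zero_iff]
    linarith [norm_sub_le x y]
  have hi : Integrable (fun y => f (x - y)) := hfi.comp_sub_left x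
  constructor
  · have hm : Measurable fun y => ‖x - y‖⁻¹ := by fun_prop
    rw [memLp_two_iff_integrable_sq hm.aestronglyMeasurable]
    exact hi.integrableOn.congr_fun hfe hDm
  · rw [← setIntegral_congr_fun hDm hfe, ← integral_sub_left_eq_self f volume x]
    exact setIntegral_le_integral hi (ae_of_all _ fun y => hf0 _)

variable {D : Set E3}

theorem integrableOn_newton (hD : Bornology.IsBounded D) (hDm : MeasurableSet D) {g : E3 → ℂ}
    (hg : MemLp g 2 (volume.restrict D)) {x : E3} (hx : x ∈ D) :
    IntegrableOn (fun y => (‖x - y‖)⁻¹ • g y) D := by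
  obtain ⟨C, -, hC⟩ := exists_integral_inv_norm_sq_le hD hDm
  exact memLp_one_iff_integrable.1 (hg.smul (hC x hx).1)

theorem exists_integral_norm_newton_le (hD : Bornology.IsBounded D) (hDm : MeasurableSet D)
    {g : E3 → ℂ} (hg : MemLp g 2 (volume.restrict D)) :
    ∃ C, 0 ≤ C ∧ ∀ x ∈ D, ∫ y in D, ‖(‖x - y‖)⁻¹ • g y‖ ≤ C := by
  obtain ⟨C, hC0, hC⟩ := exists_integral_inv_norm_sq_le hD hDm
  have hg2 := hg.integrable_norm_pow two_ne_zero
  refine ⟨C + ∫ y in D, ‖g y‖ ^ 2, add_nonneg hC0 (integral_nonneg fun _ => by positivity),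
    fun x hx => ?_⟩
  have hk := (hC x hx).1.integrable_sq
  calc ∫ y in D, ‖(‖x - y‖)⁻¹ • g y‖
      ≤ ∫ y in D, (‖x - y‖⁻¹ ^ 2 + ‖g y‖ ^ 2) := by
        refine integral_mono (integrableOn_newton hD hDm hg hx).norm (hk.add hg2) fun y => ?_
        simp only [norm_smul, norm_inv, norm_norm]
        nlinarith [sq_nonneg (‖x - y‖⁻¹ - ‖g y‖), sq_nonneg (‖x - y‖⁻¹), sq_nonneg ‖g y‖]
    _ = (∫ y in D, ‖x - y‖⁻¹ ^ 2) + ∫ y in D, ‖g y‖ ^ 2 := integral_add hk hg2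
    _ ≤ _ := by
      gcongr
      exact (hC x hx).2

/-- The integrand of the Coulomb energy of two `L²` densities is integrable. -/
theorem integrable_newton_prod (hD : Bornology.IsBounded D) (hDm : MeasurableSet D) {g h : E3 → ℂ}
    (hg : MemLp g 2 (volume.restrict D)) (hh : MemLp h 2 (volume.restrict D)) :
    Integrable (fun p : E3 × E3 => conj (h p.1) * (g p.2 * (‖p.1 - p.2‖⁻¹ : ℝ)))
      ((volume.restrict D).prod (volume.restrict D)) := by
  have : IsFiniteMeasure (volume.restrict D) := ⟨by simpa using hD.measure_lt_top⟩
  have hk : Measurable fun p : E3 × E3 => ((‖p.1 - p.2‖⁻¹ : ℝ) : ℂ) := by fun_prop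
  have hm : AEStronglyMeasurable (fun p : E3 × E3 => conj (h p.1) * (g p.2 * (‖p.1 - p.2‖⁻¹ : ℝ)))
      ((volume.restrict D).prod (volume.restrict D)) :=
    (Complex.continuous_conj.comp_aestronglyMeasurable hh.1.comp_fst).mul
      (hg.1.comp_snd.mul hk.aestronglyMeasurable)
  obtain ⟨C, hC0, hC⟩ := exists_integral_norm_newton_le hD hDm hg
  have e : ∀ x y, g y * ((‖x - y‖⁻¹ : ℝ) : ℂ) = (‖x - y‖)⁻¹ • g y := fun x y => by
    rw [mul_comm, Complex.real_smul]
  rw [integrable_prod_iff hm]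
  constructor
  · filter_upwards [ae_restrict_mem hDm] with x hx
    simp only [e]
    exact (integrableOn_newton hD hDm hg hx).const_mul _
  · refine ((hh.integrable one_le_two).norm.mul_const C).mono' hm.norm.integral_prod_right' ?_
    filter_upwards [ae_restrict_mem hDm] with x hx
    simp only [e, norm_mul, integral_const_mul, RCLike.norm_conj, norm_norm]
    rw [Real.norm_of_nonneg (integral_nonneg fun _ => norm_nonneg _)]
    gcongr
    exact hC x hx

theorem newtonK_eq (D : Set E3) (g : E3 → ℂ) (x : E3) : newtonK D g x =
    ((4 * Real.pi)⁻¹ : ℝ) * ∫ y in D, g y * (‖x - y‖⁻¹ : ℝ) := by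
  rw [newtonK, Complex.real_smul]
  simp only [Complex.real_smul, mul_comm (g _)]

theorem integrableOn_newtonK_mul (hD : Bornology.IsBounded D) (hDm : MeasurableSet D) {g h : E3 → ℂ}
    (hg : MemLp g 2 (volume.restrict D)) (hh : MemLp h 2 (volume.restrict D)) :
    IntegrableOn (fun x => newtonK D g x * star (h x)) D := by
  have : IsFiniteMeasure (volume.restrict D) := ⟨by simpa using hD.measure_lt_top⟩
  have h1 := ((integrable_newton_prod hD hDm hg hh).integral_prod_left).const_mul
    (((4 * Real.pi)⁻¹ : ℝ) : ℂ)
  refine h1.congr (ae_of_all _ fun x => ?_)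
  simp only [integral_const_mul]
  rw [newtonK_eq]
  change _ = _ * conj (h x)
  ring

theorem integral_newtonK_mul (hD : Bornology.IsBounded D) (hDm : MeasurableSet D) {g h : E3 → ℂ}
    (hg : MemLp g 2 (volume.restrict D)) (hh : MemLp h 2 (volume.restrict D)) :
    ∫ x in D, newtonK D g x * star (h x) = ((4 * Real.pi)⁻¹ : ℝ) *
      ∫ p, conj (h p.1) * (g p.2 * (‖p.1 - p.2‖⁻¹ : ℝ))
        ∂((volume.restrict D).prod (volume.restrict D)) := by
  have : IsFiniteMeasure (volume.restrict D) := ⟨by simpa using hD.measure_lt_top⟩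
  rw [integral_prod _ (integrable_newton_prod hD hDm hg hh), ← integral_const_mul]
  refine integral_congr_ae (ae_of_all _ fun x => ?_)
  simp only [integral_const_mul]
  rw [newtonK_eq]
  change _ * conj (h x) = _
  ring

theorem star_integral_newtonK_mul (hD : Bornology.IsBounded D) (hDm : MeasurableSet D)
    {g h : E3 → ℂ} (hg : MemLp g 2 (volume.restrict D)) (hh : MemLp h 2 (volume.restrict D)) :
    conj (∫ x in D, newtonK D g x * star (h x)) = ∫ x in D, newtonK D h x * star (g x) := by
  have : IsFiniteMeasure (volume.restrict D) := ⟨by simpa using hD.measure_lt_top⟩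
  rw [integral_newtonK_mul hD hDm hg hh, integral_newtonK_mul hD hDm hh hg, map_mul,
    Complex.conj_ofReal, ← integral_conj, ← integral_prod_swap]
  congr 1
  refine integral_congr_ae (ae_of_all _ fun p => ?_)
  simp [norm_sub_rev p.2 p.1]
  ring

end Star

namespace BarotropicStar

variable {s : BarotropicStar}

/-- The gravitational energy of a perturbation is nonnegative and controlled by `‖u‖²`. -/
theorem exists_integral_newtonK_dvg_eq (z : s.𝔊) : ∃ r : ℝ, 0 ≤ r ∧ r ≤ s.ρO * ‖fld z‖ ^ 2 ∧
    ∫ x in s.R, newtonK s.R (fun y => dvg z y) x * star (dvg z x) = r := by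
  have hg := memLp_K (dvg z)
  have hF := memLp_ρ_smul (fld z)
  have hR := s.measurableSet_R
  set h : E3 → ℂ := s.R.indicator (dvg z)
  set F : E3 → V3 := s.R.indicator fun x => s.ρ x • fld z x
  have h1 : Integrable h := (integrable_indicator_iff hR).2 (hg.integrable one_le_two)
  have h2 : Integrable F := (integrable_indicator_iff hR).2 (hF.integrable one_le_two)
  have h3 : MemLp F 2 := (memLp_indicator_iff_restrict hR).2 hF
  have hprod := integrable_newton_prod s.isBounded_R hR hg hg
  have ei : (fun p : E3 × E3 => conj (h p.1) * (h p.2 * (‖p.1 - p.2‖⁻¹ : ℝ))) =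
      (s.R ×ˢ s.R).indicator
        fun p => conj (dvg z p.1) * (dvg z p.2 * (‖p.1 - p.2‖⁻¹ : ℝ)) := by
    funext p
    by_cases p1 : p.1 ∈ s.R <;> by_cases p2 : p.2 ∈ s.R <;> simp [h, p1, p2, Set.mem_prod]
  have h4 : Integrable fun p : E3 × E3 => conj (h p.1) * (h p.2 * (‖p.1 - p.2‖⁻¹ : ℝ)) := by
    rw [ei, integrable_indicator_iff (hR.prod hR), IntegrableOn, Measure.volume_eq_prod,
      ← Measure.prod_restrict]
    exact hprod
  have h5 : ∀ φ : E3 → ℝ, ContDiff ℝ ∞ φ →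
      ∫ x, φ x • h x = -∫ x, rdot (gradient φ x) (F x) := fun φ hφ => by
    have := integral_smul_dvg z hφ
    rw [← integral_indicator hR, ← integral_indicator hR] at this
    refine Eq.trans (integral_congr_ae (ae_of_all _ fun x => ?_))
      (this.trans (congrArg Neg.neg (integral_congr_ae (ae_of_all _ fun x => ?_))))
    · by_cases hx : x ∈ s.R <;> simp [h, hx]
    · by_cases hx : x ∈ s.R <;> simp [F, hx, rdot]
  obtain ⟨r, hr0, hr, he⟩ := newton_form_bounds h1 h2 h3 h4 h5
  have hpi := Real.pi_pos
  have hFn : ∫ x, ‖F x‖ ^ 2 ≤ s.ρO * ‖fld z‖ ^ 2 := by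
    refine le_trans (le_of_eq ?_) (integral_norm_sq_ρ_smul_le (fld z))
    rw [← integral_indicator hR]
    refine integral_congr_ae (ae_of_all _ fun x => ?_)
    by_cases hx : x ∈ s.R <;> simp [F, hx]
  refine ⟨(4 * Real.pi)⁻¹ * r, by positivity, ?_, ?_⟩
  · rw [inv_mul_le_iff₀ (by positivity)]
    exact hr.trans (by gcongr)
  · have e2 : ∫ x, conj (h x) * ∫ y, h y * (‖x - y‖⁻¹ : ℝ) =
        ∫ p : E3 × E3, conj (h p.1) * (h p.2 * (‖p.1 - p.2‖⁻¹ : ℝ)) := by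
      rw [Measure.volume_eq_prod] at h4 ⊢
      rw [integral_prod _ h4]
      simp only [integral_const_mul]
    rw [integral_newtonK_mul s.isBounded_R hR hg hg, Complex.ofReal_mul, ← he, e2, ei,
      integral_indicator (hR.prod hR), Measure.volume_eq_prod, ← Measure.prod_restrict]

end BarotropicStar

/-! ### The quadratic forms -/

namespace BarotropicStar

variable {s : BarotropicStar}

theorem ae_fld_add (z z' : s.𝔊) :
    ∀ᵐ x ∂volume.restrict s.R, fld (z + z') x = fld z x + fld z' x :=
  s.ae_of_ae_μ (Lp.coeFn_add (fld z) (fld z'))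

theorem ae_dvg_add (z z' : s.𝔊) :
    ∀ᵐ x ∂volume.restrict s.R, dvg (z + z') x = dvg z x + dvg z' x :=
  s.ae_of_ae_ν (Lp.coeFn_add (dvg z) (dvg z'))

theorem ae_fld_smul (c : ℂ) (z : s.𝔊) :
    ∀ᵐ x ∂volume.restrict s.R, fld (c • z) x = c • fld z x :=
  s.ae_of_ae_μ (Lp.coeFn_smul c (fld z))

theorem ae_dvg_smul (c : ℂ) (z : s.𝔊) :
    ∀ᵐ x ∂volume.restrict s.R, dvg (c • z) x = c • dvg z x :=
  s.ae_of_ae_ν (Lp.coeFn_smul c (dvg z))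

theorem rdot_add (a : E3) (u v : V3) : rdot a (u + v) = rdot a u + rdot a v := by
  simp only [← rdotL_apply, map_add]

theorem rdot_const_smul (a : E3) (c : ℂ) (u : V3) : rdot a (c • u) = c * rdot a u := by
  simp only [← rdotL_apply, map_smul, smul_eq_mul]

theorem rdot_real_smul (a : E3) (c : ℝ) (u : V3) : rdot a (c • u) = c * rdot a u := by
  rw [← Complex.coe_smul, rdot_const_smul]

theorem norm_rdot_n_le (x : E3) (v : V3) : ‖rdot (s.n x) v‖ ≤ ‖v‖ :=
  (norm_rdot_le _ _).trans (mul_le_of_le_one_left (norm_nonneg _) (s.norm_n_le x))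

theorem aestronglyMeasurable_rdot_n (u : s.H) :
    AEStronglyMeasurable (fun x => rdot (s.n x) (u x)) (volume.restrict s.R) :=
  aestronglyMeasurable_rdot s.measurable_n.aestronglyMeasurable
    (Lp.stronglyMeasurable u).aestronglyMeasurable

/-- `κ₁` controls the cross terms of `Q₀`: `γP/ρ = √(γP/ρ) √ρ √(γP/ρ²)`. -/
theorem norm_cross_le (u : s.H) (g : s.K) {x : E3} (hx : x ∈ s.R) :
    ‖((s.γ * s.P x * s.𝒜 x / s.ρ x : ℝ) : ℂ) * (rdot (s.n x) (u x) * star (g x))‖ ≤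
      s.κ₁ * (‖sqrtH u x‖ * ‖sqrtK g x‖) := by
  have hρ := ρ_pos hx
  have hP := P_pos hx
  have hγ := s.γ_pos
  have e : |s.γ * s.P x * s.𝒜 x / s.ρ x| =
      |s.𝒜 x| * √(s.γ * s.P x / s.ρ x) * (√(s.ρ x) * √(s.W x)) := by
    have h1 : √(s.γ * s.P x / s.ρ x) * (√(s.ρ x) * √(s.W x)) = s.γ * s.P x / s.ρ x := by
      rw [← Real.sqrt_mul hρ.le, ← Real.sqrt_mul (by positivity)]
      have : s.γ * s.P x / s.ρ x * (s.ρ x * s.W x) = (s.γ * s.P x / s.ρ x) ^ 2 := by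
        rw [W]; field_simp
      rw [this, Real.sqrt_sq (by positivity)]
    rw [mul_assoc |s.𝒜 x|, h1, mul_div_right_comm, abs_mul, abs_of_pos (by positivity), mul_comm]
  rw [norm_mul, Complex.norm_real, Real.norm_eq_abs, e, norm_mul, norm_star, sqrtH, sqrtK,
    norm_smul, norm_smul, Real.norm_of_nonneg (Real.sqrt_nonneg _),
    Real.norm_of_nonneg (Real.sqrt_nonneg _)]
  calc |s.𝒜 x| * √(s.γ * s.P x / s.ρ x) * (√(s.ρ x) * √(s.W x)) *
        (‖rdot (s.n x) (u x)‖ * ‖g x‖)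
      ≤ s.κ₁ * (√(s.ρ x) * √(s.W x)) * (‖u x‖ * ‖g x‖) := by
        gcongr
        · have := s.κ₁_nonneg
          positivity
        · exact s.le_κ₁ hx
        · exact norm_rdot_n_le x _
    _ = _ := by ring

/-- `κ₂` controls the term of `Q₀` that is quadratic in the normal component. -/
theorem norm_normal_le (u v : s.H) {x : E3} (hx : x ∈ s.R) :
    ‖((s.γ * s.P x * s.𝒜 x / s.ρ x * ‖gradient s.ρ x‖ : ℝ) : ℂ) *
      (rdot (s.n x) (u x) * star (rdot (s.n x) (v x)))‖ ≤
      s.κ₂ * (‖sqrtH u x‖ * ‖sqrtH v x‖) := by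
  have hρ := ρ_pos hx
  have hP := P_pos hx
  have hγ := s.γ_pos
  have e : |s.γ * s.P x * s.𝒜 x / s.ρ x * ‖gradient s.ρ x‖| =
      (s.γ * s.P x * |s.𝒜 x| / s.ρ x ^ 2 * ‖gradient s.ρ x‖) * (√(s.ρ x) * √(s.ρ x)) := by
    rw [Real.mul_self_sqrt hρ.le, abs_mul, abs_div, abs_mul, abs_mul, abs_of_pos hγ, abs_of_pos hP,
      abs_of_pos hρ, abs_norm]
    field_simp
  rw [norm_mul, Complex.norm_real, Real.norm_eq_abs, e, norm_mul, norm_star, sqrtH, sqrtH,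
    norm_smul, norm_smul, Real.norm_of_nonneg (Real.sqrt_nonneg _)]
  calc _ ≤ s.κ₂ * (√(s.ρ x) * √(s.ρ x)) * (‖u x‖ * ‖v x‖) := by
        gcongr
        · have := s.κ₂_nonneg
          positivity
        · exact s.le_κ₂ hx
        · exact norm_rdot_n_le x _
        · exact norm_rdot_n_le x _
    _ = _ := by ring

theorem measurable_cross : Measurable fun x => ((s.γ * s.P x * s.𝒜 x / s.ρ x : ℝ) : ℂ) :=
  Complex.measurable_ofReal.comp
    (((s.measurable_P.const_mul _).mul s.measurable_𝒜).div s.measurable_ρ)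

theorem integrable_cross (u : s.H) (g : s.K) :
    Integrable (fun x => ((s.γ * s.P x * s.𝒜 x / s.ρ x : ℝ) : ℂ) *
      (rdot (s.n x) (u x) * star (g x))) (volume.restrict s.R) := by
  refine (((memLp_sqrtH u).norm.integrable_mul (memLp_sqrtK g).norm).const_mul s.κ₁).mono' ?_ ?_
  · exact measurable_cross.aestronglyMeasurable.mul ((aestronglyMeasurable_rdot_n u).mul
      (continuous_star.comp_aestronglyMeasurable (Lp.stronglyMeasurable g).aestronglyMeasurable))
  · filter_upwards [ae_restrict_mem s.measurableSet_R] with x hx using norm_cross_le u g hx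

theorem integrable_cross' (u : s.H) (g : s.K) :
    Integrable (fun x => ((s.γ * s.P x * s.𝒜 x / s.ρ x : ℝ) : ℂ) *
      (g x * star (rdot (s.n x) (u x)))) (volume.restrict s.R) := by
  have := Complex.conjCLE.toContinuousLinearMap.integrable_comp (integrable_cross u g)
  refine this.congr (ae_of_all _ fun x => ?_)
  change conj (_ * (_ * conj _)) = _
  simp only [← starRingEnd_apply, map_mul, Complex.conj_ofReal, Complex.conj_conj]
  ring

theorem integrable_normal (u v : s.H) :
    Integrable (fun x => ((s.γ * s.P x * s.𝒜 x / s.ρ x * ‖gradient s.ρ x‖ : ℝ) : ℂ) *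
      (rdot (s.n x) (u x) * star (rdot (s.n x) (v x)))) (volume.restrict s.R) := by
  refine (((memLp_sqrtH u).norm.integrable_mul (memLp_sqrtH v).norm).const_mul s.κ₂).mono' ?_ ?_
  · have : Measurable fun x => ((s.γ * s.P x * s.𝒜 x / s.ρ x * ‖gradient s.ρ x‖ : ℝ) : ℂ) :=
      Complex.measurable_ofReal.comp
        ((((s.measurable_P.const_mul _).mul s.measurable_𝒜).div s.measurable_ρ).mul
          s.continuous_gradient_ρ.measurable.norm)
    exact this.aestronglyMeasurable.mul ((aestronglyMeasurable_rdot_n u).mul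
      (continuous_star.comp_aestronglyMeasurable (aestronglyMeasurable_rdot_n v)))
  · filter_upwards [ae_restrict_mem s.measurableSet_R] with x hx using norm_normal_le u v hx

theorem integral_W_mul (g h : s.K) :
    ∫ x in s.R, ((s.γ * s.P x / s.ρ x ^ 2 : ℝ) : ℂ) * (g x * star (h x)) = inner ℂ h g := by
  rw [inner_K]
  rfl

theorem integrable_newtonK_dvg (z z' : s.𝔊) :
    Integrable (fun x => newtonK s.R (fun y => dvg z y) x * star (dvg z' x))
      (volume.restrict s.R) :=
  integrableOn_newtonK_mul s.isBounded_R s.measurableSet_R (memLp_K _) (memLp_K _)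

theorem newtonK_congr {D : Set E3} {g g' : E3 → ℂ} (h : ∀ᵐ y ∂volume.restrict D, g y = g' y)
    (x : E3) : newtonK D g x = newtonK D g' x := by
  have : ∫ y in D, (‖x - y‖)⁻¹ • g y = ∫ y in D, (‖x - y‖)⁻¹ • g' y :=
    integral_congr_ae (h.mono fun y hy => by simp only [hy])
  rw [newtonK, newtonK, this]

theorem Q₀_add (z z' w : s.𝔊) : Q₀ (z + z') w = Q₀ z w + Q₀ z' w := by
  have hN : ∀ x ∈ s.R, newtonK s.R (fun y => dvg (z + z') y) x =
      newtonK s.R (fun y => dvg z y) x + newtonK s.R (fun y => dvg z' y) x := fun x hx => by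
    rw [newtonK_congr (ae_dvg_add z z'), newtonK, newtonK, newtonK, ← smul_add, ← integral_add
      (integrableOn_newton s.isBounded_R s.measurableSet_R (memLp_K (dvg z)) hx)
      (integrableOn_newton s.isBounded_R s.measurableSet_R (memLp_K (dvg z')) hx)]
    simp only [smul_add]
  have h1 : dvg (z + z') = dvg z + dvg z' := rfl
  have h2 := integral_add
    ((integrable_cross (fld z) (dvg w)).add (integrable_cross' (fld w) (dvg z)))
    ((integrable_cross (fld z') (dvg w)).add (integrable_cross' (fld w) (dvg z')))
  have h3 := integral_add (integrable_normal (fld z) (fld w)) (integrable_normal (fld z') (fld w))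
  have h4 := integral_add (integrable_newtonK_dvg z w) (integrable_newtonK_dvg z' w)
  have e2 : ∫ x in s.R, ((s.γ * s.P x * s.𝒜 x / s.ρ x : ℝ) : ℂ) *
      (rdot (s.n x) (fld (z + z') x) * star (dvg w x) +
        dvg (z + z') x * star (rdot (s.n x) (fld w x))) =
      (∫ x in s.R, ((s.γ * s.P x * s.𝒜 x / s.ρ x : ℝ) : ℂ) *
        (rdot (s.n x) (fld z x) * star (dvg w x) + dvg z x * star (rdot (s.n x) (fld w x)))) +
      ∫ x in s.R, ((s.γ * s.P x * s.𝒜 x / s.ρ x : ℝ) : ℂ) *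
        (rdot (s.n x) (fld z' x) * star (dvg w x) + dvg z' x * star (rdot (s.n x) (fld w x))) := by
    simp only [mul_add]
    refine Eq.trans (integral_congr_ae ?_) h2
    filter_upwards [ae_fld_add z z', ae_dvg_add z z'] with x hx hx'
    simp only [hx, hx', rdot_add, Pi.add_apply]
    ring
  have e3 : ∫ x in s.R, ((s.γ * s.P x * s.𝒜 x / s.ρ x * ‖gradient s.ρ x‖ : ℝ) : ℂ) *
      (rdot (s.n x) (fld (z + z') x) * star (rdot (s.n x) (fld w x))) =
      (∫ x in s.R, ((s.γ * s.P x * s.𝒜 x / s.ρ x * ‖gradient s.ρ x‖ : ℝ) : ℂ) *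
        (rdot (s.n x) (fld z x) * star (rdot (s.n x) (fld w x)))) +
      ∫ x in s.R, ((s.γ * s.P x * s.𝒜 x / s.ρ x * ‖gradient s.ρ x‖ : ℝ) : ℂ) *
        (rdot (s.n x) (fld z' x) * star (rdot (s.n x) (fld w x))) := by
    refine Eq.trans (integral_congr_ae ?_) h3
    filter_upwards [ae_fld_add z z'] with x hx
    simp only [hx, rdot_add]
    ring
  have e4 : ∫ x in s.R, newtonK s.R (fun y => dvg (z + z') y) x * star (dvg w x) =
      (∫ x in s.R, newtonK s.R (fun y => dvg z y) x * star (dvg w x)) +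
      ∫ x in s.R, newtonK s.R (fun y => dvg z' y) x * star (dvg w x) := by
    refine Eq.trans (integral_congr_ae ?_) h4
    filter_upwards [ae_restrict_mem s.measurableSet_R] with x hx
    simp only [hN x hx, add_mul]
  rw [Q₀, Q₀, Q₀, e2, e3, e4, integral_W_mul, integral_W_mul, integral_W_mul, h1, inner_add_right]
  ring

theorem Q₀_smul (c : ℂ) (z w : s.𝔊) : Q₀ (c • z) w = c * Q₀ z w := by
  have hN : ∀ x, newtonK s.R (fun y => dvg (c • z) y) x = c * newtonK s.R (fun y => dvg z y) x :=
    fun x => by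
      rw [newtonK_congr (ae_dvg_smul c z), newtonK, newtonK]
      simp only [smul_comm _ c, integral_smul]
      rw [smul_eq_mul]
  have h1 : dvg (c • z) = c • dvg z := rfl
  have e2 : ∫ x in s.R, ((s.γ * s.P x * s.𝒜 x / s.ρ x : ℝ) : ℂ) *
      (rdot (s.n x) (fld (c • z) x) * star (dvg w x) +
        dvg (c • z) x * star (rdot (s.n x) (fld w x))) =
      c * ∫ x in s.R, ((s.γ * s.P x * s.𝒜 x / s.ρ x : ℝ) : ℂ) *
        (rdot (s.n x) (fld z x) * star (dvg w x) + dvg z x * star (rdot (s.n x) (fld w x))) := by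
    rw [← integral_const_mul]
    refine integral_congr_ae ?_
    filter_upwards [ae_fld_smul c z, ae_dvg_smul c z] with x hx hx'
    simp only [hx, hx', rdot_const_smul, smul_eq_mul]
    ring
  have e3 : ∫ x in s.R, ((s.γ * s.P x * s.𝒜 x / s.ρ x * ‖gradient s.ρ x‖ : ℝ) : ℂ) *
      (rdot (s.n x) (fld (c • z) x) * star (rdot (s.n x) (fld w x))) =
      c * ∫ x in s.R, ((s.γ * s.P x * s.𝒜 x / s.ρ x * ‖gradient s.ρ x‖ : ℝ) : ℂ) *
        (rdot (s.n x) (fld z x) * star (rdot (s.n x) (fld w x))) := by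
    rw [← integral_const_mul]
    refine integral_congr_ae ?_
    filter_upwards [ae_fld_smul c z] with x hx
    simp only [hx, rdot_const_smul]
    ring
  have e4 : ∫ x in s.R, newtonK s.R (fun y => dvg (c • z) y) x * star (dvg w x) =
      c * ∫ x in s.R, newtonK s.R (fun y => dvg z y) x * star (dvg w x) := by
    rw [← integral_const_mul]
    simp only [hN, mul_assoc]
  rw [Q₀, Q₀, e2, e3, e4, integral_W_mul, integral_W_mul, h1, inner_smul_right]
  ring

theorem conj_integral_cross (z w : s.𝔊) :
    conj (∫ x in s.R, ((s.γ * s.P x * s.𝒜 x / s.ρ x : ℝ) : ℂ) *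
      (rdot (s.n x) (fld z x) * star (dvg w x) + dvg z x * star (rdot (s.n x) (fld w x)))) =
    ∫ x in s.R, ((s.γ * s.P x * s.𝒜 x / s.ρ x : ℝ) : ℂ) *
      (rdot (s.n x) (fld w x) * star (dvg z x) + dvg w x * star (rdot (s.n x) (fld z x))) := by
  rw [← integral_conj]
  refine integral_congr_ae (ae_of_all _ fun x => ?_)
  simp only [← starRingEnd_apply, map_mul, map_add, Complex.conj_ofReal, Complex.conj_conj]
  ring

theorem conj_integral_normal (z w : s.𝔊) :
    conj (∫ x in s.R, ((s.γ * s.P x * s.𝒜 x / s.ρ x * ‖gradient s.ρ x‖ : ℝ) : ℂ) *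
      (rdot (s.n x) (fld z x) * star (rdot (s.n x) (fld w x)))) =
    ∫ x in s.R, ((s.γ * s.P x * s.𝒜 x / s.ρ x * ‖gradient s.ρ x‖ : ℝ) : ℂ) *
      (rdot (s.n x) (fld w x) * star (rdot (s.n x) (fld z x))) := by
  rw [← integral_conj]
  refine integral_congr_ae (ae_of_all _ fun x => ?_)
  simp only [← starRingEnd_apply, map_mul, Complex.conj_ofReal, Complex.conj_conj]
  ring

theorem star_Q₀ (z w : s.𝔊) : star (Q₀ z w) = Q₀ w z := by
  change conj (Q₀ z w) = Q₀ w z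
  rw [Q₀, Q₀, map_sub, map_sub, map_add, map_mul, conj_integral_cross, conj_integral_normal,
    Complex.conj_ofReal, star_integral_newtonK_mul s.isBounded_R s.measurableSet_R (memLp_K _)
      (memLp_K _), integral_W_mul, integral_W_mul, inner_conj_symm]

/-- On the diagonal, the second, third and fourth terms of `Q₀` are real; they are bounded by means
of `κ₁`, `κ₂` and `ρ_O`. -/
theorem exists_Q₀_self_eq (z : s.𝔊) : ∃ t₂ t₃ t₄ : ℝ,
    Q₀ z z = ((‖dvg z‖ ^ 2 + t₂ - t₃ - t₄ : ℝ) : ℂ) ∧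
    |t₂| ≤ 1 / 2 * ‖dvg z‖ ^ 2 + 2 * s.κ₁ ^ 2 * ‖fld z‖ ^ 2 ∧
    |t₃| ≤ s.κ₂ * ‖fld z‖ ^ 2 ∧ 0 ≤ t₄ ∧ t₄ ≤ 4 * Real.pi * s.G * s.ρO * ‖fld z‖ ^ 2 := by
  obtain ⟨t₂, h2⟩ := Complex.conj_eq_iff_real.1 (conj_integral_cross z z)
  obtain ⟨t₃, h3⟩ := Complex.conj_eq_iff_real.1 (conj_integral_normal z z)
  obtain ⟨t₄, h40, h4le, h4⟩ := exists_integral_newtonK_dvg_eq z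
  have iH := (memLp_sqrtH (fld z)).integrable_norm_pow two_ne_zero
  have iK := (memLp_sqrtK (dvg z)).integrable_norm_pow two_ne_zero
  have hG := s.G_pos
  have hpi := Real.pi_pos
  refine ⟨t₂, t₃, 4 * Real.pi * s.G * t₄, ?_, ?_, ?_, by positivity, ?_⟩
  · rw [Q₀, h2, h3, h4, integral_W_mul, inner_self_eq_norm_sq_to_K]
    push_cast
    rfl
  · rw [← Real.norm_eq_abs, ← Complex.norm_real, ← h2, norm_sq_H, norm_sq_K,
      ← integral_const_mul, ← integral_const_mul, ← integral_add (iK.const_mul _) (iH.const_mul _)]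
    refine norm_integral_le_of_norm_le ((iK.const_mul _).add (iH.const_mul _)) ?_
    filter_upwards [ae_restrict_mem s.measurableSet_R] with x hx
    have h1 := norm_cross_le (fld z) (dvg z) hx
    -- `2 κ₁ |u| |g| ≤ 2 κ₁² |u|² + |g|² / 2`
    rw [mul_add]
    refine (norm_add_le _ _).trans ?_
    have e : ‖((s.γ * s.P x * s.𝒜 x / s.ρ x : ℝ) : ℂ) *
        (dvg z x * star (rdot (s.n x) (fld z x)))‖ =
        ‖((s.γ * s.P x * s.𝒜 x / s.ρ x : ℝ) : ℂ) *
        (rdot (s.n x) (fld z x) * star (dvg z x))‖ := by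
      simp only [norm_mul, norm_star]
      ring
    rw [e]
    nlinarith [sq_nonneg (‖sqrtK (dvg z) x‖ - 2 * s.κ₁ * ‖sqrtH (fld z) x‖)]
  · rw [← Real.norm_eq_abs, ← Complex.norm_real, ← h3, norm_sq_H, ← integral_const_mul]
    refine norm_integral_le_of_norm_le (iH.const_mul _) ?_
    filter_upwards [ae_restrict_mem s.measurableSet_R] with x hx
    have h1 := norm_normal_le (fld z) (fld z) hx
    rwa [← sq] at h1
  · rw [mul_assoc (4 * Real.pi * s.G)]
    gcongr

theorem inner_self_H (u : s.H) : (inner ℂ u u : ℂ) = ((‖u‖ ^ 2 : ℝ) : ℂ) := by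
  rw [inner_self_eq_norm_sq_to_K]
  norm_cast

theorem Qa_self_bounds (z : s.𝔊) : (Qa z z).im = 0 ∧ (1 / 2) * ‖dvg z‖ ^ 2 ≤ (Qa z z).re ∧
    (Qa z z).re ≤ (3 / 2) * ‖dvg z‖ ^ 2 + (2 * s.κ₁ ^ 2 + s.κ₂ + s.a) * ‖fld z‖ ^ 2 := by
  obtain ⟨t₂, t₃, t₄, h, h2, h3, h4, h4'⟩ := exists_Q₀_self_eq z
  have e : Qa z z =
      ((‖dvg z‖ ^ 2 + t₂ - t₃ - t₄ + s.a * ‖fld z‖ ^ 2 : ℝ) : ℂ) := by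
    rw [Qa, h, inner_self_H]
    push_cast
    ring
  rw [e, Complex.ofReal_re, Complex.ofReal_im]
  rw [abs_le] at h2 h3
  refine ⟨rfl, ?_, by linarith⟩
  have : s.a = 2 * s.κ₁ ^ 2 + s.κ₂ + 4 * Real.pi * s.G * s.ρO := rfl
  rw [this]
  linarith

theorem Qa_equivalent : ∃ C > 0, ∀ z : s.𝔊, (1 / C) * ‖z‖ ^ 2 ≤ ‖fld z‖ ^ 2 + (Qa z z).re ∧
    ‖fld z‖ ^ 2 + (Qa z z).re ≤ C * ‖z‖ ^ 2 := by
  have h1 := s.κ₂_nonneg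
  have h2 := s.a_nonneg
  refine ⟨2 + (2 * s.κ₁ ^ 2 + s.κ₂ + s.a), by positivity, fun z => ?_⟩
  obtain ⟨-, h3, h4⟩ := Qa_self_bounds z
  rw [norm_sq_𝔊]
  set X := ‖fld z‖ ^ 2
  set Y := ‖dvg z‖ ^ 2
  have hX : 0 ≤ X := by positivity
  have hY : 0 ≤ Y := by positivity
  set B := 2 * s.κ₁ ^ 2 + s.κ₂ + s.a
  have hB : 0 ≤ B := by positivity
  constructor
  · have : 1 / (2 + B) ≤ 1 / 2 := one_div_le_one_div_of_le (by norm_num) (by linarith)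
    have := mul_le_mul_of_nonneg_right this (add_nonneg hX hY)
    linarith
  · nlinarith [mul_nonneg hB hY]

end BarotropicStar

/-! ### `Q₀` as a bounded form -/

/-- A Hermitian form bounded on the diagonal is bounded, by polarization and scaling. -/
theorem LinearMap.norm_apply_le_of_norm_apply_self_le {V : Type*} [NormedAddCommGroup V]
    [NormedSpace ℂ V] (B : V →ₗ⋆[ℂ] V →ₗ[ℂ] ℂ) {C : ℝ} (hC : ∀ x, ‖B x x‖ ≤ C * ‖x‖ ^ 2)
    (x y : V) : ‖B x y‖ ≤ 4 * C * ‖x‖ * ‖y‖ := by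
  have key : ∀ x y : V, ‖x‖ = 1 → ‖y‖ = 1 → ‖B x y‖ ≤ 4 * C := fun x y hx hy => by
    have hC0 : 0 ≤ C := by
      have := (norm_nonneg _).trans (hC x)
      rwa [hx, one_pow, mul_one] at this
    have e : 4 * B x y = B (x + y) (x + y) - B (x - y) (x - y)
        - Complex.I * B (x + Complex.I • y) (x + Complex.I • y)
        + Complex.I * B (x - Complex.I • y) (x - Complex.I • y) := by
      simp only [map_add, map_sub, LinearMap.add_apply, LinearMap.sub_apply,
        LinearMap.map_smulₛₗ, LinearMap.smul_apply, smul_eq_mul, map_smul, Complex.conj_I]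
      ring_nf
      simp only [Complex.I_sq]
      ring
    have h : ∀ z : V, ‖z‖ ≤ 2 → ‖B z z‖ ≤ 4 * C := fun z hz =>
      by
      have h1 : ‖z‖ ^ 2 ≤ 4 := by nlinarith [norm_nonneg z]
      nlinarith [hC z, mul_le_mul_of_nonneg_left h1 hC0]
    have n1 := h (x + y) ((norm_add_le _ _).trans (by rw [hx, hy]; norm_num))
    have n2 := h (x - y) ((norm_sub_le _ _).trans (by rw [hx, hy]; norm_num))
    have n3 := h (x + Complex.I • y) ((norm_add_le _ _).trans
      (by rw [norm_smul, Complex.norm_I, hx, hy]; norm_num))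
    have n4 := h (x - Complex.I • y) ((norm_sub_le _ _).trans
      (by rw [norm_smul, Complex.norm_I, hx, hy]; norm_num))
    have h4 : ‖4 * B x y‖ ≤ 4 * (4 * C) := by
      rw [e]
      refine (norm_add_le _ _).trans ?_
      refine (add_le_add_left ((norm_sub_le _ _).trans
        (add_le_add_left (norm_sub_le _ _) _)) _).trans ?_
      rw [norm_mul, norm_mul, Complex.norm_I]
      linarith
    rw [norm_mul] at h4
    norm_num at h4
    linarith
  rcases eq_or_ne x 0 with rfl | hx
  · simp
  rcases eq_or_ne y 0 with rfl | hy
  · simp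
  have h := key ((‖x‖⁻¹ : ℂ) • x) ((‖y‖⁻¹ : ℂ) • y) (norm_smul_inv_norm hx) (norm_smul_inv_norm hy)
  have hx' := norm_pos_iff.2 hx
  have hy' := norm_pos_iff.2 hy
  simp only [LinearMap.map_smulₛₗ, LinearMap.smul_apply, smul_eq_mul, norm_mul,
    RingHom.id_apply] at h
  simp only [map_inv₀, Complex.conj_ofReal, norm_inv, Complex.norm_real, norm_norm] at h
  rw [inv_mul_le_iff₀ hy', inv_mul_le_iff₀ hx'] at h
  linarith

namespace BarotropicStar

variable {s : BarotropicStar}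

theorem Q₀_add_right (z w w' : s.𝔊) : Q₀ z (w + w') = Q₀ z w + Q₀ z w' := by
  rw [← star_Q₀, Q₀_add, star_add, star_Q₀, star_Q₀]

theorem Q₀_smul_right (c : ℂ) (z w : s.𝔊) : Q₀ z (c • w) = conj c * Q₀ z w := by
  rw [← star_Q₀, Q₀_smul, ← starRingEnd_apply, map_mul, starRingEnd_apply (Q₀ w z), star_Q₀]

theorem norm_Q₀_self_le (z : s.𝔊) :
    ‖Q₀ z z‖ ≤ (2 + (2 * s.κ₁ ^ 2 + s.κ₂ + s.a)) * ‖z‖ ^ 2 := by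
  obtain ⟨t₂, t₃, t₄, h, h2, h3, h4, h4'⟩ := exists_Q₀_self_eq z
  have : s.a = 2 * s.κ₁ ^ 2 + s.κ₂ + 4 * Real.pi * s.G * s.ρO := rfl
  rw [h, Complex.norm_real, Real.norm_eq_abs, norm_sq_𝔊]
  rw [abs_le] at h2 h3
  have h1 := s.κ₂_nonneg
  have h2 := s.a_nonneg
  have := mul_nonneg s.a_nonneg (sq_nonneg ‖fld z‖)
  have := mul_nonneg s.a_nonneg (sq_nonneg ‖dvg z‖)
  have := mul_nonneg (sq_nonneg s.κ₁) (sq_nonneg ‖fld z‖)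
  have := mul_nonneg (sq_nonneg s.κ₁) (sq_nonneg ‖dvg z‖)
  have := mul_nonneg s.κ₂_nonneg (sq_nonneg ‖fld z‖)
  have := mul_nonneg s.κ₂_nonneg (sq_nonneg ‖dvg z‖)
  have h5 : 4 * Real.pi * s.G * s.ρO * ‖fld z‖ ^ 2 ≤ s.a * ‖fld z‖ ^ 2 := by
    refine mul_le_mul_of_nonneg_right ?_ (sq_nonneg _)
    nlinarith [sq_nonneg s.κ₁]
  rw [abs_le]
  constructor <;> nlinarith [sq_nonneg ‖fld z‖, sq_nonneg ‖dvg z‖]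

variable (s) in
/-- The form `Q₀` as a bounded sesquilinear form on `𝔊`, antilinear in its first argument. -/
noncomputable def formQ : s.𝔊 →L⋆[ℂ] s.𝔊 →L[ℂ] ℂ :=
  LinearMap.mkContinuous₂
    (LinearMap.mk₂'ₛₗ (starRingEnd ℂ) (RingHom.id ℂ) (fun w z : s.𝔊 => Q₀ z w)
      (fun w w' z => Q₀_add_right z w w') (fun c w z => Q₀_smul_right c z w)
      (fun w z z' => Q₀_add z z' w) (fun c w z => Q₀_smul c z w))
    (4 * (2 + (2 * s.κ₁ ^ 2 + s.κ₂ + s.a)))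
    (LinearMap.norm_apply_le_of_norm_apply_self_le _ fun z => norm_Q₀_self_le z)

theorem formQ_apply (w z : s.𝔊) : s.formQ w z = Q₀ z w := rfl

variable (s) in
/-- The embedding of `𝔊` in `ℌ`. -/
noncomputable def fldL : s.𝔊 →L[ℂ] s.H := (WithLp.fstL 2 ℂ s.H s.K).comp s.𝔊.subtypeL

theorem fldL_apply (z : s.𝔊) : s.fldL z = fld z := rfl

end BarotropicStar

/-! ### The weak form of `𝓛` -/

namespace Star

/-- Componentwise complex conjugation. -/
noncomputable def conjV (v : V3) : V3 := WithLp.toLp 2 fun i => conj (v i)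

theorem conjV_apply (v : V3) (i : Fin 3) : conjV v i = conj (v i) := rfl

theorem conjV_conjV (v : V3) : conjV (conjV v) = v := by
  ext i
  simp [conjV_apply]

theorem conjV_smul (c : ℝ) (v : V3) : conjV (c • v) = c • conjV v := by
  ext i
  simp [conjV_apply]

theorem rdot_conjV (a : E3) (v : V3) : rdot a (conjV v) = conj (rdot a v) := by
  simp [rdot, conjV_apply]

theorem rdot_add_left (a b : E3) (v : V3) : rdot (a + b) v = rdot a v + rdot b v := by
  simp [rdot, add_mul, Finset.sum_add_distrib]

theorem cdot_conjV (w v : V3) : cdot w (conjV v) = inner ℂ v w := by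
  simp [cdot, conjV_apply, PiLp.inner_apply]

theorem IsTest.conjV {D : Set E3} {v : E3 → V3} (hv : IsTest D v) :
    IsTest D fun x => conjV (v x) :=
  IsTest.toLp fun i => (hv.comp_proj i).clm_comp Complex.conjCLE.toContinuousLinearMap

theorem pd_conj {f : E3 → ℂ} {x : E3} (hf : DifferentiableAt ℝ f x) (i : Fin 3) :
    pd i (fun y => conj (f y)) x = conj (pd i f x) := by
  have := (Complex.conjCLE.toContinuousLinearMap.hasFDerivAt.comp x hf.hasFDerivAt).fderiv
  have e : (Complex.conjCLE.toContinuousLinearMap ∘ f) = fun y => conj (f y) := rfl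
  rw [e] at this
  simp [pd, this]

theorem differentiableAt_comp_proj {v : E3 → V3} {x : E3} (hv : DifferentiableAt ℝ v x)
    (i : Fin 3) : DifferentiableAt ℝ (fun y => v y i) x :=
  ((EuclideanSpace.proj i : V3 →L[ℂ] ℂ).restrictScalars ℝ).differentiableAt.comp x hv

theorem divC_conjV {v : E3 → V3} {x : E3} (hv : DifferentiableAt ℝ v x) :
    divC (fun y => conjV (v y)) x = conj (divC v x) := by
  simp only [divC, conjV_apply, map_sum, pd_conj (differentiableAt_comp_proj hv _)]

theorem divC_smul {c : E3 → ℝ} {v : E3 → V3} {x : E3} (hc : DifferentiableAt ℝ c x)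
    (hv : DifferentiableAt ℝ v x) :
    divC (fun y => c y • v y) x = c x * divC v x + rdot (gradient c x) (v x) := by
  have h : ∀ i, pd i (fun y => (c y • v y) i) x =
      (c x : ℂ) * pd i (fun y => v y i) x + ((pd i c x : ℝ) : ℂ) * v x i := fun i => by
    have := pd_smul (𝕜 := ℝ) (F := ℂ) hc (differentiableAt_comp_proj hv i) i
    simpa only [PiLp.smul_apply, Complex.real_smul] using this
  simp only [divC, h, Finset.sum_add_distrib, Finset.mul_sum, rdot, gradient_apply]

theorem divC_congr {u v : E3 → V3} {x : E3} (h : u =ᶠ[𝓝 x] v) : divC u x = divC v x := by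
  refine Finset.sum_congr rfl fun i _ => ?_
  have : (fun y => u y i) =ᶠ[𝓝 x] fun y => v y i := h.mono fun y hy => by simp only [hy]
  rw [pd, pd, this.fderiv_eq]

end Star

namespace BarotropicStar

variable {s : BarotropicStar}

theorem integral_cdot_ρ_smul_conjV (w : s.H) {v : E3 → V3} (hv : IsTest s.R v) :
    ∫ x in s.R, cdot (w x) (s.ρ x • conjV (v x)) = inner ℂ (fld (ofTest hv)) w := by
  rw [inner_H]
  refine integral_congr_ae ?_
  filter_upwards [s.ae_of_ae_μ (fld_ofTest hv)] with x hx
  rw [hx, ← conjV_smul, cdot_conjV, ← Complex.coe_smul, inner_smul_left, Complex.conj_ofReal,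
    Complex.real_smul]

theorem rdot_gradient_ρ (x : E3) (v : V3) :
    rdot (gradient s.ρ x) v = ‖gradient s.ρ x‖ * rdot (s.n x) v := by
  conv_lhs => rw [s.gradient_ρ_eq x]
  exact rdot_smul _ _ _

theorem rdot_𝔞 {x : E3} (hx : x ∈ s.R) (v : V3) :
    rdot (s.𝔞 x) v = -(s.𝒜 x * rdot (s.n x) v) := by
  rw [s.𝔞_eq hx, rdot_neg, rdot_smul]

theorem rdot_gradient_P {x : E3} (hx : x ∈ s.R) (v : V3) :
    rdot (gradient s.P x) v = (s.γ * s.P x / s.ρ x : ℝ) * (‖gradient s.ρ x‖ * rdot (s.n x) v)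
      + (s.γ * s.P x : ℝ) * (s.𝒜 x * rdot (s.n x) v) := by
  rw [s.gradient_P hx, sub_eq_add_neg, rdot_add_left, rdot_neg, rdot_smul, rdot_smul,
    rdot_gradient_ρ, rdot_𝔞 hx]
  ring

/-- The local part of the weak form of `𝓛` is the integrand of `Q₀`: in
`-δP div v̄ - (δρ/ρ) ∇P · v̄` with `ρ div v = div(ρv) - ∇ρ · v`, the two terms
`(γP/ρ²) ‖∇ρ‖ div(ρu) (v|n)^*` cancel. -/
theorem local_identity {x : E3} (hx : x ∈ s.R) (u : V3) (g : ℂ) {v : E3 → V3}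
    (hv : DifferentiableAt ℝ v x) :
    (((s.γ * s.P x / s.ρ x : ℝ) : ℂ) * -g + ((s.γ * s.P x : ℝ) : ℂ) * rdot (s.𝔞 x) u) *
        conj (divC v x) + -g / ((s.ρ x ^ 2 : ℝ) : ℂ) *
        rdot (gradient s.P x) (s.ρ x • conjV (v x)) =
      -(((s.γ * s.P x / s.ρ x ^ 2 : ℝ) : ℂ) * (g * star (divC (fun y => s.ρ y • v y) x)) +
        ((s.γ * s.P x * s.𝒜 x / s.ρ x : ℝ) : ℂ) * (rdot (s.n x) u *
          star (divC (fun y => s.ρ y • v y) x) + g * star (rdot (s.n x) (v x))) -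
        ((s.γ * s.P x * s.𝒜 x / s.ρ x * ‖gradient s.ρ x‖ : ℝ) : ℂ) *
          (rdot (s.n x) u * star (rdot (s.n x) (v x)))) := by
  have hρ : (s.ρ x : ℂ) ≠ 0 := Complex.ofReal_ne_zero.2 (ρ_pos hx).ne'
  rw [divC_smul (s.ρ_contDiff.differentiable (by simp) x) hv, rdot_gradient_ρ, rdot_real_smul,
    rdot_gradient_P hx, rdot_𝔞 hx, rdot_conjV]
  simp only [← starRingEnd_apply, map_add, map_mul, Complex.conj_ofReal]
  push_cast
  field_simp
  ring

theorem integrable_dvg_mul_test (g : s.K) {h : E3 → ℂ} (hc : Continuous h)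
    (hs : HasCompactSupport h) : Integrable (fun x => g x * h x) (volume.restrict s.R) := by
  obtain ⟨C, hC⟩ := hs.exists_bound_of_continuous hc
  exact ((memLp_K g).integrable one_le_two).mul_bdd hc.aestronglyMeasurable (ae_of_all _ hC)

/-- The weak form of `𝓛u`, tested against `ρ v̄`, is `Q₀(u, v)`. -/
theorem weakL_eq_Q₀ (z : s.𝔊) {v : E3 → V3} (hv : IsTest s.R v) :
    -(∫ x in s.R, s.δP (fun x => -(dvg z x)) (fld z) x *
        divC (fun y => (s.ρ y)⁻¹ • s.ρ y • conjV (v y)) x)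
      - (∫ x in s.R, -(dvg z x) / ((s.ρ x ^ 2 : ℝ) : ℂ) *
        rdot (gradient s.P x) (s.ρ x • conjV (v x)))
      - ∫ x in s.R, s.δΦ (fun x => -(dvg z x)) x * divC (fun y => s.ρ y • conjV (v y)) x =
    Q₀ z (ofTest hv) := by
  have hvd : Differentiable ℝ v := hv.1.differentiable (by simp)
  have hρd : Differentiable ℝ s.ρ := s.ρ_contDiff.differentiable (by simp)
  have hdiv : ∀ x ∈ s.R, divC (fun y => (s.ρ y)⁻¹ • s.ρ y • conjV (v y)) x =
      conj (divC v x) := fun x hx => by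
    rw [← divC_conjV (hvd x)]
    refine divC_congr ?_
    filter_upwards [s.isOpen_R.mem_nhds hx] with y hy
    rw [inv_smul_smul₀ (ρ_pos hy).ne']
  have hdiv' : ∀ x, divC (fun y => s.ρ y • conjV (v y)) x =
      star (divC (fun y => s.ρ y • v y) x) := fun x => by
    simp only [← conjV_smul]
    exact divC_conjV ((hρd x).smul (hvd x))
  have hd := s.ae_of_ae_ν (dvg_ofTest hv)
  have hf := s.ae_of_ae_μ (fld_ofTest hv)
  set z' := ofTest hv
  have iW : Integrable (fun x => ((s.γ * s.P x / s.ρ x ^ 2 : ℝ) : ℂ) *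
      (dvg z x * star (dvg z' x))) (volume.restrict s.R) := by
    refine ((memLp_sqrtK (dvg z)).integrable_mul (memLp_sqrtK (dvg z')).star).congr
      (ae_of_all _ fun x => ?_)
    have h : ((s.W x : ℝ) : ℂ) = (√(s.W x) : ℂ) * (√(s.W x) : ℂ) := by
      rw [← Complex.ofReal_mul, Real.mul_self_sqrt (s.W_nonneg x)]
    change _ = ((s.W x : ℝ) : ℂ) * _
    rw [h]
    change √(s.W x) • dvg z x * conj (√(s.W x) • dvg z' x) = _
    simp only [Complex.real_smul, ← starRingEnd_apply, map_mul, Complex.conj_ofReal]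
    ring
  have iX := (integrable_cross (fld z) (dvg z')).add (integrable_cross' (fld z') (dvg z))
  simp only [Pi.add_def, ← mul_add] at iX
  have iN := integrable_normal (fld z) (fld z')
  have hsum : ∀ᵐ x ∂volume.restrict s.R, s.δP (fun x => -(dvg z x)) (fld z) x *
        divC (fun y => (s.ρ y)⁻¹ • s.ρ y • conjV (v y)) x + -(dvg z x) / ((s.ρ x ^ 2 : ℝ) : ℂ) *
        rdot (gradient s.P x) (s.ρ x • conjV (v x)) =
      -(((s.γ * s.P x / s.ρ x ^ 2 : ℝ) : ℂ) * (dvg z x * star (dvg z' x)) +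
        ((s.γ * s.P x * s.𝒜 x / s.ρ x : ℝ) : ℂ) * (rdot (s.n x) (fld z x) *
          star (dvg z' x) + dvg z x * star (rdot (s.n x) (fld z' x))) -
        ((s.γ * s.P x * s.𝒜 x / s.ρ x * ‖gradient s.ρ x‖ : ℝ) : ℂ) *
          (rdot (s.n x) (fld z x) * star (rdot (s.n x) (fld z' x)))) := by
    filter_upwards [hd, hf, ae_restrict_mem s.measurableSet_R] with x h1 h2 hx
    rw [h1, h2, hdiv x hx]
    exact local_identity hx _ _ (hvd x)
  have iB : Integrable (fun x => -(dvg z x) / ((s.ρ x ^ 2 : ℝ) : ℂ) *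
      rdot (gradient s.P x) (s.ρ x • conjV (v x))) (volume.restrict s.R) := by
    have hτ : IsTest s.R fun x => s.W x • conjV (v x) :=
      hv.conjV.smul_left s.isOpen_R s.W_contDiffOn
    have hc : Continuous fun x => rdot (gradient s.ρ x) (s.W x • conjV (v x)) := by
      unfold rdot
      refine continuous_finsetSum _ fun i _ => (Complex.continuous_ofReal.comp
        ((EuclideanSpace.proj (𝕜 := ℝ) i).continuous.comp s.continuous_gradient_ρ)).mul
          (hτ.comp_proj i).1.continuous
    have hs : HasCompactSupport fun x => rdot (gradient s.ρ x) (s.W x • conjV (v x)) :=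
      hτ.2.1.mono fun x hx h => hx (by
        simp only [h, rdot, PiLp.zero_apply, mul_zero, Finset.sum_const_zero])
    have h1 := integrable_dvg_mul_test (dvg z) hc hs
    refine (h1.add (integrable_cross' (fld z') (dvg z))).neg.congr ?_
    filter_upwards [hf, ae_restrict_mem s.measurableSet_R] with x h2 hx
    have hρ : (s.ρ x : ℂ) ≠ 0 := Complex.ofReal_ne_zero.2 (ρ_pos hx).ne'
    simp only [Pi.neg_apply, Pi.add_apply]
    rw [h2, rdot_gradient_ρ, rdot_real_smul, rdot_real_smul, rdot_gradient_P hx, rdot_conjV,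
      ← starRingEnd_apply, W]
    push_cast
    field_simp
  have iAB := ((iW.add iX).sub iN).neg
  have iA : Integrable (fun x => s.δP (fun x => -(dvg z x)) (fld z) x *
      divC (fun y => (s.ρ y)⁻¹ • s.ρ y • conjV (v y)) x) (volume.restrict s.R) := by
    refine (iAB.sub iB).congr ?_
    filter_upwards [hsum] with x hx
    simp only [Pi.neg_apply, Pi.sub_apply, Pi.add_apply]
    rw [← hx]
    ring
  have hG : ∫ x in s.R, s.δΦ (fun x => -(dvg z x)) x * divC (fun y => s.ρ y • conjV (v y)) x =
      ((4 * Real.pi * s.G : ℝ) : ℂ) *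
        ∫ x in s.R, newtonK s.R (fun y => dvg z y) x * star (dvg z' x) := by
    rw [← integral_const_mul]
    refine integral_congr_ae ?_
    filter_upwards [hd] with x h1
    rw [h1, hdiv', δΦ]
    simp only [neg_neg]
    ring
  have h3 := integral_add iA iB
  rw [integral_congr_ae hsum, integral_neg] at h3
  have h4 := integral_sub (iW.add iX) iN
  simp only [Pi.add_apply] at h4
  rw [hG, Q₀, ← integral_add iW iX, ← h4]
  linear_combination h3

/-- `𝓛u = w` in the sense of distributions means `Q₀(u, v) = (w | v)` for all test fields `v`; the
substitution `φ = ρ v̄` is a bijection of `C₀^∞(ℜ)`. -/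
theorem isWeakL_iff (z : s.𝔊) (w : s.H) : IsWeakL z w ↔
    ∀ (v : E3 → V3) (hv : IsTest s.R v), inner ℂ (fld (ofTest hv)) w = Q₀ z (ofTest hv) := by
  constructor
  · intro h v hv
    rw [← integral_cdot_ρ_smul_conjV, ← weakL_eq_Q₀]
    exact h _ (isTest_ρ_smul hv.conjV)
  · intro h φ hφ
    have hv := (isTest_ρ_inv_smul hφ).conjV
    have e : φ = fun x => s.ρ x • conjV (conjV ((s.ρ x)⁻¹ • φ x)) := by
      funext x
      rw [conjV_conjV]
      by_cases hx : x ∈ s.R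
      · rw [smul_inv_smul₀ (ρ_pos hx).ne']
      · rw [hφ.eq_zero hx, smul_zero, smul_zero]
    have := h _ hv
    rw [← integral_cdot_ρ_smul_conjV, ← weakL_eq_Q₀] at this
    rw [e]
    exact this

theorem IsWeakL.congr {z : s.𝔊} {w w' : E3 → V3} (h : IsWeakL z w)
    (hw : ∀ᵐ x ∂volume.restrict s.R, w x = w' x) : IsWeakL z w' := fun φ hφ => by
  rw [← h φ hφ]
  exact integral_congr_ae (hw.mono fun x hx => by simp only [hx])

end BarotropicStar

/-! ### The operator `𝓛` on test fields -/

namespace Star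

open scoped Convolution in
/-- The Newton potential of a test function is smooth, as a convolution. -/
theorem contDiff_newtonK {D : Set E3} {g : E3 → ℂ} (hg : IsTest D g) :
    ContDiff ℝ ∞ (newtonK D g) := by
  have hk : LocallyIntegrable (fun z : E3 => ‖z‖⁻¹) := fun x => by
    obtain ⟨C, -, hC⟩ := exists_integral_inv_norm_sq_le
      (Metric.isBounded_ball (x := (0 : E3)) (r := ‖x‖ + 1)) measurableSet_ball
    have h0 : (0 : E3) ∈ Metric.ball (0 : E3) (‖x‖ + 1) := Metric.mem_ball_self (by positivity)
    have hf : IsFiniteMeasure (volume.restrict (Metric.ball (0 : E3) (‖x‖ + 1))) :=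
      ⟨by rw [Measure.restrict_apply_univ]; exact measure_ball_lt_top⟩
    refine ⟨Metric.ball 0 (‖x‖ + 1), Metric.isOpen_ball.mem_nhds (by simp), ?_⟩
    have h1 := (hC 0 h0).1.integrable one_le_two
    simp only [zero_sub, norm_neg] at h1
    exact h1
  have h : newtonK D g = fun x => (4 * Real.pi)⁻¹ •
      ((fun z : E3 => ‖z‖⁻¹) ⋆[ContinuousLinearMap.lsmul ℝ ℝ, volume] g) x := by
    funext x
    rw [newtonK, convolution_lsmul_swap,
      setIntegral_eq_integral_of_forall_compl_eq_zero fun y hy => by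
        rw [hg.eq_zero hy, smul_zero]]
  rw [h]
  exact (hg.2.1.contDiff_convolution_right (n := ⊤) _ hk hg.1).const_smul _

theorem continuous_gradC {f : E3 → ℂ} (hf : ContDiff ℝ 1 f) : Continuous (gradC f) := by
  refine (PiLp.continuous_toLp 2 _).comp (continuous_pi fun i => ?_)
  exact (hf.continuous_fderiv (by simp)).clm_apply continuous_const

theorem integrable_cdot {D : Set E3} {U ψ : E3 → V3} (hU : Continuous U) (hψ : IsTest D ψ) :
    Integrable fun x => cdot (U x) (ψ x) := by
  refine integrable_finsetSum _ fun i _ => ?_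
  exact (((EuclideanSpace.proj (𝕜 := ℂ) i).continuous.comp hU).mul
    (hψ.comp_proj i).1.continuous).integrable_of_hasCompactSupport (hψ.comp_proj i).2.1.mul_left

end Star

namespace BarotropicStar

variable {s : BarotropicStar}

theorem isTest_δρ {φ : E3 → V3} (hφ : IsTest s.R φ) : IsTest s.R (s.δρ φ) :=
  (isTest_ρ_smul hφ).divC.neg

theorem contDiffOn_pd {f : E3 → ℝ} (hf : ContDiffOn ℝ ∞ f s.R) (i : Fin 3) :
    ContDiffOn ℝ ∞ (pd i f) s.R :=
  (hf.fderiv_of_isOpen s.isOpen_R (by simp)).clm_apply contDiffOn_const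

theorem isTest_δP {φ : E3 → V3} (hφ : IsTest s.R φ) : IsTest s.R (s.δP (s.δρ φ) φ) := by
  have h1 : IsTest s.R fun x => (s.γ * s.P x / s.ρ x) • s.δρ φ x :=
    (isTest_δρ hφ).smul_left s.isOpen_R
      ((contDiffOn_const.mul s.P_contDiffOn).div s.ρ_contDiffOn fun _ hx => (ρ_pos hx).ne')
  have h2 : IsTest s.R fun x => ∑ i, (s.γ * s.P x * s.𝔞 x i) • φ x i := by
    refine IsTest.sum fun i _ => (hφ.comp_proj i).smul_left s.isOpen_R ?_
    have : (fun x => s.γ * s.P x * s.𝔞 x i) =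
        fun x => s.γ * s.P x * -((s.γ * s.CV)⁻¹ * pd i s.S x) := by
      funext x
      simp [𝔞, gradient_apply]
    rw [this]
    exact (contDiffOn_const.mul s.P_contDiffOn).mul
      (contDiffOn_const.mul (contDiffOn_pd s.S_smooth i)).neg
  have e : s.δP (s.δρ φ) φ = (fun x => (s.γ * s.P x / s.ρ x) • s.δρ φ x) +
      fun x => ∑ i, (s.γ * s.P x * s.𝔞 x i) • φ x i := by
    funext x
    simp only [δP, Pi.add_apply, Complex.real_smul, rdot, Finset.mul_sum]
    push_cast
    simp only [mul_assoc]
  rw [e]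
  exact h1.add h2

/-- The term `(δρ/ρ²) ∇P` of `𝓛` is a test field. -/
theorem isTest_buoyancy {φ : E3 → V3} (hφ : IsTest s.R φ) : IsTest s.R fun x =>
    (s.δρ φ x / ((s.ρ x ^ 2 : ℝ) : ℂ)) • toV (gradient s.P x) := by
  have e : (fun x => (s.δρ φ x / ((s.ρ x ^ 2 : ℝ) : ℂ)) • toV (gradient s.P x)) =
      fun x => (WithLp.toLp 2 fun i => (pd i s.P x / s.ρ x ^ 2) • s.δρ φ x : V3) := by
    funext x
    ext i
    simp only [toV, PiLp.smul_apply, smul_eq_mul, gradient_apply, Complex.real_smul]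
    push_cast
    ring
  rw [e]
  exact IsTest.toLp fun i => (isTest_δρ hφ).smul_left s.isOpen_R
    ((contDiffOn_pd s.P_contDiffOn i).div (s.ρ_contDiffOn.pow 2)
      fun _ hx => (pow_pos (ρ_pos hx) 2).ne')

theorem contDiff_δΦ {φ : E3 → V3} (hφ : IsTest s.R φ) : ContDiff ℝ ∞ (s.δΦ (s.δρ φ)) :=
  contDiff_const.mul (contDiff_newtonK (isTest_δρ hφ).neg)

variable (s) in
theorem isFiniteMeasure_μ : IsFiniteMeasure s.μ :=
  isFiniteMeasure_withDensity_ofReal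
    (s.ρ_contDiff.continuous.integrable_of_hasCompactSupport s.ρ_compact).integrableOn.2

theorem memLp_μ_of_continuous {U : E3 → V3} (hU : Continuous U) : MemLp U 2 s.μ := by
  have := s.isFiniteMeasure_μ
  obtain ⟨C, hC⟩ := s.isCompact_closure_R.exists_bound_of_continuousOn hU.continuousOn
  refine MemLp.of_bound hU.aestronglyMeasurable C (s.ae_μ_of_ae ?_)
  filter_upwards [ae_restrict_mem s.measurableSet_R] with x hx using hC x (subset_closure hx)

theorem memLp_classicalL {φ : E3 → V3} (hφ : IsTest s.R φ) : MemLp (s.classicalL φ) 2 s.μ :=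
  ((memLp_μ (isTest_ρ_inv_smul (isTest_δP hφ).gradC)).sub (memLp_μ (isTest_buoyancy hφ))).add
    (memLp_μ_of_continuous (continuous_gradC ((contDiff_δΦ hφ).of_le (by simp))))

/-- On a test field the weak form of `𝓛` is the classical one. -/
theorem isWeakL_classicalL {φ : E3 → V3} (hφ : IsTest s.R φ) :
    IsWeakL (ofTest hφ) (s.classicalL φ) := by
  intro ψ hψ
  set dr : E3 → ℂ := fun x => -(dvg (ofTest hφ) x) with hdr
  have hd : ∀ᵐ x ∂volume.restrict s.R, dr x = s.δρ φ x :=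
    (s.ae_of_ae_ν (dvg_ofTest hφ)).mono fun x hx => by simp only [hdr, hx, δρ]
  have hf := s.ae_of_ae_μ (fld_ofTest hφ)
  have hP := isTest_δP hφ
  have hB := isTest_buoyancy hφ
  have hΦ : ContDiff ℝ 1 (s.δΦ (s.δρ φ)) := (contDiff_δΦ hφ).of_le (by simp)
  have i1 : Integrable _ (volume.restrict s.R) :=
    (integrable_cdot (isTest_ρ_inv_smul hP.gradC).1.continuous hψ).integrableOn
  have i2 : Integrable _ (volume.restrict s.R) := (integrable_cdot hB.1.continuous hψ).integrableOn
  have i3 : Integrable _ (volume.restrict s.R) :=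
    (integrable_cdot (continuous_gradC hΦ) hψ).integrableOn
  have e0 : ∀ x, cdot (s.classicalL φ x) (ψ x) =
      cdot ((s.ρ x)⁻¹ • gradC (s.δP (s.δρ φ) φ) x) (ψ x) -
      cdot ((s.δρ φ x / ((s.ρ x ^ 2 : ℝ) : ℂ)) • toV (gradient s.P x)) (ψ x) +
      cdot (gradC (s.δΦ (s.δρ φ)) x) (ψ x) := fun x => by
    simp only [classicalL, cdot, PiLp.add_apply, PiLp.sub_apply, add_mul, sub_mul,
      Finset.sum_add_distrib, Finset.sum_sub_distrib]
  have e1 : ∫ x in s.R, cdot ((s.ρ x)⁻¹ • gradC (s.δP (s.δρ φ) φ) x) (ψ x) =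
      -∫ x in s.R, s.δP dr (fld (ofTest hφ)) x * divC (fun y => (s.ρ y)⁻¹ • ψ y) x := by
    have h := integral_mul_divC (D := s.R) (hP.1.of_le (by simp)) (isTest_ρ_inv_smul hψ)
    have h' : ∫ x in s.R, s.δP dr (fld (ofTest hφ)) x * divC (fun y => (s.ρ y)⁻¹ • ψ y) x =
        ∫ x in s.R, s.δP (s.δρ φ) φ x * divC (fun y => (s.ρ y)⁻¹ • ψ y) x := by
      refine integral_congr_ae ?_
      filter_upwards [hd, hf] with x h1 h2
      rw [δP, δP, h1, h2]
    rw [h', h, neg_neg]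
    refine integral_congr_ae (ae_of_all _ fun x => ?_)
    simp only [cdot, PiLp.smul_apply, Complex.real_smul]
    exact Finset.sum_congr rfl fun i _ => by ring
  have e2 : ∫ x in s.R, cdot ((s.δρ φ x / ((s.ρ x ^ 2 : ℝ) : ℂ)) • toV (gradient s.P x)) (ψ x) =
      ∫ x in s.R, dr x / ((s.ρ x ^ 2 : ℝ) : ℂ) * rdot (gradient s.P x) (ψ x) := by
    refine integral_congr_ae ?_
    filter_upwards [hd] with x h1
    simp only [h1, cdot, rdot, PiLp.smul_apply, smul_eq_mul, Finset.mul_sum, toV, mul_assoc]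
  have e3 : ∫ x in s.R, cdot (gradC (s.δΦ (s.δρ φ)) x) (ψ x) =
      -∫ x in s.R, s.δΦ dr x * divC ψ x := by
    have h := integral_mul_divC (D := s.R) hΦ hψ
    have h' : ∀ x, s.δΦ dr x = s.δΦ (s.δρ φ) x := fun x => by
      rw [δΦ, δΦ, newtonK_congr (hd.mono fun y hy => congrArg Neg.neg hy)]
    simp only [h', h, neg_neg]
  simp only [e0]
  rw [← e1, ← e2]
  have h1 := integral_add (i1.sub i2) i3
  have h2 := integral_sub i1 i2
  simp only [Pi.sub_apply] at h1
  rw [h1, h2, e3]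
  ring

end BarotropicStar

/-! ### Friedrichs extensions of operators given by a form -/

section FriedrichsForm

variable {V X : Type*} [NormedAddCommGroup V] [InnerProductSpace ℂ V] [CompleteSpace V]
  [NormedAddCommGroup X] [InnerProductSpace ℂ X]

/-- The self-adjoint operator associated with the restriction of a form to a closed subspace that is
dense in `X`. -/
theorem exists_isSelfAdjoint_of_submodule [CompleteSpace X] {j : V →L[ℂ] X}
    (hj : Function.Injective j)
    {B : V →L⋆[ℂ] V →L[ℂ] ℂ} (hB : ∀ x y, star (B x y) = B y x) {W : Submodule ℂ V}
    (hW : IsClosed (W : Set V)) (hd : Dense (W.map (j : V →ₗ[ℂ] X) : Set X)) {c δ : ℝ}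
    (hδ : 0 < δ) (h : ∀ z, δ * ‖z‖ ^ 2 ≤ (B z z).re + c * ‖j z‖ ^ 2) :
    ∃ L : X →ₗ.[ℂ] X, IsSelfAdjoint L ∧ ∀ u w, (u, w) ∈ L.graph ↔
      ∃ z ∈ W, j z = u ∧ ∀ z' ∈ W, B z' z = inner ℂ (j z') w := by
  have : CompleteSpace W := hW.completeSpace_coe
  let ι : W →L[ℂ] V := W.subtypeL
  obtain ⟨L, hL, hg⟩ := exists_isSelfAdjoint_graph_eq_formGraph (j.comp ι)
    (fun x y hxy => Subtype.ext (hj hxy))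
    (hd.mono (by rintro _ ⟨z, hz, rfl⟩; exact ⟨⟨z, hz⟩, rfl⟩)) (B.bilinearComp ι ι)
    (fun x y => hB _ _) hδ fun z => h z.1
  refine ⟨L, hL, fun u w => ?_⟩
  rw [hg]
  constructor
  · rintro ⟨z, hz, h⟩
    exact ⟨z.1, z.2, hz, fun z' hz' => h ⟨z', hz'⟩⟩
  · rintro ⟨z, hz, hu, h⟩
    exact ⟨⟨z, hz⟩, hu, fun z' => h z'.1 z'.2⟩

/-- For an operator given by a coercive form on `V`, form convergence is convergence in `V`. -/
theorem formConverges_iff_of_form {j : V →L[ℂ] X} {B : V →L⋆[ℂ] V →L[ℂ] ℂ} {c δ : ℝ} (hδ : 0 < δ)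
    (h : ∀ z, δ * ‖z‖ ^ 2 ≤ (B z z).re + c * ‖j z‖ ^ 2) {T : X →ₗ.[ℂ] X} {x : ℕ → T.domain}
    {y : ℕ → V} (hy : ∀ k, j (y k) = x k)
    (hT : ∀ k l, inner ℂ ((x k - x l : T.domain) : X) (T (x k - x l)) =
      B (y k - y l) (y k - y l)) {u : X} :
    FormConverges T x u ↔ ∃ z, j z = u ∧ Tendsto y atTop (𝓝 z) := by
  have hBc : Continuous fun z => B z z := B.continuous.clm_apply continuous_id
  constructor
  · rintro ⟨h1, h2⟩
    have hcau : CauchySeq y := by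
      rw [cauchySeq_iff_tendsto_dist_atTop_0]
      have h1' : Tendsto (fun p : ℕ × ℕ => ‖j (y p.1 - y p.2)‖ ^ 2) atTop (𝓝 0) := by
        have := (cauchySeq_iff_tendsto_dist_atTop_0.1 h1.cauchySeq).pow 2
        simp only [dist_eq_norm, ← hy, ← map_sub] at this
        rwa [zero_pow two_ne_zero] at this
      have h2' := (Complex.continuous_re.tendsto 0).comp h2
      have h3 := (h2'.add (h1'.const_mul c)).const_mul δ⁻¹
      simp only [Complex.zero_re, mul_zero, add_zero] at h3
      have h4 : Tendsto (fun p : ℕ × ℕ => ‖y p.1 - y p.2‖ ^ 2) atTop (𝓝 0) := by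
        refine squeeze_zero (fun p => sq_nonneg _) (fun p => ?_) h3
        rw [Function.comp_apply, hT, le_inv_mul_iff₀ hδ]
        exact h _
      have h5 := h4.sqrt
      simp only [Real.sqrt_sq (norm_nonneg _), Real.sqrt_zero] at h5
      simpa only [dist_eq_norm] using h5
    obtain ⟨z, hz⟩ := cauchySeq_tendsto_of_complete hcau
    refine ⟨z, tendsto_nhds_unique ((j.continuous.tendsto z).comp hz) ?_, hz⟩
    exact h1.congr fun k => (hy k).symm
  · rintro ⟨z, rfl, hz⟩
    refine ⟨((j.continuous.tendsto z).comp hz).congr hy, ?_⟩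
    have hd : Tendsto (fun p : ℕ × ℕ => y p.1 - y p.2) atTop (𝓝 0) := by
      rw [tendsto_zero_iff_norm_tendsto_zero]
      simpa only [dist_eq_norm] using cauchySeq_iff_tendsto_dist_atTop_0.1 hz.cauchySeq
    have := (hBc.tendsto 0).comp hd
    rw [map_zero] at this
    exact this.congr fun p => (hT _ _).symm

/-- An operator associated with the closure of the form `(Tx | y)`, realized as a form on `V`, is
the Friedrichs extension of `T`. -/
theorem isFriedrichsExtension_of_form {j : V →L[ℂ] X} (hj : Function.Injective j)
    {B : V →L⋆[ℂ] V →L[ℂ] ℂ} {c δ : ℝ} (hδ : 0 < δ)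
    (h : ∀ z, δ * ‖z‖ ^ 2 ≤ (B z z).re + c * ‖j z‖ ^ 2) {D : Submodule ℂ V} {T L : X →ₗ.[ℂ] X}
    (hdom : ∀ u, u ∈ T.domain ↔ ∃ z ∈ D, j z = u)
    (hT : ∀ (u : T.domain) (z : V), j z = u → ∀ z' ∈ D, B z' z = inner ℂ (j z') (T u))
    (hL : ∀ u w, (u, w) ∈ L.graph ↔ ∃ z ∈ D.topologicalClosure, j z = u ∧
      ∀ z' ∈ D.topologicalClosure, B z' z = inner ℂ (j z') w) :
    IsFriedrichsExtension T L := by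
  have hBc : Continuous fun p : V × V => B p.1 p.2 :=
    (B.continuous.comp continuous_fst).clm_apply continuous_snd
  choose y hym hyf using fun u : T.domain => (hdom u).1 u.2
  have hsub : ∀ u v, y (u - v) = y u - y v := fun u v => hj <| by
    rw [map_sub, hyf, hyf, hyf, Submodule.coe_sub]
  have hin : ∀ u v : T.domain, inner ℂ (v : X) (T u) = B (y v) (y u) := fun u v => by
    rw [hT u (y u) (hyf u) _ (hym v), hyf]
  have hconv : ∀ (x : ℕ → T.domain) (u : X), FormConverges T x u ↔
      ∃ z, j z = u ∧ Tendsto (fun k => y (x k)) atTop (𝓝 z) := fun x u =>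
    formConverges_iff_of_form hδ h (fun k => hyf _) fun k l => by rw [hin, hsub]
  have hmem : ∀ {x : ℕ → T.domain} {z : V}, Tendsto (fun k => y (x k)) atTop (𝓝 z) →
      z ∈ D.topologicalClosure := fun h =>
    mem_closure_of_tendsto h (Eventually.of_forall fun k => hym _)
  have hex : ∀ z ∈ D.topologicalClosure, ∃ x : ℕ → T.domain,
      Tendsto (fun k => y (x k)) atTop (𝓝 z) := by
    intro z hz
    obtain ⟨t, ht, htz⟩ := mem_closure_iff_seq_limit.1 (show z ∈ closure (D : Set V) from hz)
    refine ⟨fun k => ⟨j (t k), (hdom _).2 ⟨t k, ht k, rfl⟩⟩, htz.congr fun k => ?_⟩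
    exact hj (hyf ⟨j (t k), _⟩).symm
  have hlim : ∀ {x x' : ℕ → T.domain} {z z' : V}, Tendsto (fun k => y (x k)) atTop (𝓝 z) →
      Tendsto (fun k => y (x' k)) atTop (𝓝 z') →
      Tendsto (fun k => inner ℂ (x' k : X) (T (x k))) atTop (𝓝 (B z' z)) := by
    intro x x' z z' h h'
    simp only [hin]
    exact (hBc.tendsto (z', z)).comp (h'.prodMk_nhds h)
  intro u w
  rw [hL]
  constructor
  · rintro ⟨z, hz, hu, h⟩
    obtain ⟨x, hx⟩ := hex z hz
    refine ⟨x, (hconv x u).2 ⟨z, hu, hx⟩, fun x' v hv => ?_⟩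
    obtain ⟨z', rfl, hz'⟩ := (hconv x' v).1 hv
    rw [← h z' (hmem hz')]
    exact hlim hx hz'
  · rintro ⟨x, hx, h⟩
    obtain ⟨z, hu, hz⟩ := (hconv x u).1 hx
    refine ⟨z, hmem hz, hu, fun z' hz' => ?_⟩
    obtain ⟨x', hx'⟩ := hex z' hz'
    exact tendsto_nhds_unique (hlim hz hx') (h x' _ ((hconv x' _).2 ⟨z', rfl, hx'⟩))

end FriedrichsForm

/-! ### The Friedrichs extension of `𝓛` -/

namespace BarotropicStar

variable {s : BarotropicStar}

theorem test𝔊_le_𝔊₀ : s.test𝔊 ≤ s.𝔊₀ := s.test𝔊.le_topologicalClosure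

theorem continuous_fld : Continuous (fld : s.𝔊 → s.H) := s.fldL.continuous

/-- Elements of `𝔊₀` satisfy every closed condition that holds for test fields. -/
theorem forall_mem_𝔊₀ {p : s.𝔊 → Prop} (hp : IsClosed {z | p z})
    (h : ∀ (v : E3 → V3) (hv : IsTest s.R v), p (ofTest hv)) : ∀ z ∈ s.𝔊₀, p z := by
  intro z hz
  refine closure_minimal (fun y hy => ?_) hp hz
  obtain ⟨v, hv, hyv⟩ := hy
  have : y = ofTest hv := fld_injective (fld_ofTest_eq hv hyv).symm
  rw [this]
  exact h v hv

/-- By density of test fields, `𝓛u = w` in the sense of distributions is an identity on `𝔊₀`. -/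
theorem isWeakL_iff_forall_mem_𝔊₀ (z : s.𝔊) (w : s.H) :
    IsWeakL z w ↔ ∀ z' ∈ s.𝔊₀, Q₀ z z' = inner ℂ (fld z') w := by
  rw [isWeakL_iff]
  constructor
  · intro h
    have hc : Continuous fun y : s.𝔊 => s.formQ y z :=
      s.formQ.continuous.clm_apply continuous_const
    have hc' : Continuous fun y : s.𝔊 => (inner ℂ (fld y) w : ℂ) :=
      continuous_fld.inner continuous_const
    exact forall_mem_𝔊₀ (p := fun y => s.formQ y z = inner ℂ (fld y) w) (isClosed_eq hc hc')
      fun v hv => (h v hv).symm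
  · exact fun h v hv => (h _ (test𝔊_le_𝔊₀ (ofTest_mem hv))).symm

theorem eq_zero_of_inner_test {w : s.H}
    (h : ∀ (v : E3 → V3) (hv : IsTest s.R v), inner ℂ (fld (ofTest hv)) w = 0) : w = 0 := by
  have hi : ∀ i : Fin 3, ∀ᵐ x ∂volume.restrict s.R, s.ρ x • w x i = 0 := fun i => by
    refine eq_zero_of_integral_test_smul (IntegrableOn.locallyIntegrableOn
      ((EuclideanSpace.proj (𝕜 := ℂ) i).integrable_comp
        ((memLp_ρ_smul w).integrable one_le_two))) fun φ hφ => ?_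
    have hv : IsTest s.R fun x => (EuclideanSpace.single i (φ x : ℂ) : V3) := by
      refine IsTest.toLp fun j => ?_
      by_cases hj : j = i
      · subst hj
        simpa using hφ.clm_comp Complex.ofRealCLM
      · simp only [Pi.single_apply, hj, if_false]
        exact ⟨contDiff_const, HasCompactSupport.zero, by simp [tsupport]⟩
    rw [← h _ hv, ← integral_cdot_ρ_smul_conjV]
    refine integral_congr_ae (ae_of_all _ fun x => ?_)
    simp only [cdot, PiLp.smul_apply, conjV_apply, Complex.real_smul]
    rw [Finset.sum_eq_single i (fun j _ hj => by simp [hj]) (by simp)]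
    simp
    ring
  refine Lp.ext (EventuallyEq.trans (g := fun _ => 0) (s.ae_μ_of_ae ?_)
    (Lp.coeFn_zero V3 2 s.μ).symm)
  filter_upwards [ae_all_iff.2 hi, ae_restrict_mem s.measurableSet_R] with x hx hxR
  ext i
  exact (smul_eq_zero.1 (hx i)).resolve_left (ρ_pos hxR).ne'

variable (s) in
/-- The space of classes of test fields in `ℌ`. -/
noncomputable def testH : Submodule ℂ s.H := s.test𝔊.map (s.fldL : s.𝔊 →ₗ[ℂ] s.H)

theorem mem_testH {u : s.H} : u ∈ s.testH ↔ ∃ z ∈ s.test𝔊, fld z = u := Iff.rfl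

theorem dense_testH : Dense (s.testH : Set s.H) := by
  rw [Submodule.dense_iff_topologicalClosure_eq_top, Submodule.topologicalClosure_eq_top_iff,
    Submodule.eq_bot_iff]
  exact fun w hw => eq_zero_of_inner_test fun v hv => hw _ ⟨_, ofTest_mem hv, rfl⟩

theorem formQ_coercive (z : s.𝔊) :
    1 / 2 * ‖z‖ ^ 2 ≤ (s.formQ z z).re + (s.a + 1 / 2) * ‖s.fldL z‖ ^ 2 := by
  obtain ⟨-, h, -⟩ := Qa_self_bounds z
  have e : (Qa z z).re = (Q₀ z z).re + s.a * ‖fld z‖ ^ 2 := by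
    rw [Qa, inner_self_H, Complex.add_re, Complex.re_ofReal_mul, Complex.ofReal_re]
  rw [norm_sq_𝔊, formQ_apply, fldL_apply]
  linarith

end BarotropicStar

open BarotropicStar in
theorem theorem2 (s : BarotropicStar) :
    -- `𝒜` is the scalar field with `𝔞 = -𝒜 n`, the constants `κ₁`, `κ₂` are finite, and `𝔊` is a
    -- Hilbert space
    (∀ x ∈ s.R, s.𝔞 x = -(s.𝒜 x • s.n x)) ∧
    BddAbove ((fun x => |s.𝒜 x| * √(s.γ * s.P x / s.ρ x)) '' s.R) ∧
    BddAbove ((fun x => s.γ * s.P x * |s.𝒜 x| / s.ρ x ^ 2 * ‖gradient s.ρ x‖) '' s.R) ∧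
    CompleteSpace s.𝔊 ∧
    -- `𝓛` on `C₀^∞(ℜ)` is a densely defined operator `T` in `ℌ`
    (∃ T : s.H →ₗ.[ℂ] s.H, s.IsLOnTest T ∧ Dense (T.domain : Set s.H) ∧
      -- it is symmetric, given by the form `Q₀`, and bounded below
      T.IsFormalAdjoint T ∧
      (∀ u₁ u₂ : T.domain, ∃ z₁ ∈ s.test𝔊, ∃ z₂ ∈ s.test𝔊, fld z₁ = u₁ ∧ fld z₂ = u₂ ∧
        inner ℂ (u₂ : s.H) (T u₁) = Q₀ z₁ z₂) ∧
      (∀ u : T.domain, -s.a * ‖(u : s.H)‖ ^ 2 ≤ (inner ℂ (u : s.H) (T u)).re) ∧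
      -- its Friedrichs extension `L` exists and is self-adjoint
      ∃ L : s.H →ₗ.[ℂ] s.H, IsFriedrichsExtension T L ∧ T ≤ L ∧ IsSelfAdjoint L ∧
        -- the domain of `L` is `{u ∈ 𝔊₀ | 𝓛u ∈ ℌ}`, and `Lu = 𝓛u` there
        (∀ u : s.H, u ∈ L.domain ↔ ∃ z ∈ s.𝔊₀, fld z = u ∧ ∃ w : s.H, IsWeakL z w) ∧
        (∀ z ∈ s.𝔊₀, ∀ u : L.domain, fld z = (u : s.H) → IsWeakL z (L u)) ∧
        -- `((L + a) u₁ | u₂) = Q_a(u₁, u₂)` for `u₁ ∈ D(L)` and `u₂ ∈ 𝔊₀`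
        (∀ z₁ ∈ s.𝔊₀, ∀ z₂ ∈ s.𝔊₀, ∀ u₁ : L.domain, fld z₁ = (u₁ : s.H) →
          inner ℂ (fld z₂) (L u₁ + (s.a : ℂ) • (u₁ : s.H)) = Qa z₁ z₂)) ∧
    -- the form `Q_a` is real on the diagonal and equivalent to the `𝔊`-norm
    (∀ z : s.𝔊, (Qa z z).im = 0 ∧
      (1 / 2) * ‖dvg z‖ ^ 2 ≤ (Qa z z).re ∧
      (Qa z z).re ≤ (3 / 2) * ‖dvg z‖ ^ 2
        + (2 * s.κ₁ ^ 2 + s.κ₂ + s.a) * ‖fld z‖ ^ 2) ∧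
    (∃ C > 0, ∀ z : s.𝔊, (1 / C) * ‖z‖ ^ 2 ≤ ‖fld z‖ ^ 2 + (Qa z z).re ∧
      ‖fld z‖ ^ 2 + (Qa z z).re ≤ C * ‖z‖ ^ 2) := by
  refine ⟨fun x hx => s.𝔞_eq hx, s.bddAbove_κ₁, s.bddAbove_κ₂, s.completeSpace_𝔊, ?_,
    Qa_self_bounds, Qa_equivalent⟩
  have := s.completeSpace_𝔊
  have hinj : Function.Injective s.fldL := fld_injective
  obtain ⟨L, hLsa, hg⟩ := exists_isSelfAdjoint_of_submodule (c := s.a + 1 / 2) (δ := 1 / 2) hinj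
    (B := s.formQ) (fun x y => star_Q₀ y x) (W := s.𝔊₀) s.test𝔊.isClosed_topologicalClosure
    (dense_testH.mono (Submodule.map_mono test𝔊_le_𝔊₀)) (by norm_num) formQ_coercive
  -- the graph of `L` in terms of the distribution `𝓛u`
  have hgraph : ∀ u w : s.H, (u, w) ∈ L.graph ↔ ∃ z ∈ s.𝔊₀, fld z = u ∧ IsWeakL z w :=
    fun u w => by simp only [isWeakL_iff_forall_mem_𝔊₀]; exact hg u w
  have hL : ∀ (u : L.domain) (z : s.𝔊), fld z = u → z ∈ s.𝔊₀ ∧ IsWeakL z (L u) := fun u z hz => by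
    obtain ⟨z', h1, h2, h3⟩ := (hgraph u (L u)).1 (L.mem_graph u)
    obtain rfl := fld_injective (h2.trans hz.symm)
    exact ⟨h1, h3⟩
  have hLQ : ∀ (u : L.domain) (z : s.𝔊), fld z = u → ∀ z' ∈ s.𝔊₀,
      Q₀ z z' = inner ℂ (fld z') (L u) := fun u z hz =>
    (isWeakL_iff_forall_mem_𝔊₀ z (L u)).1 (hL u z hz).2
  have htest : ∀ φ (hφ : IsTest s.R φ),
      (fld (ofTest hφ), (memLp_classicalL hφ).toLp (s.classicalL φ)) ∈ L.graph := fun φ hφ =>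
    (hgraph _ _).2 ⟨_, test𝔊_le_𝔊₀ (ofTest_mem hφ), rfl, (isWeakL_classicalL hφ).congr
      ((s.ae_of_ae_μ (memLp_classicalL hφ).coeFn_toLp).mono fun _ h => h.symm)⟩
  have hsub : s.testH ≤ L.domain := by
    rintro _ ⟨z, ⟨φ, hφ, hz⟩, rfl⟩
    have e : s.fldL z = fld (ofTest hφ) := (fld_ofTest_eq hφ hz).symm
    change s.fldL z ∈ L.domain
    rw [e]
    exact LinearPMap.mem_domain_of_mem_graph (htest φ hφ)
  have hTL : L.domRestrict s.testH ≤ L := LinearPMap.domRestrict_le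
  set T : s.H →ₗ.[ℂ] s.H := L.domRestrict s.testH
  have hdom : T.domain = s.testH := inf_eq_left.2 hsub
  have hTapp : ∀ u : T.domain, T u = L ⟨u, hTL.1 u.2⟩ := fun u => hTL.2 rfl
  have hTQ : ∀ (u : T.domain) (z : s.𝔊), fld z = u → ∀ z' ∈ s.𝔊₀,
      Q₀ z z' = inner ℂ (fld z') (T u) := fun u z hz z' hz' => by
    rw [hTapp]
    exact hLQ ⟨u, hTL.1 u.2⟩ z hz z' hz'
  have hmem : ∀ u : T.domain, ∃ z ∈ s.test𝔊, fld z = u := fun u =>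
    mem_testH.1 (hdom ▸ u.2)
  have hform : ∀ u₁ u₂ : T.domain, ∃ z₁ ∈ s.test𝔊, ∃ z₂ ∈ s.test𝔊, fld z₁ = u₁ ∧ fld z₂ = u₂ ∧
      inner ℂ (u₂ : s.H) (T u₁) = Q₀ z₁ z₂ := fun u₁ u₂ => by
    obtain ⟨z₁, h1, e1⟩ := hmem u₁
    obtain ⟨z₂, h2, e2⟩ := hmem u₂
    exact ⟨z₁, h1, z₂, h2, e1, e2, by rw [hTQ u₁ z₁ e1 z₂ (test𝔊_le_𝔊₀ h2), e2]⟩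
  refine ⟨T, ⟨fun u => ?_, fun u φ hφ hu => ?_⟩, hdom ▸ dense_testH, fun u₁ u₂ => ?_, hform,
    fun u => ?_, L, ?_, hTL, hLsa, fun u => ?_, fun z _ u hz => (hL u z hz).2,
    fun z₁ _ z₂ hz₂ u₁ hu => ?_⟩
  · rw [hdom, mem_testH]
    constructor
    · rintro ⟨z, ⟨φ, hφ, h⟩, rfl⟩
      exact ⟨φ, hφ, h⟩
    · rintro ⟨φ, hφ, h⟩
      exact ⟨_, ofTest_mem hφ, fld_ofTest_eq hφ h⟩
  · have h1 := htest φ hφ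
    rw [fld_ofTest_eq hφ hu] at h1
    have h2 : T u = (memLp_classicalL hφ).toLp (s.classicalL φ) := by
      rw [hTapp]
      exact L.mem_graph_snd_inj (L.mem_graph ⟨u, hTL.1 u.2⟩) h1 rfl
    rw [h2]
    exact (memLp_classicalL hφ).coeFn_toLp
  · obtain ⟨z₁, h1, e1⟩ := hmem u₁
    obtain ⟨z₂, h2, e2⟩ := hmem u₂
    rw [← inner_conj_symm, ← e1, ← e2, ← hTQ u₁ z₁ e1 z₂ (test𝔊_le_𝔊₀ h2),
      ← hTQ u₂ z₂ e2 z₁ (test𝔊_le_𝔊₀ h1)]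
    exact star_Q₀ z₁ z₂
  · obtain ⟨z, h1, e1⟩ := hmem u
    obtain ⟨-, h, -⟩ := Qa_self_bounds z
    have h' : 0 ≤ (Qa z z).re := le_trans (by positivity) h
    rw [Qa, inner_self_H, Complex.add_re, Complex.re_ofReal_mul, Complex.ofReal_re,
      hTQ u z e1 z (test𝔊_le_𝔊₀ h1), e1] at h'
    linarith
  · exact isFriedrichsExtension_of_form hinj (δ := 1 / 2) (by norm_num) formQ_coercive
      (D := s.test𝔊) (fun u => by rw [hdom]; exact mem_testH)
      (fun u z hz z' hz' => hTQ u z hz z' (test𝔊_le_𝔊₀ hz')) hg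
  · constructor
    · intro hu
      obtain ⟨z, h1, h2, h3⟩ := (hgraph u (L ⟨u, hu⟩)).1 (L.mem_graph ⟨u, hu⟩)
      exact ⟨z, h1, h2, _, h3⟩
    · rintro ⟨z, h1, h2, w, h3⟩
      exact LinearPMap.mem_domain_of_mem_graph ((hgraph u w).2 ⟨z, h1, h2, h3⟩)
  · rw [inner_add_right, inner_smul_right, ← hLQ u₁ z₁ hu z₂ hz₂, ← hu, Qa]
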